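/- Let $F=\mathbb{F}_q$ be a finite field with $q$ elements, $q$ odd. For a unital, not necessarily associative $F$-algebra $A$ with involution $*$ and $\gamma\in F^\times$, the Dickson double $D_\gamma(A)=A\oplus iA$ has multiplication $(a+ib)(c+id)=(ac+\gamma\,d b^*)+i(a^*d+cb)$ and involution $(a+ib)^*=a^*-ib$. A Cayley algebra over $F$ is an algebra with involution isomorphic to $D_\gamma(D_\beta(D_\alpha(F)))$ for some $\alpha,\beta,\gamma\in F^\times$ (where $F$ carries the trivial involution). Let $O$ be a Cayley algebra over $F$ and $\mathrm{im}(O)=\{x\in O: x^*=-x\}$. Subalgebras are unital, and $\mathrm{im}(H)=H\cap\mathrm{im}(O)$ for a subalgebra $H$. Put $$\mathcal B=\{\mathrm{im}(H): H \text{ a four-dimensional subalgebra of } O\}.$$ A line is nilpotent if all its elements are nilpotent. A two-dimensional subspace $U\subseteq\mathrm{im}(O)$ is of type * Q if it contains no nilpotent line; * U if it contains exactly one nilpotent line $L$, and $uv\in L$ for all $u\in L$, $v\in U$; * D if it contains exactly one nilpotent line but is not of type U; more precisely Dn (resp. Ds) if it is of type D and the squares of all its non-nilpotent elements are non-squares (resp.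 squares) of $F=F1$; * M if it contains exactly two nilpotent lines; * Z if all its elements are nilpotent and all products of two of its elements vanish; * J if all its elements are nilpotent but not all such products vanish. For a subalgebra $H$ let $J(H)=\{x\in H: xy \text{ is nilpotent for all } y\in H\}$ be its Jacobson radical. A four-dimensional subalgebra $H$ of $O$ is of type * M4 if it is simple; * F2J2 (resp. S2J2) if $H=D\oplus J(H)$ as a vector space, where $J(H)$ is a (two-dimensional) space of type Z and $D$ is a subalgebra isomorphic to $D_\alpha(F)$ for some $\alpha\in F^\times$ which is a division algebra (resp. has zero divisors); * F1J3 if $\dim J(H)=3$. Write $[n]_t=1+t+\dots+t^{n-1}$, $[n]_q!=[1]_q\cdots[n]_q$ and $\binom{n}{k}_q=\frac{[n]_q!}{[n-k]_q!\,[k]_q!}$. **Theorem.** $(\mathrm{im}(O),\mathcal B)$ is a $(7,3,2)$-$q$-covering design, that is, $\dim\mathrm{im}(O)=7$, every element of $\mathcal B$ is three-dimensional, and every two-dimensional subspace of $\mathrm{im}(O)$ is contained in an element of $\mathcal B$. Let $N_Y$ be the number of four-dimensional subalgebras of $O$ of type $Y$. Then the number of blocks is $$|\mathcal B|=N_{\mathrm{M4}}+N_{\mathrm{F2J2}}+N_{\mathrm{S2J2}}+N_{\mathrm{F1J3}}=q^8+q^7+2q^6+2q^5+3q^4+2q^3+2q^2+q+1=\binom{6}{2}_q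 .$$ Moreover: 1. The number $\Theta_X$ of two-dimensional subspaces of $\mathrm{im}(O)$ of type $X$ is $\Theta_{\mathrm Q}=\tfrac12([11]_{-q}-[5]_{-q})$, $\Theta_{\mathrm U}=\Theta_{\mathrm J}=[8]_q-[2]_q$, $\Theta_{\mathrm{Dn}}=\Theta_{\mathrm{Ds}}=\tfrac12(q^9+q^8-q^3-q^2)$, $\Theta_{\mathrm M}=\tfrac12([11]_q-[5]_q)$, $\Theta_{\mathrm Z}=[6]_q$. 2. $N_{\mathrm{M4}}=q^8+q^6+q^4$, $N_{\mathrm{F2J2}}=\tfrac12(q^7-q)$, $N_{\mathrm{S2J2}}=\tfrac12(q^7+2q^6+2q^5+2q^4+2q^3+2q^2+q)$, $N_{\mathrm{F1J3}}=q^5+q^4+q^3+q^2+q+1$. 3. For every $U$ of type $X$, the number $H_{X,Y}$ of four-dimensional subalgebras of type $Y$ containing $U$ is: $H_{\mathrm{Q,M4}}=H_{\mathrm{M,M4}}=H_{\mathrm{Dn,F2J2}}=H_{\mathrm{Ds,S2J2}}=H_{\mathrm{J,F1J3}}=1$, $H_{\mathrm{U,M4}}=q^2$, $H_{\mathrm{U,S2J2}}=q+1$,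 $H_{\mathrm{Z,F2J2}}=\tfrac12(q^2-q)$, $H_{\mathrm{Z,S2J2}}=\tfrac12(q^2+q)$, $H_{\mathrm{Z,F1J3}}=q+1$, and $0$ in all other cases. 4. For every four-dimensional subalgebra $H$ of type $Y$, the number $T_{X,Y}$ of two-dimensional subspaces of $\mathrm{im}(O)$ of type $X$ contained in $H$ is: $T_{\mathrm{Q,M4}}=\tfrac12(q^2-q)$, $T_{\mathrm{U,M4}}=q+1$, $T_{\mathrm{M,M4}}=\tfrac12(q^2+q)$, $T_{\mathrm{Dn,F2J2}}=q^2+q$, $T_{\mathrm{Z,F2J2}}=1$, $T_{\mathrm{U,S2J2}}=2q$, $T_{\mathrm{Ds,S2J2}}=q^2-q$, $T_{\mathrm{Z,S2J2}}=1$, $T_{\mathrm{J,F1J3}}=q^2$, $T_{\mathrm{Z,F1J3}}=q+1$, and $0$ in all other cases. -/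

import Mathlib

set_option linter.unusedSectionVars false

namespace CayleyDesign

/-! ### Algebras with involution and the Dickson double

"Algebra over `F`" means a unital, not necessarily associative algebra: a `NonAssocRing` which is an
`F`-module with bilinear multiplication (`SMulCommClass` and `IsScalarTower`). -/

/-- An involution on a (not necessarily associative) `F`-algebra: an `F`-linear anti-automorphism
whose square is the identity. -/
class InvolutiveAlgebra (F : Type*) (A : Type*) [Field F] [NonAssocRing A] [Module F A] where
  conj : A →ₗ[F] A
  conj_conj : ∀ a : A, conj (conj a) = a
  conj_mul : ∀ a b : A, conj (a * b) = conj b * conj a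

/-- The involution of an algebra with involution. -/
def conj (F : Type*) {A : Type*} [Field F] [NonAssocRing A] [Module F A] [InvolutiveAlgebra F A] :
    A →ₗ[F] A :=
  InvolutiveAlgebra.conj

/-- The one-dimensional algebra `F`, whose involution is the identity. -/
instance instInvolutiveSelf (F : Type*) [Field F] : InvolutiveAlgebra F F where
  conj := LinearMap.id
  conj_conj _ := rfl
  conj_mul a b := mul_comm a b

/-- The Dickson double `D_γ(A)`: the pair `(a, b)` stands for `a + ib`, where `i² = γ`. -/
def DicksonDouble {F : Type*} (A : Type*) (_γ : F) : Type _ := A × A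

namespace DicksonDouble

variable {F : Type*} {A : Type*} [Field F] [NonAssocRing A] [Module F A]

instance instAddCommGroup (γ : F) : AddCommGroup (DicksonDouble A γ) :=
  inferInstanceAs (AddCommGroup (A × A))

instance instModule (γ : F) : Module F (DicksonDouble A γ) :=
  inferInstanceAs (Module F (A × A))

/-- The element `a + ib`. -/
def mk (γ : F) (a b : A) : DicksonDouble A γ := (a, b)

/-- The component `a` of `a + ib`. -/
def re {γ : F} (x : DicksonDouble A γ) : A := Prod.fst x

/-- The component `b` of `a + ib`. -/
def im {γ : F} (x : DicksonDouble A γ) : A := Prod.snd x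

theorem ext' {γ : F} {x y : DicksonDouble A γ} (h₁ : x.re = y.re) (h₂ : x.im = y.im) : x = y :=
  Prod.ext h₁ h₂

@[simp] theorem re_mk (γ : F) (a b : A) : (mk γ a b).re = a := rfl
@[simp] theorem im_mk (γ : F) (a b : A) : (mk γ a b).im = b := rfl
@[simp] theorem re_add {γ : F} (x y : DicksonDouble A γ) : (x + y).re = x.re + y.re := rfl
@[simp] theorem im_add {γ : F} (x y : DicksonDouble A γ) : (x + y).im = x.im + y.im := rfl
@[simp] theorem re_zero {γ : F} : (0 : DicksonDouble A γ).re = 0 := rfl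
@[simp] theorem im_zero {γ : F} : (0 : DicksonDouble A γ).im = 0 := rfl
@[simp] theorem re_smul {γ : F} (c : F) (x : DicksonDouble A γ) : (c • x).re = c • x.re := rfl
@[simp] theorem im_smul {γ : F} (c : F) (x : DicksonDouble A γ) : (c • x).im = c • x.im := rfl

instance instOne (γ : F) : One (DicksonDouble A γ) := ⟨mk γ 1 0⟩

@[simp] theorem re_one {γ : F} : (1 : DicksonDouble A γ).re = 1 := rfl
@[simp] theorem im_one {γ : F} : (1 : DicksonDouble A γ).im = 0 := rfl

variable [InvolutiveAlgebra F A]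

/-- `(a + ib)(c + id) = (ac + γ d b*) + i(a* d + c b)`. -/
instance instMul (γ : F) : Mul (DicksonDouble A γ) :=
  ⟨fun x y => mk γ (x.re * y.re + γ • (y.im * conj F x.im)) (conj F x.re * y.im + y.re * x.im)⟩

@[simp] theorem re_mul {γ : F} (x y : DicksonDouble A γ) :
    (x * y).re = x.re * y.re + γ • (y.im * conj F x.im) := rfl
@[simp] theorem im_mul {γ : F} (x y : DicksonDouble A γ) :
    (x * y).im = conj F x.re * y.im + y.re * x.im := rfl

end DicksonDouble

@[simp] theorem conj_conj {F A : Type*} [Field F] [NonAssocRing A] [Module F A]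
    [InvolutiveAlgebra F A] (a : A) : conj F (conj F a) = a :=
  InvolutiveAlgebra.conj_conj a

@[simp] theorem conj_mul {F A : Type*} [Field F] [NonAssocRing A] [Module F A]
    [InvolutiveAlgebra F A] (a b : A) : conj F (a * b) = conj F b * conj F a :=
  InvolutiveAlgebra.conj_mul a b

@[simp] theorem conj_one {F A : Type*} [Field F] [NonAssocRing A] [Module F A]
    [InvolutiveAlgebra F A] : conj F (1 : A) = 1 := by
  have h : conj F (conj F (1 : A) * 1) = conj F (conj F (1 : A)) := by rw [mul_one]
  rw [conj_mul, conj_conj, mul_one] at h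
  exact h

namespace DicksonDouble

variable {F : Type*} {A : Type*} [Field F] [NonAssocRing A] [Module F A] [InvolutiveAlgebra F A]

instance instNonAssocRing (γ : F) : NonAssocRing (DicksonDouble A γ) :=
  { instAddCommGroup (A := A) γ, instMul (A := A) γ, instOne (A := A) γ with
    left_distrib := fun x y z => by
      apply ext'
      · simp [mul_add, add_mul, smul_add]; abel
      · simp [mul_add, add_mul]; abel
    right_distrib := fun x y z => by
      apply ext'
      · simp [mul_add, add_mul, smul_add]; abel
      · simp [mul_add, add_mul]; abel
    zero_mul := fun x => by apply ext' <;> simp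
    mul_zero := fun x => by apply ext' <;> simp
    one_mul := fun x => by apply ext' <;> simp
    mul_one := fun x => by apply ext' <;> simp }

variable [SMulCommClass F A A] [IsScalarTower F A A]

instance instSMulCommClass (γ : F) :
    SMulCommClass F (DicksonDouble A γ) (DicksonDouble A γ) :=
  ⟨fun c x y => by
    apply ext'
    · simp [smul_add, mul_smul_comm, smul_mul_assoc, smul_comm c γ]
    · simp [smul_add, mul_smul_comm, smul_mul_assoc]⟩

instance instIsScalarTower (γ : F) :
    IsScalarTower F (DicksonDouble A γ) (DicksonDouble A γ) :=
  ⟨fun c x y => by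
    apply ext'
    · simp [smul_add, mul_smul_comm, smul_mul_assoc, smul_comm c γ]
    · simp [smul_add, mul_smul_comm, smul_mul_assoc]⟩

/-- The involution `(a + ib)* = a* - ib`; it extends that of `A` and satisfies `i* = -i`. -/
instance instInvolutive (γ : F) : InvolutiveAlgebra F (DicksonDouble A γ) where
  conj :=
    { toFun := fun x => mk γ (conj F x.re) (-x.im)
      map_add' := fun x y => by
        apply ext'
        · simp
        · simp; abel
      map_smul' := fun c x => by apply ext' <;> simp }
  conj_conj x := by
    apply ext'
    · change conj F (conj F x.re) = x.re
      simp
    · change - -x.im = x.im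
      simp
  conj_mul x y := by
    apply ext'
    · change conj F (x.re * y.re + γ • (y.im * conj F x.im)) =
        conj F y.re * conj F x.re + γ • (-x.im * conj F (-y.im))
      simp
    · change -(conj F x.re * y.im + y.re * x.im) =
        conj F (conj F y.re) * -x.im + conj F x.re * -y.im
      simp

end DicksonDouble

/-- `O` is a Cayley algebra (octonion algebra) over `F`: an eight-dimensional Cayley–Dickson
algebra, i.e. (an isomorphic copy of) `D_γ(D_β(D_α(F)))` with `α, β, γ` nonzero, with its
involution. -/
def IsCayleyAlgebra (F O : Type*) [Field F] [NonAssocRing O] [Module F O]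
    [InvolutiveAlgebra F O] : Prop :=
  ∃ α β γ : F, α ≠ 0 ∧ β ≠ 0 ∧ γ ≠ 0 ∧
    ∃ e : DicksonDouble (DicksonDouble (DicksonDouble F α) β) γ ≃ₗ[F] O,
      (∀ x y, e (x * y) = e x * e y) ∧ ∀ x, e (conj F x) = conj F (e x)

section

variable (F : Type*) {O : Type*} [Field F] [NonAssocRing O] [Module F O]

/-- The space `im(O)` of imaginary elements, `x* = -x`. -/
def imag (O : Type*) [NonAssocRing O] [Module F O] [InvolutiveAlgebra F O] : Submodule F O where
  carrier := {x | conj F x = -x}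
  zero_mem' := by simp
  add_mem' := fun {x y} hx hy => by
    change conj F (x + y) = -(x + y)
    rw [map_add, show conj F x = -x from hx, show conj F y = -y from hy, neg_add]
  smul_mem' := fun c x hx => by
    change conj F (c • x) = -(c • x)
    rw [map_smul, show conj F x = -x from hx, smul_neg]

variable {F}

/-! ### Subalgebras, nilpotent elements, radicals -/

/-- A linear subspace which is a (unital) subalgebra. -/
def IsSubalgebra (H : Submodule F O) : Prop :=
  1 ∈ H ∧ ∀ x ∈ H, ∀ y ∈ H, x * y ∈ H

/-- A four-dimensional (unital) subalgebra. -/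
def IsSubalgebra4 (H : Submodule F O) : Prop :=
  IsSubalgebra H ∧ Module.finrank F H = 4

/-- Powers `xⁿ`; the bracketing is irrelevant in alternative algebras. -/
def power (x : O) : ℕ → O
  | 0 => 1
  | n + 1 => power x n * x

/-- `x` is nilpotent: some power of `x` vanishes. -/
def Nilpotent (x : O) : Prop :=
  ∃ n : ℕ, power x n = 0

/-- `I` is a two-sided ideal of the subalgebra `H`. -/
def IsIdealOf (I H : Submodule F O) : Prop :=
  I ≤ H ∧ ∀ a ∈ H, ∀ x ∈ I, a * x ∈ I ∧ x * a ∈ I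

/-- The subalgebra `H` is simple: its only two-sided ideals are `0` and `H`. -/
def IsSimpleSubalgebra (H : Submodule F O) : Prop :=
  ∀ I : Submodule F O, IsIdealOf I H → I = ⊥ ∨ I = H

/-- `J` is the Jacobson radical of the subalgebra `H`, the set of all strongly nilpotent elements:
those `x ∈ H` for which `xy` is nilpotent for every `y ∈ H`. -/
def IsJacobsonRadical (H J : Submodule F O) : Prop :=
  ∀ x, x ∈ J ↔ x ∈ H ∧ ∀ y ∈ H, Nilpotent (x * y)

/-- `D` is a division algebra: left and right multiplication by a nonzero element of `D` are
bijections of `D`. -/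
def IsDivisionSubalgebra (D : Submodule F O) : Prop :=
  ∀ a ∈ D, a ≠ 0 → ∀ b ∈ D, (∃! x, x ∈ D ∧ a * x = b) ∧ ∃! x, x ∈ D ∧ x * a = b

/-- `D` contains zero divisors (for a Cayley–Dickson algebra: `D` is split). -/
def HasZeroDivisors (D : Submodule F O) : Prop :=
  ∃ x ∈ D, x ≠ 0 ∧ ∃ y ∈ D, y ≠ 0 ∧ (x * y = 0 ∨ y * x = 0)

/-- `D` is a subalgebra which is a two-dimensional Cayley–Dickson algebra, i.e. isomorphic to
`D_α(F)` for some nonzero `α`. -/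
def IsCayleyDickson2 (D : Submodule F O) : Prop :=
  IsSubalgebra D ∧ ∃ α : F, α ≠ 0 ∧ ∃ e : DicksonDouble F α →ₗ[F] O,
    Function.Injective e ∧ (∀ x y, e (x * y) = e x * e y) ∧ LinearMap.range e = D

/-! ### Types of two-dimensional subspaces of `im(O)` -/

/-- The lines (one-dimensional subspaces) in `U` all of whose elements are nilpotent. -/
def nilpotentLines (U : Submodule F O) : Set (Submodule F O) :=
  {L | L ≤ U ∧ Module.finrank F L = 1 ∧ ∀ x ∈ L, Nilpotent x}

variable [InvolutiveAlgebra F O]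

/-- A two-dimensional subspace of `im(O)`. -/
def IsImagPlane (U : Submodule F O) : Prop :=
  U ≤ imag F O ∧ Module.finrank F U = 2

/-- Type Q: no nilpotent lines. -/
def IsTypeQ (U : Submodule F O) : Prop :=
  IsImagPlane U ∧ nilpotentLines U = ∅

/-- Type U: exactly one nilpotent line `L`, and `uv ∈ L` for all `u ∈ L`, `v ∈ U`. -/
def IsTypeU (U : Submodule F O) : Prop :=
  IsImagPlane U ∧ ∃ L, nilpotentLines U = {L} ∧ ∀ u ∈ L, ∀ v ∈ U, u * v ∈ L

/-- Type D: exactly one nilpotent line, but not type U. -/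
def IsTypeD (U : Submodule F O) : Prop :=
  IsImagPlane U ∧ ∃ L, nilpotentLines U = {L} ∧ ¬ ∀ u ∈ L, ∀ v ∈ U, u * v ∈ L

/-- Type Dn: type D, and every non-nilpotent element squares to a non-square of `F`. -/
def IsTypeDn (U : Submodule F O) : Prop :=
  IsTypeD U ∧ ∀ v ∈ U, ¬ Nilpotent v → ∃ c : F, v * v = c • (1 : O) ∧ ¬ IsSquare c

/-- Type Ds: type D, and every non-nilpotent element squares to a square of `F`. -/
def IsTypeDs (U : Submodule F O) : Prop :=
  IsTypeD U ∧ ∀ v ∈ U, ¬ Nilpotent v → ∃ c : F, v * v = c • (1 : O) ∧ IsSquare c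

/-- Type M: exactly two nilpotent lines. -/
def IsTypeM (U : Submodule F O) : Prop :=
  IsImagPlane U ∧ (nilpotentLines U).ncard = 2

/-- Type Z: all elements are nilpotent and all products vanish. -/
def IsTypeZ (U : Submodule F O) : Prop :=
  IsImagPlane U ∧ (∀ x ∈ U, Nilpotent x) ∧ ∀ x ∈ U, ∀ y ∈ U, x * y = 0

/-- Type J: all elements are nilpotent but not all products vanish. -/
def IsTypeJ (U : Submodule F O) : Prop :=
  IsImagPlane U ∧ (∀ x ∈ U, Nilpotent x) ∧ ¬ ∀ x ∈ U, ∀ y ∈ U, x * y = 0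

/-! ### Types of four-dimensional subalgebras of `O` -/

/-- Type M4: a simple four-dimensional subalgebra. -/
def IsTypeM4 (H : Submodule F O) : Prop :=
  IsSubalgebra4 H ∧ IsSimpleSubalgebra H

/-- Type F2J2: `H = D ⊕ J(H)` with `J(H)` of type Z and `D` a two-dimensional Cayley–Dickson
division algebra. -/
def IsTypeF2J2 (H : Submodule F O) : Prop :=
  IsSubalgebra4 H ∧ ∃ D J : Submodule F O, IsJacobsonRadical H J ∧ IsTypeZ J ∧
    IsCayleyDickson2 D ∧ IsDivisionSubalgebra D ∧ D ⊓ J = ⊥ ∧ D ⊔ J = H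

/-- Type S2J2: `H = D ⊕ J(H)` with `J(H)` of type Z and `D` a two-dimensional split
Cayley–Dickson algebra. -/
def IsTypeS2J2 (H : Submodule F O) : Prop :=
  IsSubalgebra4 H ∧ ∃ D J : Submodule F O, IsJacobsonRadical H J ∧ IsTypeZ J ∧
    IsCayleyDickson2 D ∧ HasZeroDivisors D ∧ D ⊓ J = ⊥ ∧ D ⊔ J = H

/-- Type F1J3: three-dimensional Jacobson radical. -/
def IsTypeF1J3 (H : Submodule F O) : Prop :=
  IsSubalgebra4 H ∧ ∃ J : Submodule F O, IsJacobsonRadical H J ∧ Module.finrank F J = 3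

end

/-- The seven types of two-dimensional subspaces of `im(O)`. -/
inductive PlaneType
  | Q | U | Dn | Ds | M | J | Z

/-- The four types of four-dimensional subalgebras of `O`. -/
inductive SubalgType
  | M4 | F2J2 | S2J2 | F1J3

section

variable (F O : Type*) [Field F] [NonAssocRing O] [Module F O] [InvolutiveAlgebra F O]

/-- The set of two-dimensional subspaces of `im(O)` of type `X`. -/
def planes : PlaneType → Set (Submodule F O)
  | .Q => {U | IsTypeQ U}
  | .U => {U | IsTypeU U}
  | .Dn => {U | IsTypeDn U}
  | .Ds => {U | IsTypeDs U}
  | .M => {U | IsTypeM U}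
  | .J => {U | IsTypeJ U}
  | .Z => {U | IsTypeZ U}

/-- The set of four-dimensional subalgebras of `O` of type `Y`. -/
def subalgs : SubalgType → Set (Submodule F O)
  | .M4 => {H | IsTypeM4 H}
  | .F2J2 => {H | IsTypeF2J2 H}
  | .S2J2 => {H | IsTypeS2J2 H}
  | .F1J3 => {H | IsTypeF1J3 H}

/-- The set of blocks `{im(H) : H a four-dimensional subalgebra of O}`, where
`im(H) = {x ∈ H : x* = -x}`. -/
def blocks : Set (Submodule F O) :=
  {B | ∃ H : Submodule F O, IsSubalgebra4 H ∧ B = H ⊓ imag F O}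

/-- `(V, 𝓑)` is a `(v, k, t)`-`q`-covering design: `V` is `v`-dimensional, `𝓑` consists of
`k`-dimensional subspaces of `V`, and every `t`-dimensional subspace of `V` lies in at least one
element of `𝓑`. -/
def IsCoveringDesign {F O : Type*} [Field F] [AddCommGroup O] [Module F O] (V : Submodule F O)
    (𝓑 : Set (Submodule F O)) (v k t : ℕ) : Prop :=
  Module.finrank F V = v ∧ (∀ B ∈ 𝓑, B ≤ V ∧ Module.finrank F B = k) ∧
    ∀ T : Submodule F O, T ≤ V → Module.finrank F T = t → ∃ B ∈ 𝓑, T ≤ B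

end

/-! ### `q`-numbers and the tables of values -/

/-- `[n]_q = 1 + q + ⋯ + q^(n-1)`. -/
def qNum (q : ℚ) (n : ℕ) : ℚ := ∑ i ∈ Finset.range n, q ^ i

/-- `[n]_q! = [1]_q [2]_q ⋯ [n]_q`. -/
def qFactorial (q : ℚ) (n : ℕ) : ℚ := ∏ i ∈ Finset.range n, qNum q (i + 1)

/-- The Gaussian binomial coefficient `[n]_q! / ([n-k]_q! [k]_q!)`, for `k ≤ n`. -/
def qBinom (q : ℚ) (n k : ℕ) : ℚ := qFactorial q n / (qFactorial q (n - k) * qFactorial q k)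

/-- Values of `Θ_X`. -/
def thetaTable (q : ℚ) : PlaneType → ℚ
  | .Q => (qNum (-q) 11 - qNum (-q) 5) / 2
  | .U => qNum q 8 - qNum q 2
  | .Dn => (q ^ 9 + q ^ 8 - q ^ 3 - q ^ 2) / 2
  | .Ds => (q ^ 9 + q ^ 8 - q ^ 3 - q ^ 2) / 2
  | .M => (qNum q 11 - qNum q 5) / 2
  | .J => qNum q 8 - qNum q 2
  | .Z => qNum q 6

/-- Values of `N_Y`. -/
def nTable (q : ℚ) : SubalgType → ℚ
  | .M4 => q ^ 8 + q ^ 6 + q ^ 4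
  | .F2J2 => (q ^ 7 - q) / 2
  | .S2J2 => (q ^ 7 + 2 * q ^ 6 + 2 * q ^ 5 + 2 * q ^ 4 + 2 * q ^ 3 + 2 * q ^ 2 + q) / 2
  | .F1J3 => q ^ 5 + q ^ 4 + q ^ 3 + q ^ 2 + q + 1

/-- Values of `H_{X,Y}`. -/
def hTable (q : ℚ) : PlaneType → SubalgType → ℚ
  | .Q, .M4 => 1
  | .U, .M4 => q ^ 2
  | .U, .S2J2 => q + 1
  | .Dn, .F2J2 => 1
  | .Ds, .S2J2 => 1
  | .M, .M4 => 1
  | .J, .F1J3 => 1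
  | .Z, .F2J2 => (q ^ 2 - q) / 2
  | .Z, .S2J2 => (q ^ 2 + q) / 2
  | .Z, .F1J3 => q + 1
  | _, _ => 0

/-- Values of `T_{X,Y}`. -/
def tTable (q : ℚ) : PlaneType → SubalgType → ℚ
  | .Q, .M4 => (q ^ 2 - q) / 2
  | .U, .M4 => q + 1
  | .U, .S2J2 => 2 * q
  | .Dn, .F2J2 => q ^ 2 + q
  | .Ds, .S2J2 => q ^ 2 - q
  | .M, .M4 => (q ^ 2 + q) / 2
  | .J, .F1J3 => q ^ 2
  | .Z, .F2J2 => 1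
  | .Z, .S2J2 => 1
  | .Z, .F1J3 => q + 1
  | _, _ => 0

end CayleyDesign

set_option linter.style.haveILetI false

namespace CayleyDesign

/-! In odd characteristic a Cayley algebra is alternative, and its trace `t` gives a nondegenerate
associative symmetric form `t (x * y)`. An imaginary `x` has the scalar square `t (x * x) / 2`, so
among imaginary elements nilpotent means isotropic. The plane types are therefore the isometry types
of planes, refined by a condition on products or by a square class. A four-dimensional subalgebra is
`F1 ⊕ W` with `W` its three-dimensional imaginary part, and its Jacobson radical is the radical of
the trace form (`isJacobsonRadical_iff`). Rank 3 on `W` is type M4, rank 1 is F2J2 or S2J2 according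
to the square class represented, and rank 0 is F1J3. Rank 2 is impossible: if `x` and `y` are
orthogonal and anisotropic, then so is `x * y`, and it is orthogonal to both
(`exists_mem_imagSubalgs`). The main tool is a square root `d` of 1 in `im(O)`, which exists because
the field is finite. It splits `im(O)` as `Fd` plus two totally isotropic three-dimensional
eigenspaces of left multiplication by `d`, in duality under the trace form. In these coordinates `c
d + a + b` has square `c² + t (a * b)`, so vectors of a given square can be counted
(`ncard_mul_self_eq`). Planes in a subalgebra: for M4 the isotropic points of `W` form a conic, and
types U, M, Q are its tangents, secants and exterior lines. For rank 1 the radical is the only plane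
of type Z, and any other plane meets it in a line; it has type U exactly when that line is an
eigenline of left multiplication by the anisotropic vector. For F1J3 the planes of type Z are those
through a common annihilated line. Subalgebras over a plane: by alternativity, independent imaginary
`u`, `v` span a four-dimensional subalgebra together with `1` and `u * v`, unless `u * v` lies in
`F1 + U` (`isImagSubalgebra_sup`). Hence every plane outside types U and Z lies in exactly one
subalgebra. A plane of type U is spanned by some `d` with `d² = 1` and some `u` with `d * u = u`,
and the subalgebras above it correspond to the lines of the opposite eigenspace. A plane `U` of type
Z is an ideal in its five-dimensional orthogonal space, and the subalgebras above it are the points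
of the quotient by `U`. Only the number of Z-planes is counted directly: there are `q⁶ - 1` nonzero
isotropic vectors, each in `q + 1` such planes. All other totals follow from the incidence equations
`Θ_X H_{X,Y} = N_Y T_{X,Y}` (`ncard_planes_mul`). -/

/-- `t` is the trace of a Cayley algebra `O` over `F`, a field of odd characteristic: the structure
of `O` used below. -/
structure IsCayleyTrace (F : Type*) {O : Type*} [Field F] [NonAssocRing O] [Module F O]
    [InvolutiveAlgebra F O] (t : O →ₗ[F] F) : Prop where
  two : (2 : F) ≠ 0
  conj_eq : ∀ x, conj F x = t x • 1 - x
  left_alt : ∀ x y : O, x * (x * y) = (x * x) * y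
  right_alt : ∀ x y : O, (y * x) * x = y * (x * x)
  comm : ∀ x y, t (x * y) = t (y * x)
  assoc : ∀ x y z, t ((x * y) * z) = t (x * (y * z))
  nondeg : ∀ x, (∀ y, t (x * y) = 0) → x = 0
  finrank : Module.finrank F O = 8

/-! ### The trace of an iterated Dickson double. -/

section Double

variable {F : Type*} [Field F]

theorem conj_self (a : F) : conj F a = a := rfl

namespace DicksonDouble

variable {A : Type*} [NonAssocRing A] [Module F A]

@[simp] theorem re_sub {γ : F} (x y : DicksonDouble A γ) : (x - y).re = x.re - y.re := rfl
@[simp] theorem im_sub {γ : F} (x y : DicksonDouble A γ) : (x - y).im = x.im - y.im := rfl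
@[simp] theorem re_neg {γ : F} (x : DicksonDouble A γ) : (-x).re = -x.re := rfl
@[simp] theorem im_neg {γ : F} (x : DicksonDouble A γ) : (-x).im = -x.im := rfl

/-- The double as a pair. -/
def equivProd (γ : F) : DicksonDouble A γ ≃ₗ[F] A × A where
  toFun x := (x.re, x.im)
  invFun p := mk γ p.1 p.2
  left_inv _ := rfl
  right_inv _ := rfl
  map_add' _ _ := rfl
  map_smul' _ _ := rfl

theorem finrank_eq [Module.Finite F A] (γ : F) :
    Module.finrank F (DicksonDouble A γ) = Module.finrank F A + Module.finrank F A := by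
  rw [(equivProd γ).finrank_eq, Module.finrank_prod]

theorem moduleFinite [Module.Finite F A] (γ : F) : Module.Finite F (DicksonDouble A γ) :=
  Module.Finite.equiv (equivProd γ).symm

variable [InvolutiveAlgebra F A]

@[simp] theorem re_conj {γ : F} (x : DicksonDouble A γ) : (conj F x).re = conj F x.re := rfl
@[simp] theorem im_conj {γ : F} (x : DicksonDouble A γ) : (conj F x).im = -x.im := rfl

end DicksonDouble

open DicksonDouble

/-- The trace of the triple double of `F`. -/
def doubleTrace (α β γ : F) : DicksonDouble (DicksonDouble (DicksonDouble F α) β) γ →ₗ[F] F where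
  toFun x := 2 * x.re.re.re
  map_add' x y := by simp [mul_add]
  map_smul' c x := by simp [mul_left_comm]

theorem doubleTrace_apply {α β γ : F} (x : DicksonDouble (DicksonDouble (DicksonDouble F α) β) γ) :
    doubleTrace α β γ x = 2 * x.re.re.re := rfl

set_option maxHeartbeats 1000000 in
theorem isCayleyTrace_doubleTrace (h2 : (2 : F) ≠ 0) {α β γ : F} (hα : α ≠ 0) (hβ : β ≠ 0)
    (hγ : γ ≠ 0) : IsCayleyTrace F (doubleTrace α β γ) where
  two := h2
  conj_eq x := by
    apply ext' <;> apply ext' <;> apply ext' <;> simp [doubleTrace, conj_self]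
    ring
  left_alt x y := by
    apply ext' <;> apply ext' <;> apply ext' <;>
      simp only [re_mul, im_mul, re_add, im_add, re_smul, im_smul, re_conj, im_conj, re_neg, im_neg,
        conj_self, smul_eq_mul] <;> ring
  right_alt x y := by
    apply ext' <;> apply ext' <;> apply ext' <;>
      simp only [re_mul, im_mul, re_add, im_add, re_smul, im_smul, re_conj, im_conj, re_neg, im_neg,
        conj_self, smul_eq_mul] <;> ring
  comm x y := by
    simp only [doubleTrace_apply, re_mul, re_add, re_smul, re_conj, im_conj, re_neg, im_neg,
      conj_self, smul_eq_mul]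
    ring
  assoc x y z := by
    simp only [doubleTrace_apply, re_mul, im_mul, re_add, im_add, re_smul, im_smul, re_conj,
      im_conj, re_neg, im_neg, conj_self, smul_eq_mul]
    ring
  nondeg x hx := by
    have key : ∀ a b c d e f g k : F,
        doubleTrace α β γ (x * mk γ (mk β (mk α a b) (mk α c d)) (mk β (mk α e f) (mk α g k))) =
          0 := fun a b c d e f g k => hx _
    simp [doubleTrace, conj_self, h2] at key
    -- Pairing with the eight basis vectors isolates the coordinates of `x`, up to sign and nonzero
    -- factors.
    have e1 := key 1 0 0 0 0 0 0 0
    have e2 := key 0 1 0 0 0 0 0 0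
    have e3 := key 0 0 1 0 0 0 0 0
    have e4 := key 0 0 0 1 0 0 0 0
    have e5 := key 0 0 0 0 1 0 0 0
    have e6 := key 0 0 0 0 0 1 0 0
    have e7 := key 0 0 0 0 0 0 1 0
    have e8 := key 0 0 0 0 0 0 0 1
    simp [hα, hβ, hγ] at e1 e2 e3 e4 e5 e6 e7 e8
    apply ext' <;> apply ext' <;> apply ext' <;> simp [*]
  finrank := by
    have := moduleFinite (A := F) α
    have := moduleFinite (A := DicksonDouble F α) β
    rw [finrank_eq, finrank_eq, finrank_eq, Module.finrank_self]

end Double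

open DicksonDouble

variable {F O : Type*} [Field F] [NonAssocRing O] [Module F O] [InvolutiveAlgebra F O]

/-- The structure is transported along the isomorphism. The square root `d` of 1 is where finiteness
of `F` enters: it makes every Cayley algebra here split. -/
theorem IsCayleyAlgebra.exists_trace [Finite F] (h2 : (2 : F) ≠ 0) (hO : IsCayleyAlgebra F O) :
    ∃ t : O →ₗ[F] F, IsCayleyTrace F t ∧ ∃ d : O, t d = 0 ∧ d * d = 1 := by
  obtain ⟨α, β, γ, hα, hβ, hγ, e, hmul, hconj⟩ := hO
  have h := isCayleyTrace_doubleTrace h2 hα hβ hγ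
  have hs : ∀ x y, e.symm (x * y) = e.symm x * e.symm y := fun x y => by
    apply e.injective; rw [hmul]; simp
  have h1 : e 1 = 1 := by
    have := hmul 1 (e.symm 1)
    rw [one_mul, e.apply_symm_apply, mul_one] at this
    exact this.symm
  have hs1 : e.symm 1 = 1 := by rw [← h1, e.symm_apply_apply]
  refine ⟨doubleTrace α β γ ∘ₗ e.symm.toLinearMap, ?_, ?_⟩
  · constructor
    · exact h2
    · intro x
      obtain ⟨x, rfl⟩ := e.surjective x
      rw [← hconj, h.conj_eq]
      simp [h1]
    · intro x y
      apply e.symm.injective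
      simp only [hs, h.left_alt]
    · intro x y
      apply e.symm.injective
      simp only [hs, h.right_alt]
    · intro x y
      simpa [hs] using h.comm _ _
    · intro x y z
      simpa [hs] using h.assoc _ _ _
    · intro x hx
      apply e.symm.injective
      rw [map_zero]
      refine h.nondeg _ fun y => ?_
      have := hx (e y)
      simpa [hs] using this
    · rw [← e.finrank_eq, h.finrank]
  · haveI := Fintype.ofFinite F
    obtain ⟨x, y, hxy⟩ := FiniteField.exists_root_sum_quadratic
      (f := Polynomial.C α * Polynomial.X ^ 2 - Polynomial.C 1)
      (g := Polynomial.C β * Polynomial.X ^ 2)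
      (by compute_degree!) (by compute_degree!) (FiniteField.odd_card_of_char_ne_two fun hc => h2 (by
        have := CharP.cast_eq_zero F (ringChar F)
        rwa [hc, Nat.cast_two] at this))
    simp at hxy
    -- The two generators used here anticommute and have squares `α` and `β`, so this combination
    -- has square `α x² + β y² = 1`.
    refine ⟨e (mk γ (mk β (mk α 0 x) (mk α y 0)) 0), ?_, ?_⟩
    · simp [doubleTrace]
    · rw [← hmul, ← h1]
      congr 1
      apply ext' <;> apply ext' <;> apply ext' <;> simp [conj_self]
      · linear_combination hxy

/-! ### Quadratic and alternative identities; nilpotent elements. -/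

namespace IsCayleyTrace

variable [SMulCommClass F O O] [IsScalarTower F O O] {t : O →ₗ[F] F} (h : IsCayleyTrace F t)
include h

theorem nontrivial : Nontrivial O :=
  Module.nontrivial_of_finrank_pos (R := F) (by rw [h.finrank]; norm_num)

theorem moduleFinite : Module.Finite F O :=
  Module.finite_of_finrank_pos (by rw [h.finrank]; norm_num)

theorem smul_one_inj {c : F} (hc : c • (1 : O) = 0) : c = 0 := by
  haveI := h.nontrivial
  exact (smul_eq_zero.1 hc).resolve_right one_ne_zero

theorem trace_one : t 1 = 2 := by
  have h1 := h.conj_eq 1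
  rw [conj_one] at h1
  have : (t 1 - 2) • (1 : O) = 0 := by linear_combination (norm := module) -h1
  linear_combination h.smul_one_inj this

theorem mem_imag {x : O} : x ∈ imag F O ↔ t x = 0 := by
  change conj F x = -x ↔ _
  rw [h.conj_eq]
  constructor
  · intro hx
    exact h.smul_one_inj (by linear_combination (norm := module) hx)
  · intro hx
    simp [hx]

/-- The polarized quadratic equation of `O`: expand `conj (x * y) = conj y * conj x` using `conj x =
t x - x`. -/
theorem quadratic (x y : O) :
    x * y + y * x = t x • y + t y • x + (t (x * y) - t x * t y) • 1 := by
  have h1 : conj F (x * y) = conj F y * conj F x := conj_mul x y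
  simp only [h.conj_eq, sub_mul, mul_sub, smul_mul_assoc, mul_smul_comm, one_mul, mul_one] at h1
  linear_combination (norm := module) -h1

theorem add_comm_mul {x y : O} (hx : t x = 0) (hy : t y = 0) : x * y + y * x = t (x * y) • 1 := by
  rw [h.quadratic, hx, hy]; simp

theorem mul_eq_neg {x y : O} (hx : t x = 0) (hy : t y = 0) (hxy : t (x * y) = 0) :
    y * x = -(x * y) := by
  have := h.add_comm_mul hx hy
  rw [hxy, zero_smul] at this
  exact eq_neg_of_add_eq_zero_right this

theorem mul_self {x : O} (hx : t x = 0) : x * x = (t (x * x) / 2) • 1 := by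
  have := h.add_comm_mul hx hx
  have h2 := h.two
  have e : (2 : F) • (x * x) = (2 : F) • ((t (x * x) / 2) • (1 : O)) := by
    rw [smul_smul, mul_div_cancel₀ _ h2, ← this, two_smul]
  exact smul_right_injective O h2 e

theorem mul_self_eq_zero {x : O} (hx : t x = 0) : x * x = 0 ↔ t (x * x) = 0 :=
  ⟨fun e => by rw [e, map_zero], fun e => by rw [h.mul_self hx, e]; simp⟩

/-- Linearization of the alternative law; with `right_alt_add` it replaces associativity in nearly
all later computations. -/
theorem left_alt_add (x y z : O) : x * (y * z) + y * (x * z) = (x * y + y * x) * z := by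
  have h1 := h.left_alt (x + y) z
  have h2 := h.left_alt x z
  have h3 := h.left_alt y z
  simp only [add_mul, mul_add] at h1 ⊢
  linear_combination (norm := module) h1 - h2 - h3

theorem right_alt_add (x y z : O) : (z * x) * y + (z * y) * x = z * (x * y + y * x) := by
  have h1 := h.right_alt (x + y) z
  have h2 := h.right_alt x z
  have h3 := h.right_alt y z
  simp only [add_mul, mul_add] at h1 ⊢
  linear_combination (norm := module) h1 - h2 - h3

theorem flexible (x y : O) : (x * y) * x = x * (y * x) := by
  have h1 := h.left_alt_add x y x
  have h2 := h.right_alt x y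
  simp only [add_mul] at h1
  rw [h2] at h1
  linear_combination (norm := module) -h1

theorem power_ne_zero {x : O} (hx : t x ≠ 0 ∨ x * x ≠ 0) (n : ℕ) : power x n ≠ 0 := by
  haveI := h.nontrivial
  have h2 := h.two
  -- `m` is the norm of `x`, so that `x² = t(x) x - m`.
  set m : F := (t x * t x - t (x * x)) / 2 with hm
  have hq : x * x = t x • x - m • 1 := by
    have e : (2 : F) • (x * x) = (2 : F) • (t x • x - m • (1 : O)) := by
      have := h.quadratic x x
      have hm' : t (x * x) = t x * t x - 2 * m := by rw [hm]; field_simp; ring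
      rw [hm'] at this
      linear_combination (norm := module) this
    exact smul_right_injective O h2 e
  by_cases hm0 : m = 0
  · have hx0 : x ≠ 0 := by rintro rfl; simp at hx
    have htx : t x ≠ 0 := by
      intro h0; rw [hq, h0, hm0] at hx; simp at hx
    have : ∀ n, power x (n + 1) = (t x) ^ n • x := by
      intro n
      induction n with
      | zero => simp [power]
      | succ n ih => rw [power, ih, smul_mul_assoc, hq, hm0, zero_smul, sub_zero, smul_smul,
          pow_succ]
    cases n with
    | zero => simp [power]
    | succ n => rw [this]; exact smul_ne_zero (pow_ne_zero _ htx) hx0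
  -- With nonzero norm, right multiplication by `x` is injective: `p x = 0` forces `0 = (p x) x = p
  -- x² = -m p`.
  · induction n with
    | zero => simp [power]
    | succ n ih =>
      intro h0
      have h1 := h.right_alt x (power x n)
      rw [power] at h0
      rw [h0, zero_mul, hq, mul_sub, mul_smul_comm, h0, smul_zero, zero_sub, mul_smul_comm,
        mul_one] at h1
      exact smul_ne_zero hm0 ih (neg_eq_zero.1 h1.symm)

theorem nilpotent_iff {x : O} : Nilpotent x ↔ t x = 0 ∧ x * x = 0 := by
  constructor
  · rintro ⟨n, hn⟩
    by_contra hc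
    exact h.power_ne_zero (by tauto) n hn
  · rintro ⟨-, h2⟩
    exact ⟨2, by simp [power, h2]⟩

/-- An isotropic plane closed under multiplication has zero multiplication. -/
theorem mul_eq_zero_of_mul_mem {u v : O} (hu : u * u = 0) (hv : v * v = 0) {a b : F}
    (huv : u * v = a • u + b • v) : u * v = 0 := by
  -- The identities `u(uv) = 0` and `(uv)v = 0` become `b(uv) = 0` and `a(uv) = 0`; a nonzero `uv`
  -- would force `a = b = 0`.
  have h1 := h.left_alt u v
  have h2 := h.right_alt v u
  rw [hu, huv, zero_mul, mul_add, mul_smul_comm, mul_smul_comm, hu, smul_zero, zero_add] at h1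
  rw [hv, huv, mul_zero, add_mul, smul_mul_assoc, smul_mul_assoc, hv, smul_zero, add_zero] at h2
  by_contra hne
  have ha := (smul_eq_zero.1 h2).resolve_right hne
  have hb := (smul_eq_zero.1 h1).resolve_right hne
  exact hne (by rw [huv, ha, hb]; simp)

end IsCayleyTrace

/-! ### Peirce decomposition with respect to a square root of one. -/

/-- The eigenspace of left multiplication by the imaginary element `d`, where `d² = 1`. -/
def peirce [SMulCommClass F O O] (t : O →ₗ[F] F) (d : O) : Submodule F O where
  carrier := {x | t x = 0 ∧ d * x = x}
  zero_mem' := by simp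
  add_mem' := fun {x y} hx hy => by
    simp only [Set.mem_ofPred_eq] at *
    rw [map_add, mul_add, hx.1, hy.1, hx.2, hy.2]; simp
  smul_mem' := fun c x hx => by
    simp only [Set.mem_ofPred_eq] at *
    rw [map_smul, mul_smul_comm, hx.1, hx.2]; simp

theorem mem_peirce [SMulCommClass F O O] {t : O →ₗ[F] F} {d x : O} :
    x ∈ peirce t d ↔ t x = 0 ∧ d * x = x := Iff.rfl

theorem mem_peirce_neg [SMulCommClass F O O] {t : O →ₗ[F] F} {d x : O} :
    x ∈ peirce t (-d) ↔ t x = 0 ∧ d * x = -x := by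
  rw [mem_peirce, neg_mul, neg_eq_iff_eq_neg]

namespace IsCayleyTrace

variable [SMulCommClass F O O] [IsScalarTower F O O] {t : O →ₗ[F] F} (h : IsCayleyTrace F t)
include h

/-- Nondegeneracy on imaginary elements. -/
theorem eq_zero_of_imag {x : O} (hx : t x = 0) (hxy : ∀ y, t y = 0 → t (x * y) = 0) : x = 0 := by
  refine h.nondeg x fun y => ?_
  have h2 := h.two
  have := hxy (y - (t y / 2) • 1) (by rw [map_sub, map_smul, h.trace_one]; simp [h2])
  rwa [mul_sub, map_sub, mul_smul_comm, mul_one, map_smul, hx, smul_zero, sub_zero] at this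

section Peirce

variable {d : O} (hd : t d = 0) (hdd : d * d = 1)
include hd

theorem peirce_trace {x : O} (hx : x ∈ peirce t d) : t (d * x) = 0 := by rw [hx.2, hx.1]

theorem peirce_mul {x : O} (hx : x ∈ peirce t d) : x * d = -x := by
  rw [h.mul_eq_neg hd hx.1 (h.peirce_trace hd hx), hx.2]

/-- Associativity of the trace moves `d` from the left of `x` to the right of `y`, where it acts as
`-1`. -/
theorem peirce_trace_mul {x y : O} (hx : x ∈ peirce t d) (hy : y ∈ peirce t d) :
    t (x * y) = 0 := by
  have h1 : t (x * y) = -t (x * y) := by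
    conv_lhs => rw [← hx.2, h.assoc, h.comm, h.assoc, h.peirce_mul hd hy, mul_neg, map_neg]
  have h2 := h.two
  have : 2 * t (x * y) = 0 := by linear_combination h1
  exact (mul_eq_zero.1 this).resolve_left h2

/-- Since `d` anticommutes with `x`, it satisfies `d(xy) = -x(dy)`. On an eigenspace the product
thus behaves like a cross product with values in the opposite eigenspace. -/
theorem peirce_mul_mem {x y : O} (hx : x ∈ peirce t d) (hy : y ∈ peirce t d) :
    x * y ∈ peirce t (-d) := by
  rw [mem_peirce_neg]
  refine ⟨h.peirce_trace_mul hd hx hy, ?_⟩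
  have h1 := h.left_alt_add d x y
  rw [hy.2, hx.2, h.peirce_mul hd hx, add_neg_cancel, zero_mul] at h1
  exact eq_neg_of_add_eq_zero_left h1

theorem peirce_mul_neg {x : O} (hx : x ∈ peirce t (-d)) : x * d = x := by
  have := h.peirce_mul (d := -d) (by simp [hd]) hx
  simpa using this

theorem peirce_neg_trace_mul {x y : O} (hx : x ∈ peirce t (-d)) (hy : y ∈ peirce t (-d)) :
    t (x * y) = 0 := h.peirce_trace_mul (d := -d) (by simp [hd]) hx hy

theorem peirce_self_mul {x : O} (hx : x ∈ peirce t d) : x * x = 0 :=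
  (h.mul_self_eq_zero hx.1).2 (h.peirce_trace_mul hd hx hx)

theorem peirce_neg_self_mul {x : O} (hx : x ∈ peirce t (-d)) : x * x = 0 :=
  (h.mul_self_eq_zero hx.1).2 (h.peirce_neg_trace_mul hd hx hx)

theorem disjoint_peirce {x : O} (hx : x ∈ peirce t d) (hy : x ∈ peirce t (-d)) : x = 0 := by
  have h1 := hx.2
  rw [(mem_peirce_neg.1 hy).2] at h1
  have h2 := h.two
  have : (2 : F) • x = 0 := by linear_combination (norm := module) -h1
  exact (smul_eq_zero.1 this).resolve_left h2

include hdd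

/-- The components of an imaginary element. -/
theorem exists_peirce {x : O} (hx : t x = 0) :
    ∃ a b, a ∈ peirce t d ∧ b ∈ peirce t (-d) ∧ x = (t (d * x) / 2) • d + a + b ∧
      d * x = (t (d * x) / 2) • 1 + (a - b) := by
  have h2 := h.two
  set α := t (d * x) / 2 with hα
  set y := x - α • d with hy
  have hty : t y = 0 := by simp [hy, hx, hd]
  have htd : t (d * y) = 0 := by
    rw [hy, mul_sub, mul_smul_comm, hdd, map_sub, map_smul, h.trace_one, hα]
    simp [h2]
  have hddy : d * (d * y) = y := by rw [h.left_alt, hdd, one_mul]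
  -- On the part `y` of `x` orthogonal to `d`, left multiplication by `d` is an involution; these
  -- are its two eigenprojections.
  refine ⟨(1 / 2 : F) • (y + d * y), (1 / 2 : F) • (y - d * y), ?_, ?_, ?_, ?_⟩
  · rw [mem_peirce, map_smul, map_add, hty, htd, mul_smul_comm, mul_add, hddy, add_comm y]
    simp
  · rw [mem_peirce_neg, map_smul, map_sub, hty, htd, mul_smul_comm, mul_sub, hddy, ← smul_neg]
    simp
  · have : x = α • d + y := by rw [hy]; abel
    conv_lhs => rw [this]
    match_scalars <;> field_simp <;> ring
  · have : x = α • d + y := by rw [hy]; abel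
    conv_lhs => rw [this]
    rw [mul_add, mul_smul_comm, hdd]
    match_scalars <;> field_simp <;> ring

/-- An element commuting with `d` is in the span of `1` and `d`. -/
theorem eq_of_commute {x : O} (hx : t x = 0) (hc : d * x = x * d) : x = (t (d * x) / 2) • d := by
  have h1 := h.add_comm_mul hd hx
  have h2 := h.two
  have h3 : d * x = (t (d * x) / 2) • 1 := by
    rw [← hc, ← two_smul F] at h1
    apply smul_right_injective O h2
    dsimp only
    rw [h1, smul_smul, mul_div_cancel₀ _ h2]
  have h4 : d * (d * x) = x := by rw [h.left_alt, hdd, one_mul]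
  rw [← h4]
  conv_lhs => rw [h3]
  rw [mul_smul_comm, mul_one, h4]

/-- Multiplication by `d` on either side fixes `x * y`. Its imaginary part therefore commutes with
`d` and is a multiple of `d`. -/
theorem peirce_mul_peirce_neg {x y : O} (hx : x ∈ peirce t d) (hy : y ∈ peirce t (-d)) :
    x * y = (t (x * y) / 2) • (1 + d) := by
  have h2 := h.two
  have hdy := (mem_peirce_neg.1 hy).2
  have hyd := h.peirce_mul_neg hd hy
  have hxd := h.peirce_mul hd hx
  have e1 : d * (x * y) = x * y := by
    have h1 := h.left_alt_add d x y
    rw [hdy, hx.2, hxd, add_neg_cancel, zero_mul, mul_neg] at h1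
    linear_combination (norm := module) h1
  have e2 : (x * y) * d = x * y := by
    have h1 := h.right_alt_add y d x
    rw [hdy, hyd, hxd, add_neg_cancel, mul_zero, neg_mul] at h1
    linear_combination (norm := module) h1
  set z := x * y - (t (x * y) / 2) • (1 : O) with hz
  have htz : t z = 0 := by rw [hz, map_sub, map_smul, h.trace_one]; simp [h2]
  have e3 := h.eq_of_commute hd hdd htz
    (by rw [hz, mul_sub, sub_mul, e1, e2, mul_smul_comm, smul_mul_assoc, mul_one, one_mul])
  have e4 : t (d * z) = t (x * y) := by
    rw [hz, mul_sub, e1, mul_smul_comm, mul_one, map_sub, map_smul, hd]; simp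
  rw [e4] at e3
  rw [smul_add, ← e3, hz]; abel

theorem peirce_neg_mul_peirce {x y : O} (hx : x ∈ peirce t (-d)) (hy : y ∈ peirce t d) :
    x * y = (t (x * y) / 2) • (1 - d) := by
  have := h.peirce_mul_peirce_neg (d := -d) (by simp [hd]) (by simp [hdd]) hx (by rwa [neg_neg])
  rwa [← sub_eq_add_neg] at this

theorem peirce_nondeg {x : O} (hx : x ∈ peirce t d) (hxy : ∀ y ∈ peirce t (-d), t (x * y) = 0) :
    x = 0 := by
  refine h.eq_zero_of_imag hx.1 fun y hy => ?_
  obtain ⟨a, b, ha, hb, he, -⟩ := h.exists_peirce hd hdd hy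
  rw [he, mul_add, mul_add, map_add, map_add, hxy b hb, h.peirce_trace_mul hd hx ha,
    mul_smul_comm, map_smul, h.peirce_mul hd hx, map_neg, hx.1]
  simp

/-- The product of `peirce t d` is nondegenerate. -/
theorem mem_span_of_peirce_mul_eq_zero {x y : O} (hx : x ∈ peirce t d) (hx0 : x ≠ 0)
    (hy : y ∈ peirce t d) (hxy : x * y = 0) : ∃ c : F, y = c • x := by
  have h2 := h.two
  obtain ⟨z, hz, hne⟩ : ∃ z ∈ peirce t (-d), t (x * z) ≠ 0 := by
    by_contra! hc
    exact hx0 (h.peirce_nondeg hd hdd hx hc)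
  -- As `xy = 0`, this reads `x(zy) = t(xz) y`. Since `zy` is a multiple of `1 - d`, the left side
  -- is a multiple of `x`.
  have h1 := h.left_alt_add x z y
  rw [hxy, mul_zero, add_zero, h.add_comm_mul hx.1 hz.1, h.peirce_neg_mul_peirce hd hdd hz hy,
    mul_smul_comm, mul_sub, mul_one, h.peirce_mul hd hx, smul_mul_assoc, one_mul] at h1
  refine ⟨t (z * y) / t (x * z), ?_⟩
  apply smul_right_injective O hne
  dsimp only
  rw [← h1, smul_smul, mul_div_cancel₀ _ hne]
  match_scalars; field_simp; ring

/-- The square of an element in terms of its components. -/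
theorem mul_self_peirce {a b : O} (c : F) (ha : a ∈ peirce t d) (hb : b ∈ peirce t (-d)) :
    (c • d + a + b) * (c • d + a + b) = (c ^ 2 + t (a * b)) • 1 := by
  have hab := h.add_comm_mul ha.1 hb.1
  simp only [add_mul, mul_add, smul_mul_assoc, mul_smul_comm, hdd, ha.2, h.peirce_mul hd ha,
    (mem_peirce_neg.1 hb).2, h.peirce_mul_neg hd hb, h.peirce_self_mul hd ha,
    h.peirce_neg_self_mul hd hb]
  linear_combination (norm := module) hab

/-- The imaginary elements annihilated by an element of `peirce t d`. -/
theorem exists_of_peirce_mul_eq_zero {u x : O} (hu : u ∈ peirce t d) (hu0 : u ≠ 0) (hx : t x = 0)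
    (hux : u * x = 0) : ∃ (c : F) (b : O), b ∈ peirce t (-d) ∧ t (u * b) = 0 ∧ x = c • u + b := by
  have h2 := h.two
  obtain ⟨a, b, ha, hb, he, -⟩ := h.exists_peirce hd hdd hx
  set α := t (d * x) / 2
  have h1 := hux
  rw [he, mul_add, mul_add, mul_smul_comm, h.peirce_mul hd hu] at h1
  have h3 : t (u * b) = 0 := by
    have := congrArg t h1
    simpa [hu.1, h.peirce_trace_mul hd hu ha] using this
  rw [h.peirce_mul_peirce_neg hd hdd hu hb, h3, zero_div, zero_smul, add_zero] at h1
  have h4 := congrArg (fun z => d * z) h1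
  simp only [mul_add, mul_smul_comm, mul_neg, hu.2, mul_zero,
    (mem_peirce_neg.1 (h.peirce_mul_mem hd hu ha)).2] at h4
  have h5 : (-2 * α) • u = 0 := by linear_combination (norm := module) h1 + h4
  have h6 : α = 0 := by
    have := (smul_eq_zero.1 h5).resolve_right hu0
    simpa [h2] using this
  rw [h6, zero_smul, zero_add] at h1
  obtain ⟨c, hc⟩ := h.mem_span_of_peirce_mul_eq_zero hd hdd hu hu0 ha h1
  exact ⟨c, b, hb, h3, by rw [he, h6, hc, zero_smul, zero_add]⟩

end Peirce

/-! ### Isotropic pairs with zero product, and their annihilators. -/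

/-- If no such `y` existed, the functional `t (u * ·)` would lie in the span of `t` and `t (v * ·)`.
Nondegeneracy would put `u` in the span of `1` and `v`, and comparing traces would make `u` a
multiple of `v`. The value 2 gives `u * y - 1` trace zero. -/
theorem exists_trace_eq {u v : O} (hu : t u = 0) (hv : t v = 0)
    (huv : ∀ c : F, u ≠ c • v) : ∃ y, t y = 0 ∧ t (v * y) = 0 ∧ t (u * y) = 2 := by
  let B : O → O →ₗ[F] F := fun x => t ∘ₗ LinearMap.mulLeft F x
  have hB : ∀ x y, B x y = t (x * y) := fun x y => rfl
  have hex : ∃ y, t y = 0 ∧ t (v * y) = 0 ∧ t (u * y) ≠ 0 := by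
    by_contra! hc
    have hmem : B u ∈ Submodule.span F (Set.range ![t, B v]) := by
      apply mem_span_of_iInf_ker_le_ker
      intro y hy
      simp only [Submodule.mem_iInf, Fin.forall_fin_two, LinearMap.mem_ker] at hy
      exact hc y hy.1 hy.2
    rw [Matrix.range_cons, Matrix.range_cons, Matrix.range_empty, Set.union_empty,
      Set.singleton_union, Submodule.mem_span_pair] at hmem
    obtain ⟨a, b, hab⟩ := hmem
    have e : a • (1 : O) + b • v - u = 0 := by
      refine h.nondeg _ fun y => ?_
      have := LinearMap.congr_fun hab y
      simp only [LinearMap.add_apply, LinearMap.smul_apply, hB] at this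
      rw [sub_mul, add_mul, smul_mul_assoc, smul_mul_assoc, one_mul, map_sub, map_add, map_smul,
        map_smul, this, sub_self]
    have ha : a = 0 := by
      have := congrArg t e
      simpa [hu, hv, h.trace_one, h.two] using this
    rw [ha, zero_smul, zero_add] at e
    exact huv b (sub_eq_zero.1 e).symm
  obtain ⟨y, hy1, hy2, hy3⟩ := hex
  refine ⟨(2 / t (u * y)) • y, ?_, ?_, ?_⟩
  · rw [map_smul, hy1, smul_zero]
  · rw [mul_smul_comm, map_smul, hy2, smul_zero]
  · rw [mul_smul_comm, map_smul, smul_eq_mul, div_mul_cancel₀ _ hy3]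

/-- Choose an isotropic `y` orthogonal to `v` with `t (u * y) = 2`. Then `u * y` is twice an
idempotent, fixing `u` up to the factor 2 and killing `v`, so `d = u * y - 1` has the required
eigenvectors. The case `v = 0` is allowed. -/
theorem exists_peirce_of_isotropic {u v : O} (hu : t u = 0) (huu : u * u = 0)
    (hv : t v = 0) (huv : u * v = 0) (hne : ∀ c : F, u ≠ c • v) :
    ∃ d, t d = 0 ∧ d * d = 1 ∧ u ∈ peirce t d ∧ v ∈ peirce t (-d) := by
  have h2 := h.two
  obtain ⟨y₀, hy1, hy2, hy3⟩ := h.exists_trace_eq hu hv hne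
  obtain ⟨y, hty, hvy, huy, hyy⟩ : ∃ y, t y = 0 ∧ t (v * y) = 0 ∧ t (u * y) = 2 ∧ y * y = 0 := by
    -- Subtracting `c u` changes `t (y₀ * y₀)` by `-2c t(u y₀) = -4c`, which fixes `c` and makes the
    -- vector isotropic.
    refine ⟨y₀ - (t (y₀ * y₀) / 4) • u, ?_, ?_, ?_, ?_⟩
    · simp [hy1, hu]
    · rw [mul_sub, mul_smul_comm, map_sub, hy2, map_smul, h.comm v, huv]; simp
    · rw [mul_sub, mul_smul_comm, map_sub, hy3, map_smul, huu]; simp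
    · rw [h.mul_self_eq_zero (by simp [hy1, hu])]
      have h4 : (4 : F) ≠ 0 := by
        have : (4 : F) = 2 * 2 := by norm_num
        rw [this]; exact mul_ne_zero h2 h2
      simp only [mul_sub, sub_mul, mul_smul_comm, smul_mul_assoc, huu, map_sub, map_smul, hy3,
        h.comm y₀ u, smul_zero, map_zero, smul_eq_mul]
      field_simp
      ring
  have e1 : u * y + y * u = (2 : F) • 1 := by rw [h.add_comm_mul hu hty, huy]
  have e2 : (u * y) * u = (2 : F) • u := by
    rw [h.flexible, show y * u = (2 : F) • 1 - u * y by rw [← e1]; abel, mul_sub, h.left_alt, huu]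
    simp
  have e3 : (u * y) * y = 0 := by rw [h.right_alt, hyy, mul_zero]
  have e4 : (u * y) * v = 0 := by
    have h1 := h.right_alt_add y v u
    rw [h.add_comm_mul hty hv, h.comm, hvy, huv] at h1
    simpa using h1
  refine ⟨u * y - 1, ?_, ?_, ⟨hu, ?_⟩, mem_peirce_neg.2 ⟨hv, ?_⟩⟩
  · rw [map_sub, huy, h.trace_one, sub_self]
  · have h1 := h.quadratic (u * y) (u * y)
    rw [huy] at h1
    have e5 : t ((u * y) * (u * y)) = 4 := by
      rw [← h.assoc, e2, smul_mul_assoc, map_smul, huy]; norm_num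
    rw [e5] at h1
    have e6 : (u * y) * (u * y) = (2 : F) • (u * y) := by
      apply smul_right_injective O h2
      dsimp only
      linear_combination (norm := module) h1
    rw [mul_sub, sub_mul, e6, mul_one, one_mul, two_smul]; abel
  · rw [sub_mul, e2, one_mul, two_smul, add_sub_cancel_right]
  · rw [sub_mul, e4, one_mul, zero_sub]

theorem exists_peirce_mem {u : O} (hu : t u = 0) (huu : u * u = 0) (hu0 : u ≠ 0) :
    ∃ d, t d = 0 ∧ d * d = 1 ∧ u ∈ peirce t d := by
  obtain ⟨d, h1, h2, h3, -⟩ := h.exists_peirce_of_isotropic hu huu (map_zero t) (mul_zero u)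
    (by simpa using hu0)
  exact ⟨d, h1, h2, h3⟩

/-- A plane with zero multiplication is its own annihilator. -/
theorem exists_of_mul_eq_zero {u v x : O} (hu : t u = 0) (huu : u * u = 0) (hv : t v = 0)
    (huv : u * v = 0) (hne : ∀ c : F, u ≠ c • v) (hv0 : v ≠ 0)
    (hx : t x = 0) (hux : u * x = 0) (hvx : v * x = 0) : ∃ a b : F, x = a • u + b • v := by
  have hu0 : u ≠ 0 := by simpa using hne 0
  obtain ⟨d, hd, hdd, hud, hvd⟩ := h.exists_peirce_of_isotropic hu huu hv huv hne
  obtain ⟨c, b, hb, -, rfl⟩ := h.exists_of_peirce_mul_eq_zero hd hdd hud hu0 hx hux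
  have hvu : v * u = 0 := by rw [h.mul_eq_neg hu hv (by rw [huv, map_zero]), huv, neg_zero]
  rw [mul_add, mul_smul_comm, hvu, smul_zero, zero_add] at hvx
  obtain ⟨e, he⟩ := h.mem_span_of_peirce_mul_eq_zero (d := -d) (by simp [hd]) (by simp [hdd]) hvd
    hv0 hb hvx
  exact ⟨c, e, by rw [he]⟩

/-- A plane with zero multiplication is an ideal in its orthogonal space. -/
theorem mul_mem_of_orthogonal {u v w : O} (hu : t u = 0) (huu : u * u = 0) (hv : t v = 0)
    (huv : u * v = 0) (hne : ∀ c : F, u ≠ c • v) (hv0 : v ≠ 0)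
    (hw : t w = 0) (huw : t (u * w) = 0) (hvw : t (v * w) = 0) :
    ∃ a b : F, u * w = a • u + b • v := by
  -- It suffices that `u` and `v` annihilate `u * w`. For `v`: orthogonality gives `(vw)u = 0`,
  -- hence `u(vw) = 0`, and `v(uw) = -u(vw)` because `uv = vu = 0`.
  refine h.exists_of_mul_eq_zero hu huu hv huv hne hv0 huw ?_ ?_
  · rw [h.left_alt, huu, zero_mul]
  · have hvu : v * u = 0 := by rw [h.mul_eq_neg hu hv (by rw [huv, map_zero]), huv, neg_zero]
    have e1 : (v * w) * u = 0 := by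
      have h1 := h.right_alt_add u w v
      have h3 := h.add_comm_mul hu hw
      rw [huw, zero_smul] at h3
      rwa [hvu, zero_mul, zero_add, h3, mul_zero] at h1
    have e2 : u * (v * w) = 0 := by
      have h1 := h.mul_eq_neg (x := v * w) (y := u) hvw hu (by rw [e1, map_zero])
      rw [h1, e1, neg_zero]
    have h1 := h.left_alt_add u v w
    rwa [huv, hvu, add_zero, zero_mul, e2, zero_add] at h1

end IsCayleyTrace

/-! ### Double counting and dimension lemmas. -/

section Counting

theorem ncard_mul_eq_ncard_mul {α β : Type*} [Finite α] [Finite β] {A : Set α} {B : Set β}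
    (r : α → β → Prop) {m n : ℕ} (hA : ∀ a ∈ A, {b ∈ B | r a b}.ncard = m)
    (hB : ∀ b ∈ B, {a ∈ A | r a b}.ncard = n) : A.ncard * m = B.ncard * n := by
  classical
  haveI := Fintype.ofFinite α
  haveI := Fintype.ofFinite β
  rw [Set.ncard_eq_toFinset_card', Set.ncard_eq_toFinset_card']
  refine Finset.card_mul_eq_card_mul r (fun a ha => ?_) (fun b hb => ?_)
  · rw [← hA a (by simpa using ha), Set.ncard_eq_toFinset_card']
    congr 1; ext b; simp [Finset.bipartiteAbove]
  · rw [← hB b (by simpa using hb), Set.ncard_eq_toFinset_card']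
    congr 1; ext b; simp [Finset.bipartiteBelow]

theorem ncard_eq_one_of_existsUnique {α : Type*} {S : Set α} (hS : ∃ x, x ∈ S ∧ ∀ y ∈ S, y = x) :
    S.ncard = 1 := by
  obtain ⟨x, hx, hy⟩ := hS
  exact Set.ncard_eq_one.2 ⟨x, Set.eq_singleton_iff_unique_mem.2 ⟨hx, hy⟩⟩

variable {V : Type*} [AddCommGroup V] [Module F V] [Module.Finite F V]

theorem finite_of_moduleFinite [Finite F] : Finite V := Module.finite_of_finite F

theorem finite_submodule [Finite V] : Finite (Submodule F V) :=
  Finite.of_injective (fun W : Submodule F V => (W : Set V)) SetLike.coe_injective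

theorem ncard_submodule (W : Submodule F V) :
    (W : Set V).ncard = Nat.card F ^ Module.finrank F W := by
  rw [← Module.natCard_eq_pow_finrank (K := F) (V := W)]
  rfl

theorem finrank_sup_span {K : Submodule F V} {x : V} (hx : x ∉ K) :
    Module.finrank F (K ⊔ Submodule.span F {x} : Submodule F V) = Module.finrank F K + 1 := by
  have h1 := Submodule.finrank_sup_add_finrank_inf_eq K (Submodule.span F {x})
  have hx0 : x ≠ 0 := by rintro rfl; exact hx K.zero_mem
  have h2 : K ⊓ Submodule.span F {x} = ⊥ := by
    rw [Submodule.eq_bot_iff]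
    rintro y ⟨hy1, hy2⟩
    obtain ⟨c, rfl⟩ := Submodule.mem_span_singleton.1 hy2
    by_contra hne
    have hc : c ≠ 0 := by rintro rfl; simp at hne
    exact hx ((Submodule.smul_mem_iff K hc).1 hy1)
  rw [h2, finrank_bot, finrank_span_singleton hx0, add_zero] at h1
  exact h1

theorem eq_sup_span {K H : Submodule F V} (hKH : K ≤ H) {x : V} (hx : x ∈ H) (hxK : x ∉ K)
    (hr : Module.finrank F H = Module.finrank F K + 1) : K ⊔ Submodule.span F {x} = H := by
  apply Submodule.eq_of_le_of_finrank_eq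
  · exact sup_le hKH ((Submodule.span_singleton_le_iff_mem _ _).2 hx)
  · rw [finrank_sup_span hxK, hr]

/-- Counting subspaces covering `K` through the vectors they add to `K`. -/
theorem ncard_covers [Finite F] {K : Submodule F V} {k : ℕ} (hK : Module.finrank F K = k)
    {𝓗 : Set (Submodule F V)} {S : Set V}
    (h1 : ∀ H ∈ 𝓗, K ≤ H ∧ Module.finrank F H = k + 1)
    (hS : ∀ x ∈ S, x ∉ K ∧ ∃ H ∈ 𝓗, x ∈ H)
    (hS' : ∀ H ∈ 𝓗, ∀ x ∈ H, x ∉ K → x ∈ S) :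
    𝓗.ncard * (Nat.card F ^ (k + 1) - Nat.card F ^ k) = S.ncard := by
  haveI : Finite V := finite_of_moduleFinite (F := F)
  haveI : Finite (Submodule F V) := finite_submodule
  rw [← mul_one S.ncard]
  refine ncard_mul_eq_ncard_mul (fun H x => x ∈ H) (fun H hH => ?_) (fun x hx => ?_)
  · obtain ⟨hKH, hr⟩ := h1 H hH
    have : {x ∈ S | x ∈ H} = (H : Set V) \ (K : Set V) := by
      ext x
      exact ⟨fun hx => ⟨hx.2, (hS x hx.1).1⟩, fun hx => ⟨hS' H hH x hx.1 hx.2, hx.1⟩⟩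
    rw [this, Set.ncard_sdiff hKH, ncard_submodule, ncard_submodule, hK, hr]
  · obtain ⟨hxK, H, hH, hxH⟩ := hS x hx
    refine ncard_eq_one_of_existsUnique ⟨H, ⟨hH, hxH⟩, fun H' hH' => ?_⟩
    rw [← eq_sup_span (h1 H hH).1 hxH hxK (by rw [hK, (h1 H hH).2]),
      ← eq_sup_span (h1 H' hH'.1).1 hH'.2 hxK (by rw [hK, (h1 H' hH'.1).2])]

theorem ncard_sdiff_submodule [Finite F] {K H : Submodule F V} (hKH : K ≤ H) :
    (((H : Set V) \ (K : Set V)).ncard : ℚ) =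
      (Nat.card F : ℚ) ^ Module.finrank F H - (Nat.card F : ℚ) ^ Module.finrank F K := by
  haveI : Finite V := finite_of_moduleFinite (F := F)
  have h1 := Set.ncard_sdiff_add_ncard_of_subset (s := (K : Set V)) (t := (H : Set V)) hKH
  rw [ncard_submodule, ncard_submodule] at h1
  have h2 : ((((H : Set V) \ (K : Set V)).ncard + Nat.card F ^ Module.finrank F K : ℕ) : ℚ) =
    ((Nat.card F ^ Module.finrank F H : ℕ) : ℚ) := by rw [h1]
  push_cast at h2
  linear_combination h2

theorem ncard_sdiff_zero [Finite F] (H : Submodule F V) :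
    (((H : Set V) \ {0}).ncard : ℚ) = (Nat.card F : ℚ) ^ Module.finrank F H - 1 := by
  have := ncard_sdiff_submodule (F := F) (bot_le : ⊥ ≤ H)
  rwa [Submodule.bot_coe, finrank_bot, pow_zero] at this

theorem ncard_covers_cast [Finite F] {K : Submodule F V} {k : ℕ} (hK : Module.finrank F K = k)
    {𝓗 : Set (Submodule F V)} {S : Set V}
    (h1 : ∀ H ∈ 𝓗, K ≤ H ∧ Module.finrank F H = k + 1)
    (hS : ∀ x ∈ S, x ∉ K ∧ ∃ H ∈ 𝓗, x ∈ H)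
    (hS' : ∀ H ∈ 𝓗, ∀ x ∈ H, x ∉ K → x ∈ S) :
    (𝓗.ncard : ℚ) * ((Nat.card F : ℚ) ^ (k + 1) - (Nat.card F : ℚ) ^ k) = S.ncard := by
  rw [← ncard_covers hK h1 hS hS', Nat.cast_mul,
    Nat.cast_sub (Nat.pow_le_pow_right Nat.card_pos (Nat.le_succ k))]
  push_cast
  rfl

theorem ncard_mul_eq_ncard_mul_cast {α β : Type*} [Finite α] [Finite β] {A : Set α} {B : Set β}
    (r : α → β → Prop) {m n : ℚ} (hA : ∀ a ∈ A, ({b ∈ B | r a b}.ncard : ℚ) = m)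
    (hB : ∀ b ∈ B, ({a ∈ A | r a b}.ncard : ℚ) = n) : (A.ncard : ℚ) * m = B.ncard * n := by
  -- When one side is empty its own constant is arbitrary, but the constant of a nonempty other side
  -- is then zero.
  rcases A.eq_empty_or_nonempty with rfl | ⟨a, ha⟩
  · rcases B.eq_empty_or_nonempty with rfl | ⟨b, hb⟩
    · simp
    · rw [← hB b hb]; simp
  · rcases B.eq_empty_or_nonempty with rfl | ⟨b, hb⟩
    · rw [← hA a ha]; simp
    · rw [← hA a ha, ← hB b hb]
      exact_mod_cast ncard_mul_eq_ncard_mul r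
        (fun a' ha' => by exact_mod_cast (hA a' ha').trans (hA a ha).symm)
        (fun b' hb' => by exact_mod_cast (hB b' hb').trans (hB b hb).symm)

theorem finrank_inf_ker {P : Submodule F V} {f : V →ₗ[F] F} {x : V} (hx : x ∈ P) (hfx : f x ≠ 0) :
    Module.finrank F (P ⊓ LinearMap.ker f : Submodule F V) + 1 = Module.finrank F P := by
  have h1 : P ⊓ LinearMap.ker f ⊔ Submodule.span F {x} = P := by
    apply le_antisymm
    · exact sup_le inf_le_left ((Submodule.span_singleton_le_iff_mem _ _).2 hx)
    · intro y hy
      refine Submodule.mem_sup.2 ⟨y - (f y / f x) • x, ⟨P.sub_mem hy (P.smul_mem _ hx), ?_⟩,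
        (f y / f x) • x, Submodule.smul_mem _ _ (Submodule.mem_span_singleton_self x), by abel⟩
      simp [hfx]
  rw [← finrank_sup_span (K := P ⊓ LinearMap.ker f) (x := x) (fun hm => hfx hm.2), h1]

theorem finrank_le_inf_ker (P : Submodule F V) (f : V →ₗ[F] F) :
    Module.finrank F P ≤ Module.finrank F (P ⊓ LinearMap.ker f : Submodule F V) + 1 := by
  by_cases hc : ∃ x ∈ P, f x ≠ 0
  · obtain ⟨x, hx, hfx⟩ := hc
    rw [finrank_inf_ker hx hfx]
  · push Not at hc
    rw [inf_eq_left.2 (fun x hx => hc x hx)]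
    omega

theorem exists_mem_ne_zero_of_finrank_pos {P : Submodule F V} (hP : 0 < Module.finrank F P) :
    ∃ x ∈ P, x ≠ 0 := by
  by_contra! hc
  rw [(Submodule.eq_bot_iff P).2 hc, finrank_bot] at hP
  exact lt_irrefl _ hP

theorem finrank_span_pair {u v : V} (hu : u ≠ 0) (hv : ∀ c : F, v ≠ c • u) :
    Module.finrank F (Submodule.span F {u, v}) = 2 := by
  have : v ∉ Submodule.span F {u} := fun hm => by
    obtain ⟨c, hc⟩ := Submodule.mem_span_singleton.1 hm
    exact hv c hc.symm
  rw [Submodule.span_insert, finrank_sup_span this, finrank_span_singleton hu]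

/-- A plane containing two independent vectors is spanned by them. -/
theorem span_pair_eq {P : Submodule F V} (hP : Module.finrank F P = 2) {u v : V} (hu : u ∈ P)
    (hv : v ∈ P) (hu0 : u ≠ 0) (hne : ∀ c : F, v ≠ c • u) : Submodule.span F {u, v} = P := by
  apply Submodule.eq_of_le_of_finrank_eq
  · rw [Submodule.span_le]
    rintro x (rfl | rfl) <;> assumption
  · rw [finrank_span_pair hu0 hne, hP]

theorem exists_not_smul {P : Submodule F V} (hP : 2 ≤ Module.finrank F P) (u : V) :
    ∃ v ∈ P, ∀ c : F, v ≠ c • u := by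
  by_contra! hc
  have h1 : P ≤ Submodule.span F {u} := fun x hx => by
    obtain ⟨c, hc⟩ := hc x hx
    exact Submodule.mem_span_singleton.2 ⟨c, hc.symm⟩
  have h2 := Submodule.finrank_mono h1
  have h3 := (finrank_span_le_card (R := F) ({u} : Set V)).trans (by simp : _ ≤ 1)
  omega

theorem exists_mem_span_pair {P : Submodule F V} (hP : Module.finrank F P = 2) {u v : V}
    (hu : u ∈ P) (hv : v ∈ P) (hu0 : u ≠ 0) (hne : ∀ c : F, v ≠ c • u) {x : V} (hx : x ∈ P) :
    ∃ a b : F, x = a • u + b • v := by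
  rw [← span_pair_eq hP hu hv hu0 hne] at hx
  obtain ⟨a, b, hab⟩ := Submodule.mem_span_pair.1 hx
  exact ⟨a, b, hab.symm⟩

end Counting

/-! ### Peirce coordinates: dimensions and numbers of solutions of `x² = c`. -/

section PeirceMap

variable [SMulCommClass F O O] [IsScalarTower F O O] {t : O →ₗ[F] F}

/-- The orthogonal space of `u` for the trace form. -/
def orth (t : O →ₗ[F] F) (u : O) : Submodule F O := LinearMap.ker (t ∘ₗ LinearMap.mulLeft F u)

theorem mem_orth {u x : O} : x ∈ orth t u ↔ t (u * x) = 0 := Iff.rfl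

/-- The map `(c, a, b) ↦ c d + a + b`. -/
def peirceMap (d : O) (A B : Submodule F O) : (F × A × B) →ₗ[F] O where
  toFun p := p.1 • d + p.2.1 + p.2.2
  map_add' x y := by simp only [Prod.fst_add, Prod.snd_add, Submodule.coe_add]; module
  map_smul' c x := by
    simp only [Prod.smul_fst, Prod.smul_snd, Submodule.coe_smul, RingHom.id_apply, smul_eq_mul]
    module

theorem mem_range_peirceMap {d : O} {A B : Submodule F O} {x : O} :
    x ∈ LinearMap.range (peirceMap d A B) ↔
      ∃ (c : F) (a b : O), a ∈ A ∧ b ∈ B ∧ x = c • d + a + b := by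
  constructor
  · rintro ⟨⟨c, a, b⟩, rfl⟩
    exact ⟨c, a, b, a.2, b.2, rfl⟩
  · rintro ⟨c, a, b, ha, hb, rfl⟩
    exact ⟨(c, ⟨a, ha⟩, ⟨b, hb⟩), rfl⟩

namespace IsCayleyTrace

variable (h : IsCayleyTrace F t)
include h

variable {d : O} (hd : t d = 0) (hdd : d * d = 1)
include hd hdd

theorem peirce_unique {c : F} {a b : O} (ha : a ∈ peirce t d) (hb : b ∈ peirce t (-d))
    (h0 : c • d + a + b = 0) : c = 0 ∧ a = 0 ∧ b = 0 := by
  have h2 := h.two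
  have h1 := congrArg (fun z => d * z) h0
  simp only [mul_add, mul_smul_comm, hdd, ha.2, (mem_peirce_neg.1 hb).2, mul_zero] at h1
  have hc : c = 0 := by
    have := congrArg t h1
    simpa [h.trace_one, ha.1, hb.1, h2] using this
  rw [hc, zero_smul, zero_add] at h0 h1
  refine ⟨hc, ?_, ?_⟩
  · have : (2 : F) • a = 0 := by linear_combination (norm := module) h0 + h1
    exact (smul_eq_zero.1 this).resolve_left h2
  · have : (2 : F) • b = 0 := by linear_combination (norm := module) h0 - h1
    exact (smul_eq_zero.1 this).resolve_left h2

theorem peirceMap_injective {A B : Submodule F O} (hA : A ≤ peirce t d) (hB : B ≤ peirce t (-d)) :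
    Function.Injective (peirceMap d A B) := by
  rw [← LinearMap.ker_eq_bot, Submodule.eq_bot_iff]
  rintro ⟨c, a, b⟩ hx
  obtain ⟨h1, h2, h3⟩ := h.peirce_unique hd hdd (hA a.2) (hB b.2) hx
  have h1 : c = 0 := h1
  ext <;> simp [h1, h2, h3]

theorem finrank_range_peirceMap {A B : Submodule F O} (hA : A ≤ peirce t d)
    (hB : B ≤ peirce t (-d)) :
    Module.finrank F (LinearMap.range (peirceMap d A B)) =
      1 + (Module.finrank F A + Module.finrank F B) := by
  haveI := h.moduleFinite
  rw [LinearMap.finrank_range_of_inj (h.peirceMap_injective hd hdd hA hB), Module.finrank_prod,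
    Module.finrank_prod, Module.finrank_self]

theorem range_peirceMap :
    LinearMap.range (peirceMap d (peirce t d) (peirce t (-d))) = imag F O := by
  ext x
  rw [mem_range_peirceMap, h.mem_imag]
  constructor
  · rintro ⟨c, a, b, ha, hb, rfl⟩
    simp [hd, ha.1, hb.1]
  · intro hx
    obtain ⟨a, b, ha, hb, he, -⟩ := h.exists_peirce hd hdd hx
    exact ⟨_, a, b, ha, hb, he⟩

/-- The trace form embeds one eigenspace into the dual of the other. Exchanging `d` and `-d` gives
equal dimensions, and the total `1 + 3 + 3 = 7` then fixes them. -/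
theorem finrank_peirce_le : Module.finrank F (peirce t d) ≤ Module.finrank F (peirce t (-d)) := by
  haveI := h.moduleFinite
  let f : peirce t d →ₗ[F] Module.Dual F (peirce t (-d)) :=
    { toFun := fun a => (t ∘ₗ LinearMap.mulLeft F (a : O)).domRestrict _
      map_add' := fun a b => by ext; simp [add_mul]
      map_smul' := fun c a => by ext; simp [smul_mul_assoc] }
  have hf : Function.Injective f := by
    rw [← LinearMap.ker_eq_bot, Submodule.eq_bot_iff]
    intro a ha
    have : (a : O) = 0 := h.peirce_nondeg hd hdd a.2 fun y hy => LinearMap.congr_fun ha ⟨y, hy⟩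
    exact Subtype.ext this
  rw [← Subspace.dual_finrank_eq (V := peirce t (-d))]
  exact LinearMap.finrank_le_finrank_of_injective hf

omit hd hdd in
theorem finrank_imag : Module.finrank F (imag F O) = 7 := by
  haveI := h.moduleFinite
  have h1 := finrank_inf_ker (P := (⊤ : Submodule F O)) (f := t) (x := 1) trivial
    (by rw [h.trace_one]; exact h.two)
  rw [finrank_top, h.finrank, top_inf_eq] at h1
  have : imag F O = LinearMap.ker t := by ext x; exact h.mem_imag
  rw [this]; omega

theorem finrank_peirce : Module.finrank F (peirce t d) = 3 := by
  have h1 := h.finrank_peirce_le hd hdd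
  have h2 := h.finrank_peirce_le (d := -d) (by simp [hd]) (by simp [hdd])
  rw [neg_neg] at h2
  have h3 := h.finrank_range_peirceMap hd hdd le_rfl le_rfl
  rw [h.range_peirceMap hd hdd, h.finrank_imag] at h3
  omega

theorem finrank_peirce_neg : Module.finrank F (peirce t (-d)) = 3 :=
  h.finrank_peirce (d := -d) (by simp [hd]) (by simp [hdd])

theorem finrank_peirce_neg_orth {u : O} (hu : u ∈ peirce t d) (hu0 : u ≠ 0) :
    Module.finrank F (peirce t (-d) ⊓ orth t u : Submodule F O) = 2 := by
  haveI := h.moduleFinite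
  obtain ⟨z, hz, hne⟩ : ∃ z ∈ peirce t (-d), t (u * z) ≠ 0 := by
    by_contra! hc
    exact hu0 (h.peirce_nondeg hd hdd hu hc)
  have := finrank_inf_ker (f := t ∘ₗ LinearMap.mulLeft F u) hz hne
  rw [h.finrank_peirce_neg hd hdd] at this
  exact Nat.succ.inj this

/-- The number of solutions of `x² = c` in `F d + A + B`. -/
theorem ncard_mul_self_eq [Finite F] {A B : Submodule F O} (hA : A ≤ peirce t d)
    (hB : B ≤ peirce t (-d)) (c : F) {N r : ℕ} (hN : {s : F | s ^ 2 = c}.ncard = N)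
    (hr : {a | a ∈ A ∧ ∀ b ∈ B, t (a * b) = 0}.ncard = r) :
    {x | x ∈ LinearMap.range (peirceMap d A B) ∧ x * x = c • 1}.ncard =
      r * (N * (B : Set O).ncard) + ((A : Set O).ncard - r) * (B : Set O).ncard := by
  classical
  haveI := h.moduleFinite
  haveI : Finite O := finite_of_moduleFinite (F := F)
  haveI := Fintype.ofFinite A
  have hsq : ∀ (s : F) (a : A) (b : B), (s • d + (a : O) + b) * (s • d + (a : O) + b) = c • 1 ↔
      s ^ 2 + t (a * b) = c := by
    intro s a b
    rw [h.mul_self_peirce hd hdd s (hA a.2) (hB b.2)]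
    constructor
    · intro he
      have : (s ^ 2 + t (a * b) - c) • (1 : O) = 0 := by rw [sub_smul, he, sub_self]
      exact sub_eq_zero.1 (h.smul_one_inj this)
    · intro he; rw [he]
  have h1 : {x | x ∈ LinearMap.range (peirceMap d A B) ∧ x * x = c • 1}.ncard =
      Nat.card (Σ a : A, {p : F × B // p.1 ^ 2 + t (a * p.2) = c}) := by
    symm
    refine Nat.card_congr (Equiv.ofBijective (fun p => ⟨peirceMap d A B (p.2.1.1, p.1, p.2.1.2),
      ⟨⟨_, rfl⟩, (hsq _ _ _).2 p.2.2⟩⟩) ⟨?_, ?_⟩)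
    · rintro ⟨a, ⟨s, b⟩, hp⟩ ⟨a', ⟨s', b'⟩, hp'⟩ he
      have := h.peirceMap_injective hd hdd hA hB (Subtype.ext_iff.1 he)
      simp only [Prod.mk.injEq] at this
      obtain ⟨rfl, rfl, rfl⟩ := this
      rfl
    · rintro ⟨x, ⟨⟨⟨s, a, b⟩, rfl⟩, hx⟩⟩
      exact ⟨⟨a, (s, b), (hsq _ _ _).1 hx⟩, rfl⟩
  -- For fixed `a` orthogonal to `B`, `b` is free and `s` runs over the roots of `s² = c`. Otherwise
  -- the equation only prescribes the value of a nonzero functional at `b` for each `s`, which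
  -- leaves `|B|` solutions in all.
  have h2 : ∀ a : A, Nat.card {p : F × B // p.1 ^ 2 + t (a * p.2) = c} =
      if (∀ b ∈ B, t ((a : O) * b) = 0) then N * (B : Set O).ncard else (B : Set O).ncard := by
    intro a
    split_ifs with ha
    · rw [← hN]
      change _ = Nat.card {s : F | s ^ 2 = c} * Nat.card B
      rw [← Nat.card_prod]
      refine Nat.card_congr
        { toFun := fun p => (⟨p.1.1, ?_⟩, p.1.2)
          invFun := fun p => ⟨(p.1, p.2), ?_⟩
          left_inv := fun _ => rfl
          right_inv := fun _ => rfl }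
      · have := p.2
        rwa [ha _ p.1.2.2, add_zero] at this
      · have : (p.1 : F) ^ 2 = c := p.1.2
        dsimp only
        rw [ha _ p.2.2, add_zero, this]
    · push Not at ha
      obtain ⟨b₁, hb₁, hne⟩ := ha
      obtain ⟨b₀, hb₀⟩ : ∃ b₀ : B, t ((a : O) * b₀) = 1 :=
        ⟨(t ((a : O) * b₁))⁻¹ • ⟨b₁, hb₁⟩, by simp [hne, mul_smul_comm]⟩
      change _ = Nat.card B
      -- The shift along `b₀` changes the value `t (a * b)` from `c - s²` to `s`, so that `s` can be
      -- recovered from the shifted vector alone.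
      refine Nat.card_congr
        { toFun := fun p => p.1.2 - (c - p.1.1 ^ 2 - p.1.1) • b₀
          invFun := fun b => ⟨(t (a * b), b + (c - t (a * b) ^ 2 - t (a * b)) • b₀), ?_⟩
          left_inv := ?_
          right_inv := ?_ }
      · simp [mul_add, mul_smul_comm, hb₀]
      · rintro ⟨⟨s, b⟩, hp⟩
        dsimp only at hp
        have e : t ((a : O) * ((b - (c - s ^ 2 - s) • b₀ : B) : O)) = s := by
          simp only [Submodule.coe_sub, Submodule.coe_smul, mul_sub, mul_smul_comm, map_sub,
            map_smul, hb₀, smul_eq_mul, mul_one]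
          linear_combination hp
        apply Subtype.ext
        simp only [e, Prod.mk.injEq, true_and]
        abel
      · intro b
        simp
  rw [h1, Nat.card_sigma]
  simp only [h2]
  rw [Finset.sum_ite, Finset.sum_const, Finset.sum_const, smul_eq_mul, smul_eq_mul]
  have h3 : (Finset.univ.filter fun a : A => ∀ b ∈ B, t ((a : O) * b) = 0).card = r := by
    rw [← hr, ← Set.ncard_coe_finset]
    refine Set.ncard_congr (fun a _ => (a : O)) ?_ ?_ ?_
    · intro a ha
      exact ⟨a.2, by simpa using ha⟩
    · intro a b _ _ hab
      exact Subtype.ext hab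
    · rintro a ⟨ha, hb⟩
      exact ⟨⟨a, ha⟩, by simpa using hb, rfl⟩
  have h4 := Finset.card_filter_add_card_filter_not (s := (Finset.univ : Finset A))
    (fun a : A => ∀ b ∈ B, t ((a : O) * b) = 0)
  rw [h3, Finset.card_univ, ← Nat.card_eq_fintype_card] at h4
  have h5 : (A : Set O).ncard = Nat.card A := rfl
  rw [h3, h5]
  congr 2
  omega

/-- For `c = 0` the equation `s² = c` has one root. Every `a` then contributes `|B|`, whether or not
it is orthogonal to `B`, and the count is independent of the pairing. -/
theorem ncard_isotropic [Finite F] {A B : Submodule F O} (hA : A ≤ peirce t d)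
    (hB : B ≤ peirce t (-d)) :
    {x | x ∈ LinearMap.range (peirceMap d A B) ∧ x * x = 0}.ncard =
      Nat.card F ^ (Module.finrank F A + Module.finrank F B) := by
  haveI := h.moduleFinite
  haveI : Finite O := finite_of_moduleFinite (F := F)
  have h1 := h.ncard_mul_self_eq hd hdd hA hB 0 (N := 1)
    (ncard_eq_one_of_existsUnique ⟨0, by simp, by simp⟩) rfl
  rw [zero_smul] at h1
  rw [h1, one_mul, ← add_mul, pow_add, ← ncard_submodule, ← ncard_submodule]
  congr 1
  apply Nat.add_sub_cancel'
  exact Set.ncard_le_ncard (fun a ha => ha.1)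

end IsCayleyTrace

end PeirceMap

/-! ### The seven plane types in terms of the trace form. -/

section PlaneTypes

variable [SMulCommClass F O O] [IsScalarTower F O O] {t : O →ₗ[F] F}

/-- `u` is isotropic, `v` is anisotropic, and `u` and `v` are orthogonal. -/
def IsTangent (t : O →ₗ[F] F) (u v : O) : Prop :=
  u ≠ 0 ∧ u * u = 0 ∧ t (v * v) ≠ 0 ∧ t (u * v) = 0

theorem IsTangent.ne_smul {u v : O} (huv : IsTangent t u v) (c : F) : v ≠ c • u := by
  rintro rfl
  apply huv.2.2.1
  rw [smul_mul_assoc, mul_smul_comm, huv.2.1]; simp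

namespace IsCayleyTrace

variable (h : IsCayleyTrace F t)
include h

theorem trace_eq_zero {U : Submodule F O} (hU : IsImagPlane U) {x : O} (hx : x ∈ U) : t x = 0 :=
  h.mem_imag.1 (hU.1 hx)

theorem nilpotent_iff_of_mem {U : Submodule F O} (hU : IsImagPlane U) {x : O} (hx : x ∈ U) :
    Nilpotent x ↔ x * x = 0 := by
  rw [h.nilpotent_iff, h.trace_eq_zero hU hx]; simp

theorem mem_nilpotentLines {U : Submodule F O} (hU : IsImagPlane U) {L : Submodule F O} :
    L ∈ nilpotentLines U ↔ ∃ u ∈ U, u ≠ 0 ∧ u * u = 0 ∧ L = Submodule.span F {u} := by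
  constructor
  · rintro ⟨hL, hr, hn⟩
    obtain ⟨u, hu0, hu⟩ := finrank_eq_one_iff'.1 hr
    have e : L = Submodule.span F {(u : O)} := by
      ext x
      rw [Submodule.mem_span_singleton]
      constructor
      · intro hx
        obtain ⟨c, hc⟩ := hu ⟨x, hx⟩
        exact ⟨c, congrArg Subtype.val hc⟩
      · rintro ⟨c, rfl⟩
        exact L.smul_mem c u.2
    exact ⟨u, hL u.2, by simpa using hu0, (h.nilpotent_iff.1 (hn u u.2)).2, e⟩
  · rintro ⟨u, hu, hu0, huu, rfl⟩
    refine ⟨(Submodule.span_singleton_le_iff_mem _ _).2 hu, finrank_span_singleton hu0, ?_⟩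
    intro x hx
    obtain ⟨c, rfl⟩ := Submodule.mem_span_singleton.1 hx
    rw [h.nilpotent_iff_of_mem hU (U.smul_mem c hu), smul_mul_assoc, mul_smul_comm, huu]
    simp

/-- The isometry types of planes. -/
theorem plane_cases {U : Submodule F O} (hU : IsImagPlane U) :
    (∀ x ∈ U, x * x = 0 → x = 0) ∨ (∃ u ∈ U, ∃ v ∈ U, IsTangent t u v) ∨
      (∃ u ∈ U, ∃ v ∈ U, u * u = 0 ∧ v * v = 0 ∧ t (u * v) ≠ 0) ∨ ∀ x ∈ U, x * x = 0 := by
  have h2 := h.two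
  by_cases h1 : ∀ x ∈ U, x * x = 0 → x = 0
  · exact Or.inl h1
  right
  push Not at h1
  obtain ⟨u, hu, huu, hu0⟩ := h1
  by_cases h3 : ∃ v ∈ U, t (u * v) ≠ 0
  · right; left
    obtain ⟨v, hv, huv⟩ := h3
    -- The coefficient makes the corrected vector isotropic; its pairing with `u` is unchanged
    -- because `u² = 0`.
    refine ⟨u, hu, v - (t (v * v) / (2 * t (u * v))) • u, U.sub_mem hv (U.smul_mem _ hu), huu,
      ?_, ?_⟩
    · rw [h.mul_self_eq_zero (h.trace_eq_zero hU (U.sub_mem hv (U.smul_mem _ hu)))]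
      simp only [sub_mul, mul_sub, smul_mul_assoc, mul_smul_comm, huu, map_sub, map_smul,
        h.comm v u, smul_zero, smul_eq_mul, map_zero]
      field_simp
      ring
    · rwa [mul_sub, mul_smul_comm, huu, smul_zero, sub_zero]
  · push Not at h3
    by_cases h4 : ∃ v ∈ U, v * v ≠ 0
    · obtain ⟨v, hv, hvv⟩ := h4
      refine Or.inl ⟨u, hu, v, hv, hu0, huu, ?_, h3 v hv⟩
      rwa [Ne, ← h.mul_self_eq_zero (h.trace_eq_zero hU hv)]
    · push Not at h4
      exact Or.inr (Or.inr h4)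

theorem IsTangent.mul_self_eq_zero {U : Submodule F O} (hU : IsImagPlane U) {u v : O} (hu : u ∈ U)
    (hv : v ∈ U) (huv : IsTangent t u v) {x : O} (hx : x ∈ U) (hxx : x * x = 0) :
    ∃ c : F, x = c • u := by
  haveI := h.moduleFinite
  obtain ⟨a, b, rfl⟩ := exists_mem_span_pair hU.2 hu hv huv.1 huv.ne_smul hx
  have h1 := congrArg t hxx
  simp only [add_mul, mul_add, smul_mul_assoc, mul_smul_comm, huv.2.1, map_add, map_smul,
    h.comm v u, huv.2.2.2, smul_eq_mul, smul_zero, mul_zero, map_zero, zero_add] at h1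
  have hb : b = 0 := by simpa [huv.2.2.1] using h1
  exact ⟨a, by rw [hb]; simp⟩

theorem IsTangent.nilpotentLines_eq {U : Submodule F O} (hU : IsImagPlane U) {u v : O} (hu : u ∈ U)
    (hv : v ∈ U) (huv : IsTangent t u v) : nilpotentLines U = {Submodule.span F {u}} := by
  ext L
  rw [h.mem_nilpotentLines hU, Set.mem_singleton_iff]
  constructor
  · rintro ⟨x, hx, hx0, hxx, rfl⟩
    obtain ⟨c, rfl⟩ := IsTangent.mul_self_eq_zero h hU hu hv huv hx hxx
    have hc : c ≠ 0 := by rintro rfl; simp at hx0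
    exact Submodule.span_singleton_smul_eq (IsUnit.mk0 c hc) u
  · rintro rfl
    exact ⟨u, hu, huv.1, huv.2.1, rfl⟩

theorem span_ne_span {u v : O} (hu : u * u = 0) (huv : t (u * v) ≠ 0) :
    Submodule.span F {u} ≠ Submodule.span F {v} := by
  intro he
  have : v ∈ Submodule.span F {u} := by rw [he]; exact Submodule.mem_span_singleton_self v
  obtain ⟨c, rfl⟩ := Submodule.mem_span_singleton.1 this
  rw [mul_smul_comm, hu] at huv
  simp at huv

theorem nilpotentLines_eq_pair {U : Submodule F O} (hU : IsImagPlane U) {u v : O} (hu : u ∈ U)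
    (hv : v ∈ U) (huu : u * u = 0) (hvv : v * v = 0) (huv : t (u * v) ≠ 0) :
    nilpotentLines U = {Submodule.span F {u}, Submodule.span F {v}} := by
  have hu0 : u ≠ 0 := by rintro rfl; simp at huv
  have hv0 : v ≠ 0 := by rintro rfl; simp at huv
  have hne : ∀ c : F, v ≠ c • u := by
    rintro c rfl; rw [mul_smul_comm, huu] at huv; simp at huv
  ext L
  rw [h.mem_nilpotentLines hU, Set.mem_insert_iff, Set.mem_singleton_iff]
  constructor
  · rintro ⟨x, hx, hx0, hxx, rfl⟩
    haveI := h.moduleFinite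
    obtain ⟨a, b, rfl⟩ := exists_mem_span_pair hU.2 hu hv hu0 hne hx
    have h1 := congrArg t hxx
    simp only [add_mul, mul_add, smul_mul_assoc, mul_smul_comm, huu, hvv, map_add, map_smul,
      h.comm v u, smul_eq_mul, smul_zero, map_zero, zero_add, add_zero] at h1
    have h3 : (2 * t (u * v)) * (a * b) = 0 := by linear_combination h1
    have h4 := (mul_eq_zero.1 h3).resolve_left (mul_ne_zero h.two huv)
    rcases mul_eq_zero.1 h4 with rfl | rfl
    · right
      rw [zero_smul, zero_add] at hx0 ⊢
      have hc : b ≠ 0 := by rintro rfl; simp at hx0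
      exact Submodule.span_singleton_smul_eq (IsUnit.mk0 b hc) v
    · left
      rw [zero_smul, add_zero] at hx0 ⊢
      have hc : a ≠ 0 := by rintro rfl; simp at hx0
      exact Submodule.span_singleton_smul_eq (IsUnit.mk0 a hc) u
  · rintro (rfl | rfl)
    · exact ⟨u, hu, hu0, huu, rfl⟩
    · exact ⟨v, hv, hv0, hvv, rfl⟩

theorem nilpotentLines_ncard_two {U : Submodule F O} (hU : IsImagPlane U) {u v : O} (hu : u ∈ U)
    (hv : v ∈ U) (huu : u * u = 0) (hvv : v * v = 0) (huv : t (u * v) ≠ 0) :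
    (nilpotentLines U).ncard = 2 := by
  rw [h.nilpotentLines_eq_pair hU hu hv huu hvv huv, Set.ncard_pair (h.span_ne_span huu huv)]

/-- The lines through `u`, `v` and `u + v` are distinct. This separates totally isotropic planes
from all the others by the number of nilpotent lines. -/
theorem three_le_ncard_nilpotentLines [Finite F] {U : Submodule F O} (hU : IsImagPlane U)
    (h0 : ∀ x ∈ U, x * x = 0) : 3 ≤ (nilpotentLines U).ncard := by
  haveI := h.moduleFinite
  haveI : Finite O := finite_of_moduleFinite (F := F)
  haveI : Finite (Submodule F O) := finite_submodule
  obtain ⟨u, hu, hu0⟩ := exists_mem_ne_zero_of_finrank_pos (P := U) (by rw [hU.2]; norm_num)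
  obtain ⟨v, hv, hne⟩ := exists_not_smul (P := U) hU.2.ge u
  have hindep : ∀ a b : F, a • u + b • v = 0 → a = 0 ∧ b = 0 := by
    intro a b hab
    have hb : b = 0 := by
      by_contra hb
      apply hne (-(b⁻¹ * a))
      apply smul_right_injective O hb
      simp only [smul_smul, mul_neg, mul_inv_cancel_left₀ hb]
      linear_combination (norm := module) hab
    rw [hb, zero_smul, add_zero] at hab
    exact ⟨(smul_eq_zero.1 hab).resolve_right hu0, hb⟩
  have key : ∀ a b a' b' : F, (a • u + b • v) ∈ Submodule.span F {a' • u + b' • v} →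
      a * b' = b * a' := by
    intro a b a' b' hm
    obtain ⟨c, hc⟩ := Submodule.mem_span_singleton.1 hm
    obtain ⟨h1, h3⟩ := hindep (a - c * a') (b - c * b')
      (by linear_combination (norm := module) -hc)
    linear_combination b' * h1 - a' * h3
  have hne' : ∀ a b a' b' : F, a * b' ≠ b * a' →
      Submodule.span F {a • u + b • v} ≠ Submodule.span F {a' • u + b' • v} := by
    intro a b a' b' hne he
    exact hne (key a b a' b' (he ▸ Submodule.mem_span_singleton_self _))
  have hmem : ∀ a b : F, a • u + b • v ≠ 0 →
      Submodule.span F {a • u + b • v} ∈ nilpotentLines U := fun a b hab => by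
    rw [h.mem_nilpotentLines hU]
    have hm := U.add_mem (U.smul_mem a hu) (U.smul_mem b hv)
    exact ⟨_, hm, hab, h0 _ hm, rfl⟩
  refine (Set.two_lt_ncard_iff (Set.toFinite _)).2 ⟨_, _, _, hmem 1 0 ?_, hmem 0 1 ?_, hmem 1 1 ?_,
    hne' _ _ _ _ ?_, hne' _ _ _ _ ?_, hne' _ _ _ _ ?_⟩
  · intro he; exact one_ne_zero (hindep _ _ he).1
  · intro he; exact one_ne_zero (hindep _ _ he).2
  · intro he; exact one_ne_zero (hindep _ _ he).2
  all_goals simp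

theorem isTypeQ_iff {U : Submodule F O} :
    IsTypeQ U ↔ IsImagPlane U ∧ ∀ x ∈ U, x * x = 0 → x = 0 := by
  refine and_congr_right fun hU => ?_
  rw [Set.eq_empty_iff_forall_notMem]
  constructor
  · intro h1 x hx hxx
    by_contra hx0
    exact h1 _ ((h.mem_nilpotentLines hU).2 ⟨x, hx, hx0, hxx, rfl⟩)
  · intro h1 L hL
    obtain ⟨u, hu, hu0, huu, -⟩ := (h.mem_nilpotentLines hU).1 hL
    exact hu0 (h1 u hu huu)

variable [Finite F]

/-- Among the four isometry types the numbers of nilpotent lines are 0, 1, 2 and at least 3, so one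
line means a tangent plane. -/
theorem exists_isTangent {U L : Submodule F O} (hU : IsImagPlane U) (hL : nilpotentLines U = {L}) :
    ∃ u ∈ U, ∃ v ∈ U, IsTangent t u v ∧ L = Submodule.span F {u} := by
  have hn : (nilpotentLines U).ncard = 1 := by rw [hL, Set.ncard_singleton]
  rcases h.plane_cases hU with h1 | ⟨u, hu, v, hv, huv⟩ | ⟨u, hu, v, hv, huu, hvv, huv⟩ | h1
  · rw [((h.isTypeQ_iff).2 ⟨hU, h1⟩).2] at hn; simp at hn
  · rw [IsTangent.nilpotentLines_eq h hU hu hv huv] at hL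
    exact ⟨u, hu, v, hv, huv, (Set.singleton_injective hL).symm⟩
  · rw [h.nilpotentLines_ncard_two hU hu hv huu hvv huv] at hn; omega
  · have := h.three_le_ncard_nilpotentLines hU h1; omega

theorem IsTangent.stable_iff {U : Submodule F O} (hU : IsImagPlane U) {u v : O} (hu : u ∈ U)
    (hv : v ∈ U) (huv : IsTangent t u v) :
    (∀ x ∈ Submodule.span F {u}, ∀ y ∈ U, x * y ∈ Submodule.span F {u}) ↔
      ∃ c : F, u * v = c • u := by
  constructor
  · intro h1
    obtain ⟨c, hc⟩ := Submodule.mem_span_singleton.1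
      (h1 u (Submodule.mem_span_singleton_self u) v hv)
    exact ⟨c, hc.symm⟩
  · rintro ⟨c, hc⟩ x hx y hy
    obtain ⟨a, rfl⟩ := Submodule.mem_span_singleton.1 hx
    haveI := h.moduleFinite
    obtain ⟨p, r, rfl⟩ := exists_mem_span_pair hU.2 hu hv huv.1 huv.ne_smul hy
    refine Submodule.mem_span_singleton.2 ⟨a * (r * c), ?_⟩
    simp only [smul_mul_assoc, mul_add, mul_smul_comm, huv.2.1, hc, smul_smul, smul_zero, zero_add]
    congr 1; ring

theorem isTypeU_iff {U : Submodule F O} : IsTypeU U ↔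
    IsImagPlane U ∧ ∃ u ∈ U, ∃ v ∈ U, IsTangent t u v ∧ ∃ c : F, u * v = c • u := by
  refine and_congr_right fun hU => ?_
  constructor
  · rintro ⟨L, hL, hs⟩
    obtain ⟨u, hu, v, hv, huv, rfl⟩ := h.exists_isTangent hU hL
    exact ⟨u, hu, v, hv, huv, (IsTangent.stable_iff h hU hu hv huv).1 hs⟩
  · rintro ⟨u, hu, v, hv, huv, hc⟩
    exact ⟨_, IsTangent.nilpotentLines_eq h hU hu hv huv,
      (IsTangent.stable_iff h hU hu hv huv).2 hc⟩

theorem isTypeD_iff {U : Submodule F O} : IsTypeD U ↔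
    IsImagPlane U ∧ ∃ u ∈ U, ∃ v ∈ U, IsTangent t u v ∧ ∀ c : F, u * v ≠ c • u := by
  refine and_congr_right fun hU => ?_
  constructor
  · rintro ⟨L, hL, hs⟩
    obtain ⟨u, hu, v, hv, huv, rfl⟩ := h.exists_isTangent hU hL
    rw [IsTangent.stable_iff h hU hu hv huv] at hs
    exact ⟨u, hu, v, hv, huv, by simpa using hs⟩
  · rintro ⟨u, hu, v, hv, huv, hc⟩
    refine ⟨_, IsTangent.nilpotentLines_eq h hU hu hv huv, ?_⟩
    rw [IsTangent.stable_iff h hU hu hv huv]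
    simpa using hc

/-- The squares of the anisotropic elements of a tangent plane form one square class. -/
theorem IsTangent.mul_self {U : Submodule F O} (hU : IsImagPlane U) {u v : O} (hu : u ∈ U)
    (hv : v ∈ U) (huv : IsTangent t u v) {c : F} (hc : v * v = c • 1) {x : O} (hx : x ∈ U)
    (hxx : x * x ≠ 0) : ∃ s : F, s ≠ 0 ∧ x * x = (s * s * c) • 1 := by
  haveI := h.moduleFinite
  obtain ⟨a, b, rfl⟩ := exists_mem_span_pair hU.2 hu hv huv.1 huv.ne_smul hx
  have h1 := h.mul_eq_neg (h.trace_eq_zero hU hu) (h.trace_eq_zero hU hv) huv.2.2.2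
  have e : (a • u + b • v) * (a • u + b • v) = (b * b * c) • 1 := by
    simp only [add_mul, mul_add, smul_mul_assoc, mul_smul_comm, huv.2.1, h1, hc]
    module
  refine ⟨b, ?_, e⟩
  rintro rfl
  rw [e] at hxx
  simp at hxx

theorem IsTangent.coeff_ne_zero {u v : O} (huv : IsTangent t u v) {c : F} (hc : v * v = c • 1) :
    c ≠ 0 := by
  rintro rfl
  apply huv.2.2.1
  rw [hc]; simp

/-- All anisotropic vectors of a tangent plane have squares in the class of `c` modulo nonzero
squares. For a property of square classes it is enough to test one vector; this serves both Dn and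
Ds. -/
theorem forall_not_nilpotent_iff {U : Submodule F O} (hU : IsImagPlane U) {u v : O} (hu : u ∈ U)
    (hv : v ∈ U) (huv : IsTangent t u v) {c : F} (hc : v * v = c • 1) (P : F → Prop)
    (hP : ∀ s a : F, s ≠ 0 → P a → P (s * s * a)) :
    (∀ x ∈ U, ¬ Nilpotent x → ∃ c : F, x * x = c • (1 : O) ∧ P c) ↔ P c := by
  have hvv : v * v ≠ 0 := fun e => huv.2.2.1 (by rw [e, map_zero])
  constructor
  · intro h1
    obtain ⟨e, he, hs⟩ := h1 v hv (by rwa [h.nilpotent_iff_of_mem hU hv])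
    have : c = e := by
      have : (c - e) • (1 : O) = 0 := by rw [sub_smul, ← hc, ← he, sub_self]
      exact sub_eq_zero.1 (h.smul_one_inj this)
    rwa [this]
  · intro hs x hx hn
    rw [h.nilpotent_iff_of_mem hU hx] at hn
    obtain ⟨s, hs0, e⟩ := IsTangent.mul_self h hU hu hv huv hc hx hn
    exact ⟨_, e, hP _ _ hs0 hs⟩

theorem isTypeDn_iff {U : Submodule F O} : IsTypeDn U ↔ IsImagPlane U ∧ ∃ u ∈ U, ∃ v ∈ U,
    IsTangent t u v ∧ (∀ c : F, u * v ≠ c • u) ∧ ∃ c : F, v * v = c • 1 ∧ ¬ IsSquare c := by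
  have hP : ∀ s a : F, s ≠ 0 → ¬ IsSquare a → ¬ IsSquare (s * s * a) := by
    rintro s a hs ha ⟨r, hr⟩
    exact ha ⟨r / s, by field_simp; linear_combination hr⟩
  rw [IsTypeDn, h.isTypeD_iff]
  constructor
  · rintro ⟨⟨hU, u, hu, v, hv, huv, hc⟩, hs⟩
    have hvv := h.mul_self (h.trace_eq_zero hU hv)
    rw [h.forall_not_nilpotent_iff hU hu hv huv hvv _ hP] at hs
    exact ⟨hU, u, hu, v, hv, huv, hc, _, hvv, hs⟩
  · rintro ⟨hU, u, hu, v, hv, huv, hc, c, hvv, hs⟩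
    exact ⟨⟨hU, u, hu, v, hv, huv, hc⟩, (h.forall_not_nilpotent_iff hU hu hv huv hvv _ hP).2 hs⟩

theorem isTypeDs_iff {U : Submodule F O} : IsTypeDs U ↔ IsImagPlane U ∧ ∃ u ∈ U, ∃ v ∈ U,
    IsTangent t u v ∧ (∀ c : F, u * v ≠ c • u) ∧ ∃ c : F, v * v = c • 1 ∧ IsSquare c := by
  have hP : ∀ s a : F, s ≠ 0 → IsSquare a → IsSquare (s * s * a) := by
    rintro s a hs ⟨r, hr⟩
    exact ⟨s * r, by rw [hr]; ring⟩
  rw [IsTypeDs, h.isTypeD_iff]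
  constructor
  · rintro ⟨⟨hU, u, hu, v, hv, huv, hc⟩, hs⟩
    have hvv := h.mul_self (h.trace_eq_zero hU hv)
    rw [h.forall_not_nilpotent_iff hU hu hv huv hvv _ hP] at hs
    exact ⟨hU, u, hu, v, hv, huv, hc, _, hvv, hs⟩
  · rintro ⟨hU, u, hu, v, hv, huv, hc, c, hvv, hs⟩
    exact ⟨⟨hU, u, hu, v, hv, huv, hc⟩, (h.forall_not_nilpotent_iff hU hu hv huv hvv _ hP).2 hs⟩

theorem isTypeM_iff {U : Submodule F O} : IsTypeM U ↔ IsImagPlane U ∧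
    ∃ u ∈ U, ∃ v ∈ U, u * u = 0 ∧ v * v = 0 ∧ t (u * v) ≠ 0 := by
  refine and_congr_right fun hU => ?_
  constructor
  · intro hn
    rcases h.plane_cases hU with h1 | ⟨u, hu, v, hv, huv⟩ | h1 | h1
    · rw [((h.isTypeQ_iff).2 ⟨hU, h1⟩).2] at hn; simp at hn
    · rw [IsTangent.nilpotentLines_eq h hU hu hv huv] at hn; simp at hn
    · exact h1
    · have := h.three_le_ncard_nilpotentLines hU h1; omega
  · rintro ⟨u, hu, v, hv, huu, hvv, huv⟩
    exact h.nilpotentLines_ncard_two hU hu hv huu hvv huv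

omit [Finite F] in
theorem forall_nilpotent_iff {U : Submodule F O} (hU : IsImagPlane U) :
    (∀ x ∈ U, Nilpotent x) ↔ ∀ x ∈ U, x * x = 0 :=
  forall₂_congr fun _ hx => h.nilpotent_iff_of_mem hU hx

omit [Finite F] in
theorem isTypeZ_iff {U : Submodule F O} :
    IsTypeZ U ↔ IsImagPlane U ∧ ∀ x ∈ U, ∀ y ∈ U, x * y = 0 := by
  refine and_congr_right fun hU => ?_
  rw [h.forall_nilpotent_iff hU]
  exact ⟨fun h1 => h1.2, fun h1 => ⟨fun x hx => h1 x hx x hx, h1⟩⟩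

omit [Finite F] in
theorem isTypeJ_iff {U : Submodule F O} : IsTypeJ U ↔
    IsImagPlane U ∧ (∀ x ∈ U, x * x = 0) ∧ ∃ x ∈ U, ∃ y ∈ U, x * y ≠ 0 := by
  refine and_congr_right fun hU => ?_
  rw [h.forall_nilpotent_iff hU]
  simp

omit [Finite F] in
theorem isImagPlane_of_mem_planes {X : PlaneType} {U : Submodule F O} (hU : U ∈ planes F O X) :
    IsImagPlane U := by
  cases X
  · exact hU.1
  · exact hU.1
  · exact hU.1.1
  · exact hU.1.1
  · exact hU.1
  · exact hU.1
  · exact hU.1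

theorem exists_mem_planes {U : Submodule F O} (hU : IsImagPlane U) : ∃ X, U ∈ planes F O X := by
  rcases h.plane_cases hU with h1 | ⟨u, hu, v, hv, huv⟩ | h1 | h1
  · exact ⟨.Q, h.isTypeQ_iff.2 ⟨hU, h1⟩⟩
  · by_cases hc : ∃ c : F, u * v = c • u
    · exact ⟨.U, h.isTypeU_iff.2 ⟨hU, u, hu, v, hv, huv, hc⟩⟩
    · push Not at hc
      have hvv := h.mul_self (h.trace_eq_zero hU hv)
      by_cases hs : IsSquare (t (v * v) / 2)
      · exact ⟨.Ds, h.isTypeDs_iff.2 ⟨hU, u, hu, v, hv, huv, hc, _, hvv, hs⟩⟩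
      · exact ⟨.Dn, h.isTypeDn_iff.2 ⟨hU, u, hu, v, hv, huv, hc, _, hvv, hs⟩⟩
  · exact ⟨.M, h.isTypeM_iff.2 ⟨hU, h1⟩⟩
  · by_cases hz : ∀ x ∈ U, ∀ y ∈ U, x * y = 0
    · exact ⟨.Z, h.isTypeZ_iff.2 ⟨hU, hz⟩⟩
    · push Not at hz
      exact ⟨.J, h.isTypeJ_iff.2 ⟨hU, h1, hz⟩⟩

theorem not_isTypeDn_and_isTypeDs {U : Submodule F O} (h1 : IsTypeDn U) (h2 : IsTypeDs U) :
    False := by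
  obtain ⟨hU, u, hu, v, hv, huv, -⟩ := h.isTypeDn_iff.1 h1
  have hn : ¬ Nilpotent v := by
    rw [h.nilpotent_iff_of_mem hU hv]
    exact fun e => huv.2.2.1 (by rw [e, map_zero])
  obtain ⟨c, hc, hs⟩ := h1.2 v hv hn
  obtain ⟨e, he, hs'⟩ := h2.2 v hv hn
  have : (c - e) • (1 : O) = 0 := by rw [sub_smul, ← hc, ← he, sub_self]
  rw [sub_eq_zero.1 (h.smul_one_inj this)] at hs
  exact hs hs'

omit h [Finite F] in
theorem not_isTypeU_and_isTypeD {U : Submodule F O} (h1 : IsTypeU U) (h2 : IsTypeD U) :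
    False := by
  obtain ⟨-, L, hL, hs⟩ := h1
  obtain ⟨-, L', hL', hs'⟩ := h2
  rw [hL] at hL'
  rw [Set.singleton_injective hL'] at hs
  exact hs' hs

/-- The number of nilpotent lines separates Q, {U, Dn, Ds}, M and {J, Z}. Within these groups
stability of the line, the square class and the vanishing of products decide. -/
theorem planes_unique {X Y : PlaneType} {U : Submodule F O} (hX : U ∈ planes F O X)
    (hY : U ∈ planes F O Y) : X = Y := by
  have hU := h.isImagPlane_of_mem_planes hX
  have hQ : U ∈ planes F O .Q → (nilpotentLines U).ncard = 0 := fun h1 => by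
    rw [h1.2, Set.ncard_empty]
  have hU' : U ∈ planes F O .U → (nilpotentLines U).ncard = 1 := by
    rintro ⟨-, L, hL, -⟩; rw [hL, Set.ncard_singleton]
  have hDn : U ∈ planes F O .Dn → (nilpotentLines U).ncard = 1 := by
    rintro ⟨⟨-, L, hL, -⟩, -⟩; rw [hL, Set.ncard_singleton]
  have hDs : U ∈ planes F O .Ds → (nilpotentLines U).ncard = 1 := by
    rintro ⟨⟨-, L, hL, -⟩, -⟩; rw [hL, Set.ncard_singleton]
  have hM : U ∈ planes F O .M → (nilpotentLines U).ncard = 2 := fun h1 => h1.2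
  have hJ : U ∈ planes F O .J → 3 ≤ (nilpotentLines U).ncard := fun h1 =>
    h.three_le_ncard_nilpotentLines hU (h.isTypeJ_iff.1 h1).2.1
  have hZ : U ∈ planes F O .Z → 3 ≤ (nilpotentLines U).ncard := fun h1 =>
    h.three_le_ncard_nilpotentLines hU fun x hx => (h.isTypeZ_iff.1 h1).2 x hx x hx
  cases X <;> cases Y <;>
    first
    | rfl
    | exact (h.not_isTypeDn_and_isTypeDs hX hY).elim
    | exact (h.not_isTypeDn_and_isTypeDs hY hX).elim
    | exact (not_isTypeU_and_isTypeD hX hY.1).elim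
    | exact (not_isTypeU_and_isTypeD hY hX.1).elim
    | exact (hX.2.2 hY.2.2).elim
    | exact (hY.2.2 hX.2.2).elim
    | (exfalso
       first | have := hQ hX | have := hU' hX | have := hDn hX | have := hDs hX | have := hM hX
             | have := hJ hX | have := hZ hX
       first | have := hQ hY | have := hU' hY | have := hDn hY | have := hDs hY | have := hM hY
             | have := hJ hY | have := hZ hY
       omega)

theorem ncard_planes_sum (P : Submodule F O → Prop) :
    {U | IsImagPlane U ∧ P U}.ncard =
      {U ∈ planes F O .Q | P U}.ncard + ({U ∈ planes F O .U | P U}.ncard +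
        ({U ∈ planes F O .Dn | P U}.ncard + ({U ∈ planes F O .Ds | P U}.ncard +
          ({U ∈ planes F O .M | P U}.ncard + ({U ∈ planes F O .J | P U}.ncard +
            {U ∈ planes F O .Z | P U}.ncard))))) := by
  haveI := h.moduleFinite
  haveI : Finite O := finite_of_moduleFinite (F := F)
  haveI : Finite (Submodule F O) := finite_submodule
  have hdis : ∀ X Y, X ≠ Y → Disjoint {U ∈ planes F O X | P U} {U ∈ planes F O Y | P U} :=
    fun X Y hXY => Set.disjoint_left.2 fun U h1 h2 => hXY (h.planes_unique h1.1 h2.1)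
  have e : {U | IsImagPlane U ∧ P U} = {U ∈ planes F O .Q | P U} ∪ ({U ∈ planes F O .U | P U} ∪
        ({U ∈ planes F O .Dn | P U} ∪ ({U ∈ planes F O .Ds | P U} ∪
          ({U ∈ planes F O .M | P U} ∪ ({U ∈ planes F O .J | P U} ∪
            {U ∈ planes F O .Z | P U}))))) := by
    ext U
    constructor
    · rintro ⟨hU, hP⟩
      obtain ⟨X, hX⟩ := h.exists_mem_planes hU
      cases X <;> simp [hX, hP]
    · rintro (h1 | h1 | h1 | h1 | h1 | h1 | h1) <;>
        exact ⟨h.isImagPlane_of_mem_planes h1.1, h1.2⟩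
  rw [e]
  iterate 6
    rw [Set.ncard_union_eq (by
      simp [Set.disjoint_union_right, hdis])]

end IsCayleyTrace

end PlaneTypes

/-! ### Subalgebra types in terms of imaginary parts and the radical of the trace form. -/

section Subalgebras

variable [SMulCommClass F O O] [IsScalarTower F O O] {t : O →ₗ[F] F}

/-- `W` is the imaginary part of a four-dimensional subalgebra. -/
def IsImagSubalgebra (t : O →ₗ[F] F) (W : Submodule F O) : Prop :=
  W ≤ imag F O ∧ Module.finrank F W = 3 ∧ ∀ x ∈ W, ∀ y ∈ W, x * y - (t (x * y) / 2) • 1 ∈ W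

/-- The radical of the trace form on `W`. -/
def traceRad (t : O →ₗ[F] F) (W : Submodule F O) : Submodule F O where
  carrier := {x | x ∈ W ∧ ∀ y ∈ W, t (x * y) = 0}
  zero_mem' := by simp
  add_mem' := fun {x y} hx hy =>
    ⟨W.add_mem hx.1 hy.1, fun z hz => by rw [add_mul, map_add, hx.2 z hz, hy.2 z hz, add_zero]⟩
  smul_mem' := fun c x hx =>
    ⟨W.smul_mem c hx.1, fun z hz => by rw [smul_mul_assoc, map_smul, hx.2 z hz, smul_zero]⟩

/-- `w² = c ≠ 0` and the radical of the trace form on `W` is the orthogonal complement of `w`. -/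
def IsRankOne (t : O →ₗ[F] F) (w : O) (c : F) (W : Submodule F O) : Prop :=
  w ∈ W ∧ w * w = c • 1 ∧ c ≠ 0 ∧ ∀ x ∈ W, t (w * x) = 0 → x ∈ traceRad t W

/-- The imaginary parts of the four-dimensional subalgebras of a given type. -/
def imagSubalgs (t : O →ₗ[F] F) : SubalgType → Set (Submodule F O)
  | .M4 => {W | IsImagSubalgebra t W ∧ traceRad t W = ⊥}
  | .F2J2 => {W | IsImagSubalgebra t W ∧ ∃ w c, IsRankOne t w c W ∧ ¬ IsSquare c}
  | .S2J2 => {W | IsImagSubalgebra t W ∧ ∃ w, IsRankOne t w 1 W}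
  | .F1J3 => {W | IsImagSubalgebra t W ∧ traceRad t W = W}

omit [InvolutiveAlgebra F O] [SMulCommClass F O O] [IsScalarTower F O O] in
theorem mem_span_one {w x : O} : x ∈ Submodule.span F {1, w} ↔ ∃ a b : F, x = a • 1 + b • w := by
  rw [Submodule.mem_span_pair]
  exact ⟨fun ⟨a, b, hab⟩ => ⟨a, b, hab.symm⟩, fun ⟨a, b, hab⟩ => ⟨a, b, hab.symm⟩⟩

omit [InvolutiveAlgebra F O] in
theorem span_one_mul {w : O} {c : F} (hw : w * w = c • 1) (a b a' b' : F) :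
    (a • (1 : O) + b • w) * (a' • 1 + b' • w) =
      (a * a' + c * (b * b')) • 1 + (a * b' + b * a') • w := by
  simp only [add_mul, mul_add, smul_mul_assoc, mul_smul_comm, one_mul, mul_one, hw]
  module

namespace IsCayleyTrace

variable (h : IsCayleyTrace F t)
include h

theorem imag_eq_ker : imag F O = LinearMap.ker t := by ext x; exact h.mem_imag

theorem sub_mem_imag (x : O) : x - (t x / 2) • 1 ∈ imag F O := by
  have h2 := h.two
  rw [h.mem_imag, map_sub, map_smul, h.trace_one]; simp [h2]

theorem sub_mem_inf {H : Submodule F O} (h1 : 1 ∈ H) {x : O} (hx : x ∈ H) :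
    x - (t x / 2) • 1 ∈ H ⊓ imag F O :=
  ⟨H.sub_mem hx (H.smul_mem _ h1), h.sub_mem_imag x⟩

theorem finrank_inf_imag {H : Submodule F O} (h1 : 1 ∈ H) :
    Module.finrank F (H ⊓ imag F O : Submodule F O) + 1 = Module.finrank F H := by
  haveI := h.moduleFinite
  rw [h.imag_eq_ker]
  exact finrank_inf_ker h1 (by rw [h.trace_one]; exact h.two)

theorem sup_inf_imag {H : Submodule F O} (h1 : 1 ∈ H) :
    Submodule.span F {1} ⊔ H ⊓ imag F O = H := by
  apply le_antisymm
  · exact sup_le ((Submodule.span_singleton_le_iff_mem _ _).2 h1) inf_le_left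
  · intro x hx
    exact Submodule.mem_sup.2 ⟨(t x / 2) • 1,
      Submodule.smul_mem _ _ (Submodule.mem_span_singleton_self _), _, h.sub_mem_inf h1 hx, by abel⟩

theorem inf_imag_sup {W : Submodule F O} (hW : W ≤ imag F O) :
    (Submodule.span F {1} ⊔ W) ⊓ imag F O = W := by
  apply le_antisymm
  · rintro x ⟨hx, hi⟩
    obtain ⟨y, hy, z, hz, rfl⟩ := Submodule.mem_sup.1 hx
    obtain ⟨c, rfl⟩ := Submodule.mem_span_singleton.1 hy
    have h1 : t (c • (1 : O) + z) = 0 := h.mem_imag.1 hi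
    rw [map_add, h.mem_imag.1 (hW hz), map_smul, h.trace_one, add_zero, smul_eq_mul] at h1
    rw [(mul_eq_zero.1 h1).resolve_right h.two, zero_smul, zero_add]
    exact hz
  · exact le_inf le_sup_right hW

/-- Since `t 1 = 2` is nonzero, `H` is the sum of `F1` and its imaginary part. Products of general
elements reduce to products of imaginary parts and terms already in `H`. -/
theorem isSubalgebra4_iff {H : Submodule F O} :
    IsSubalgebra4 H ↔ 1 ∈ H ∧ IsImagSubalgebra t (H ⊓ imag F O) := by
  constructor
  · rintro ⟨⟨h1, hm⟩, hr⟩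
    have := h.finrank_inf_imag h1
    refine ⟨h1, inf_le_right, by omega, fun x hx y hy => h.sub_mem_inf h1 (hm x hx.1 y hy.1)⟩
  · rintro ⟨h1, -, hr, hm⟩
    have := h.finrank_inf_imag h1
    refine ⟨⟨h1, fun x hx y hy => ?_⟩, by omega⟩
    have hx' := h.sub_mem_inf h1 hx
    have hy' := h.sub_mem_inf h1 hy
    have key : ∀ x ∈ H ⊓ imag F O, ∀ y ∈ H ⊓ imag F O, x * y ∈ H := fun x hx y hy => by
      have := H.add_mem (hm x hx y hy).1 (H.smul_mem (t (x * y) / 2) h1)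
      rwa [sub_add_cancel] at this
    have e : x * y = (x - (t x / 2) • 1) * (y - (t y / 2) • 1) + (t x / 2) • y + (t y / 2) • x -
        (t x / 2 * (t y / 2)) • 1 := by
      simp only [sub_mul, mul_sub, smul_mul_assoc, mul_smul_comm, one_mul, mul_one]
      module
    rw [e]
    exact H.sub_mem (H.add_mem (H.add_mem (key _ hx' _ hy') (H.smul_mem _ hy)) (H.smul_mem _ hx))
      (H.smul_mem _ h1)

theorem traceRad_inf_imag {H : Submodule F O} (h1 : 1 ∈ H) :
    traceRad t (H ⊓ imag F O) = traceRad t H := by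
  ext x
  constructor
  · rintro ⟨hx, hy⟩
    refine ⟨hx.1, fun y hyH => ?_⟩
    have := hy _ (h.sub_mem_inf h1 hyH)
    rwa [mul_sub, mul_smul_comm, mul_one, map_sub, map_smul, h.mem_imag.1 hx.2, smul_zero,
      sub_zero] at this
  · rintro ⟨hx, hy⟩
    have := hy 1 h1
    rw [mul_one] at this
    exact ⟨⟨hx, h.mem_imag.2 this⟩, fun y hyH => hy y hyH.1⟩

/-- A nilpotent element has trace zero. Conversely, if `x` is orthogonal to `H`, then `t((xy)²) =
t(x(y(xy)))` vanishes, so each trace-zero element `xy` has square zero. -/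
theorem isJacobsonRadical_iff {H J : Submodule F O} (hH : IsSubalgebra H) :
    IsJacobsonRadical H J ↔ J = traceRad t H := by
  have key : ∀ x, (x ∈ H ∧ ∀ y ∈ H, Nilpotent (x * y)) ↔ x ∈ traceRad t H := by
    intro x
    refine and_congr_right fun hx => ?_
    constructor
    · intro h1 y hy
      exact (h.nilpotent_iff.1 (h1 y hy)).1
    · intro h1 y hy
      rw [h.nilpotent_iff, h.mul_self_eq_zero (h1 y hy), h.assoc]
      exact ⟨h1 y hy, h1 _ (hH.2 _ hy _ (hH.2 _ hx _ hy))⟩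
  unfold IsJacobsonRadical
  simp only [key]
  exact ⟨fun h1 => Submodule.ext h1, fun h1 => by simp [h1]⟩

theorem isIdealOf_traceRad {H : Submodule F O} (hH : IsSubalgebra H) :
    IsIdealOf (traceRad t H) H := by
  refine ⟨fun x hx => hx.1, fun a ha x hx => ⟨⟨hH.2 a ha x hx.1, fun y hy => ?_⟩,
    ⟨hH.2 x hx.1 a ha, fun y hy => ?_⟩⟩⟩
  · rw [h.assoc, h.comm, h.assoc]
    exact hx.2 _ (hH.2 y hy a ha)
  · rw [h.assoc]
    exact hx.2 _ (hH.2 a ha y hy)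

/-- A nondegenerate three-dimensional space contains no isotropic plane. -/
theorem exists_mul_self_ne_zero {W S : Submodule F O} (hW : W ≤ imag F O)
    (hr : Module.finrank F W = 3) (hrad : traceRad t W = ⊥) (hS : S ≤ W)
    (hSr : 2 ≤ Module.finrank F S) : ∃ x ∈ S, x * x ≠ 0 := by
  by_contra! hc
  haveI := h.moduleFinite
  obtain ⟨w, hw⟩ : ∃ w ∈ W, W ≤ S ⊔ Submodule.span F {w} := by
    by_cases hSW : W ≤ S
    · exact ⟨0, W.zero_mem, hSW.trans le_sup_left⟩
    · obtain ⟨w, hw, hwS⟩ := SetLike.not_le_iff_exists.1 hSW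
      refine ⟨w, hw, ?_⟩
      rw [← eq_sup_span hS hw hwS]
      have h1 := finrank_sup_span hwS
      have h3 := Submodule.finrank_mono
        (sup_le hS ((Submodule.span_singleton_le_iff_mem _ _).2 hw) : S ⊔ Submodule.span F {w} ≤ W)
      omega
  -- A totally isotropic `S` of dimension at least two has a nonzero vector orthogonal to `w`. That
  -- vector is orthogonal to `S + Fw`, hence to `W`.
  have h1 := finrank_le_inf_ker S (t ∘ₗ LinearMap.mulLeft F w)
  obtain ⟨s, ⟨hs, hsw⟩, hs0⟩ := exists_mem_ne_zero_of_finrank_pos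
    (P := S ⊓ LinearMap.ker (t ∘ₗ LinearMap.mulLeft F w)) (by omega)
  apply hs0
  rw [← Submodule.mem_bot F, ← hrad]
  refine ⟨hS hs, fun y hy => ?_⟩
  obtain ⟨s', hs', z, hz, rfl⟩ := Submodule.mem_sup.1 (hw.2 hy)
  obtain ⟨a, rfl⟩ := Submodule.mem_span_singleton.1 hz
  have e1 := hc _ (S.add_mem hs hs')
  rw [add_mul, mul_add, mul_add, hc s hs, hc s' hs', zero_add, add_zero,
    h.add_comm_mul (h.mem_imag.1 (hW (hS hs))) (h.mem_imag.1 (hW (hS hs')))] at e1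
  rw [mul_add, map_add, h.smul_one_inj e1, mul_smul_comm, map_smul, h.comm s w,
    show t (w * s) = 0 from hsw]
  simp

/-- The radical is an ideal without `1`. Conversely, in the nondegenerate case a nonzero ideal
contains some `z` with nonzero trace. Take an anisotropic imaginary `y` orthogonal to the imaginary
part of `z`: then `zy + yz = t(z) y` puts `y`, and with it the nonzero scalar `y²`, in the ideal. -/
theorem isSimpleSubalgebra_iff {H : Submodule F O} (hH : IsSubalgebra4 H) :
    IsSimpleSubalgebra H ↔ traceRad t H = ⊥ := by
  haveI := h.moduleFinite
  have h2 := h.two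
  constructor
  · intro hs
    refine (hs _ (h.isIdealOf_traceRad hH.1)).resolve_right fun he => ?_
    have h1 : (1 : O) ∈ traceRad t H := he.ge hH.1.1
    have := h1.2 1 hH.1.1
    rw [mul_one, h.trace_one] at this
    exact h2 this
  · intro hrad I hI
    by_contra! hc
    obtain ⟨hI0, hI1⟩ := hc
    have hone : (1 : O) ∉ I := fun h1 => hI1 (le_antisymm hI.1 fun a ha => by
      have := (hI.2 a ha 1 h1).1
      rwa [mul_one] at this)
    obtain ⟨z, hz, htz⟩ : ∃ z ∈ I, t z ≠ 0 := by
      by_contra! hc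
      apply hI0
      rw [Submodule.eq_bot_iff]
      intro x hx
      rw [← Submodule.mem_bot F, ← hrad]
      exact ⟨hI.1 hx, fun y hy => hc _ (hI.2 y hy x hx).2⟩
    have hW := (h.isSubalgebra4_iff.1 hH).2
    set W := H ⊓ imag F O with hWdef
    have h1 := finrank_le_inf_ker W (t ∘ₗ LinearMap.mulLeft F (z - (t z / 2) • (1 : O)))
    obtain ⟨y, ⟨hy, hzy⟩, hyy⟩ := h.exists_mul_self_ne_zero
      (S := W ⊓ LinearMap.ker (t ∘ₗ LinearMap.mulLeft F (z - (t z / 2) • (1 : O)))) hW.1 hW.2.1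
      (by rw [h.traceRad_inf_imag hH.1.1, hrad]) inf_le_left (by have := hW.2.1; omega)
    have hty := h.mem_imag.1 hy.2
    have hzy : t ((z - (t z / 2) • (1 : O)) * y) = 0 := hzy
    rw [sub_mul, smul_mul_assoc, one_mul, map_sub, map_smul, hty, smul_zero, sub_zero] at hzy
    have e := h.quadratic z y
    rw [hzy, hty, zero_smul, mul_zero, sub_self, zero_smul, add_zero, add_zero] at e
    have hyI : y ∈ I := by
      rw [← Submodule.smul_mem_iff I htz, ← e]
      exact I.add_mem (hI.2 y hy.1 z hz).2 (hI.2 y hy.1 z hz).1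
    have h3 := (hI.2 y hy.1 y hyI).1
    rw [h.mul_self hty, Submodule.smul_mem_iff] at h3
    · exact hone h3
    · intro h0
      rw [h.mul_self hty, h0, zero_smul] at hyy
      exact hyy rfl

theorem linearIndependent_one {w : O} (hw : t w = 0) (hw0 : w ≠ 0) {a b : F}
    (hab : a • (1 : O) + b • w = 0) : a = 0 ∧ b = 0 := by
  have ha : a = 0 := by
    have := congrArg t hab
    simpa [hw, h.trace_one, h.two] using this
  rw [ha, zero_smul, zero_add] at hab
  exact ⟨ha, (smul_eq_zero.1 hab).resolve_right hw0⟩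

theorem ne_zero_of_mul_self {w : O} {c : F} (hww : w * w = c • 1) (hc : c ≠ 0) : w ≠ 0 := by
  rintro rfl
  rw [mul_zero] at hww
  exact hc (h.smul_one_inj hww.symm)

theorem isCayleyDickson2_span {w : O} {c : F} (hw : t w = 0) (hww : w * w = c • 1) (hc : c ≠ 0) :
    IsCayleyDickson2 (Submodule.span F {1, w}) := by
  refine ⟨⟨mem_span_one.2 ⟨1, 0, by simp⟩, fun x hx y hy => ?_⟩, c, hc,
    { toFun := fun x => (re x : F) • (1 : O) + (im x : F) • w
      map_add' := fun x y => by rw [re_add, im_add]; module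
      map_smul' := fun a x => by
        rw [re_smul, im_smul, smul_eq_mul, smul_eq_mul, RingHom.id_apply]; module }, ?_, ?_, ?_⟩
  · obtain ⟨a, b, rfl⟩ := mem_span_one.1 hx
    obtain ⟨a', b', rfl⟩ := mem_span_one.1 hy
    rw [span_one_mul hww]
    exact mem_span_one.2 ⟨_, _, rfl⟩
  · rw [← LinearMap.ker_eq_bot, Submodule.eq_bot_iff]
    intro x hx
    obtain ⟨h1, h3⟩ := h.linearIndependent_one hw (h.ne_zero_of_mul_self hww hc) hx
    exact ext' h1 h3
  · intro x y
    change (x * y).re • (1 : O) + (x * y).im • w =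
      ((re x : F) • (1 : O) + (im x : F) • w) * ((re y : F) • (1 : O) + (im y : F) • w)
    rw [span_one_mul hww, re_mul, im_mul, conj_self, conj_self, smul_eq_mul]
    congr 2 <;> ring
  · ext x
    rw [mem_span_one]
    constructor
    · rintro ⟨y, rfl⟩
      exact ⟨_, _, rfl⟩
    · rintro ⟨a, b, rfl⟩
      exact ⟨DicksonDouble.mk c a b, rfl⟩

/-- The norm form `p² - c r²` vanishes only at zero when `c` is a non-square, so linear equations
are solved by Cramer's rule. Commutativity handles the other side. -/
theorem isDivisionSubalgebra_span {w : O} {c : F} (hw : t w = 0) (hww : w * w = c • 1)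
    (hc : ¬ IsSquare c) : IsDivisionSubalgebra (Submodule.span F {1, w}) := by
  have hc0 : c ≠ 0 := by rintro rfl; exact hc ⟨0, by simp⟩
  have hw0 := h.ne_zero_of_mul_self hww hc0
  have key : ∀ a ∈ Submodule.span F {1, w}, a ≠ 0 → ∀ b ∈ Submodule.span F {1, w},
      ∃! x, x ∈ Submodule.span F {1, w} ∧ a * x = b := by
    intro a ha ha0 b hb
    obtain ⟨p, r, rfl⟩ := mem_span_one.1 ha
    obtain ⟨m, n, rfl⟩ := mem_span_one.1 hb
    have hN : p ^ 2 - c * r ^ 2 ≠ 0 := by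
      intro h0
      by_cases hr : r = 0
      · have : p = 0 := by simpa [hr] using h0
        exact ha0 (by simp [hr, this])
      · exact hc ⟨p / r, by field_simp; linear_combination -h0⟩
    refine ⟨((p * m - c * r * n) / (p ^ 2 - c * r ^ 2)) • 1 +
      ((p * n - r * m) / (p ^ 2 - c * r ^ 2)) • w, ⟨mem_span_one.2 ⟨_, _, rfl⟩, ?_⟩, ?_⟩
    · generalize hNN : p ^ 2 - c * r ^ 2 = N at hN
      rw [span_one_mul hww]
      congr 2
      · field_simp; linear_combination m * hNN
      · field_simp; linear_combination n * hNN
    · rintro x ⟨hx, he⟩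
      obtain ⟨s, u, rfl⟩ := mem_span_one.1 hx
      rw [span_one_mul hww] at he
      obtain ⟨h1, h3⟩ := h.linearIndependent_one hw hw0 (a := p * s + c * (r * u) - m)
        (b := p * u + r * s - n) (by linear_combination (norm := module) he)
      congr 2
      · rw [eq_div_iff hN]; linear_combination p * h1 - c * r * h3
      · rw [eq_div_iff hN]; linear_combination p * h3 - r * h1
  intro a ha ha0 b hb
  refine ⟨key a ha ha0 b hb, ?_⟩
  have hcomm : ∀ x ∈ Submodule.span F {1, w}, x * a = a * x := by
    intro x hx
    obtain ⟨p, r, rfl⟩ := mem_span_one.1 ha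
    obtain ⟨m, n, rfl⟩ := mem_span_one.1 hx
    rw [span_one_mul hww, span_one_mul hww]
    congr 2 <;> ring
  obtain ⟨x, hx, hu⟩ := key a ha ha0 b hb
  exact ⟨x, ⟨hx.1, by rw [hcomm x hx.1, hx.2]⟩,
    fun y hy => hu y ⟨hy.1, by rw [← hcomm y hy.1, hy.2]⟩⟩

theorem exists_zero_divisors_span {w : O} {c : F} (hw : t w = 0) (hww : w * w = c • 1) (hc0 : c ≠ 0)
    (hc : IsSquare c) : ∃ x ∈ Submodule.span F {1, w}, x ≠ 0 ∧ ∃ y ∈ Submodule.span F {1, w},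
      y ≠ 0 ∧ x * y = 0 := by
  obtain ⟨s, rfl⟩ := hc
  have hw0 := h.ne_zero_of_mul_self hww hc0
  have hs : s ≠ 0 := by rintro rfl; simp at hc0
  refine ⟨_, mem_span_one.2 ⟨s, 1, rfl⟩, fun h0 => hs (h.linearIndependent_one hw hw0 h0).1,
    _, mem_span_one.2 ⟨s, -1, rfl⟩, fun h0 => hs (h.linearIndependent_one hw hw0 h0).1, ?_⟩
  rw [span_one_mul hww]
  match_scalars <;> ring

omit h [InvolutiveAlgebra F O] [SMulCommClass F O O] [IsScalarTower F O O] in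
theorem not_hasZeroDivisors {D : Submodule F O} (hD : IsDivisionSubalgebra D) :
    ¬ HasZeroDivisors D := by
  rintro ⟨x, hx, hx0, y, hy, hy0, he | he⟩
  · exact hy0 ((hD x hx hx0 0 D.zero_mem).1.unique ⟨hy, he⟩ ⟨D.zero_mem, mul_zero x⟩)
  · exact hy0 ((hD x hx hx0 0 D.zero_mem).2.unique ⟨hy, he⟩ ⟨D.zero_mem, zero_mul x⟩)

/-- `w` is the image of the generator `i` of the double. The embedding need not respect the
involution, so `t w = 0` needs an argument: `w²` is scalar, and a nonzero trace would make `w`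
scalar by the quadratic equation. -/
theorem exists_isRankOne {H D J : Submodule F O} (hH : IsSubalgebra4 H)
    (hJ : IsJacobsonRadical H J) (hD : IsCayleyDickson2 D) (hsup : D ⊔ J = H) :
    ∃ w c, IsRankOne t w c (H ⊓ imag F O) ∧ D = Submodule.span F {1, w} := by
  obtain ⟨⟨h1D, -⟩, c, hc, e, hinj, hmul, rfl⟩ := hD
  rw [h.isJacobsonRadical_iff hH.1] at hJ
  have he1 : e 1 = 1 := by
    obtain ⟨z, hz⟩ := h1D
    have := hmul 1 z
    rw [one_mul, hz, mul_one] at this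
    exact this.symm
  set w := e (DicksonDouble.mk c 0 1) with hw
  have hform : ∀ a b : F, e (DicksonDouble.mk c a b) = a • 1 + b • w := by
    intro a b
    rw [hw, ← he1, ← map_smul, ← map_smul, ← map_add]
    congr 1
    apply ext' <;> simp
  have hww : w * w = c • 1 := by
    rw [hw, ← hmul]
    have : DicksonDouble.mk c 0 1 * DicksonDouble.mk c (0 : F) 1 = DicksonDouble.mk c c 0 := by
      apply ext' <;> simp [conj_self]
    rw [this, hform]; simp
  have hw1 : ∀ s : F, w ≠ s • 1 := by
    intro s hs
    rw [hw, ← he1, ← map_smul] at hs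
    have := congrArg im (hinj hs)
    simp at this
  have htw : t w = 0 := by
    by_contra h0
    have h1 := h.quadratic w w
    rw [hww] at h1
    apply hw1 ((2 * c - (t (c • (1 : O)) - t w * t w)) / (2 * t w))
    have h3 : 2 * t w ≠ 0 := mul_ne_zero h.two h0
    apply smul_right_injective O h3
    dsimp only
    rw [smul_smul, mul_div_cancel₀ _ h3]
    linear_combination (norm := module) -h1
  have hrange : LinearMap.range e = Submodule.span F {1, w} := by
    ext x
    rw [mem_span_one]
    constructor
    · rintro ⟨y, rfl⟩
      exact ⟨re y, im y, hform _ _⟩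
    · rintro ⟨a, b, rfl⟩
      exact ⟨_, hform a b⟩
  refine ⟨w, c, ⟨⟨?_, h.mem_imag.2 htw⟩, hww, hc, fun x hx hwx => ?_⟩, hrange⟩
  · rw [← hsup]
    exact (le_sup_left : LinearMap.range e ≤ _) ⟨_, rfl⟩
  · rw [h.traceRad_inf_imag hH.1.1, ← hJ]
    have hxH := hx.1
    rw [← hsup, hrange] at hxH
    obtain ⟨y, hy, j, hj, rfl⟩ := Submodule.mem_sup.1 hxH
    obtain ⟨a, b, rfl⟩ := mem_span_one.1 hy
    have hjw : t (j * w) = 0 := by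
      rw [hJ] at hj
      refine hj.2 w ?_
      rw [← hsup]
      exact (le_sup_left : LinearMap.range e ≤ _) ⟨_, rfl⟩
    have htj : t j = 0 := by
      rw [hJ] at hj
      simpa using hj.2 1 hH.1.1
    have ha : a = 0 := by
      have := h.mem_imag.1 hx.2
      simpa [htw, htj, h.trace_one, h.two] using this
    have hb : b = 0 := by
      rw [mul_add, mul_add, mul_smul_comm, mul_smul_comm, hww, map_add, map_add, h.comm w j,
        hjw] at hwx
      simpa [ha, htw, h.trace_one, h.two, hc] using hwx
    rw [ha, hb]; simpa using hj

section RankOne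

variable {W : Submodule F O} (hW : IsImagSubalgebra t W) {w : O} {c : F} (hw : IsRankOne t w c W)
include hW hw

theorem IsRankOne.trace_mul_self_ne_zero : t (w * w) ≠ 0 := by
  rw [hw.2.1, map_smul, h.trace_one]
  exact mul_ne_zero hw.2.2.1 h.two

theorem IsRankOne.traceRad_eq : traceRad t W = W ⊓ orth t w := by
  ext x
  constructor
  · intro hx
    refine ⟨hx.1, mem_orth.2 ?_⟩
    rw [h.comm]
    exact hx.2 w hw.1
  · rintro ⟨hx, hwx⟩
    exact hw.2.2.2 x hx hwx

theorem IsRankOne.smul {s : F} (hs : s ≠ 0) : IsRankOne t (s • w) (s * s * c) W := by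
  refine ⟨W.smul_mem s hw.1, ?_, mul_ne_zero (mul_ne_zero hs hs) hw.2.2.1, fun x hx hwx => ?_⟩
  · rw [smul_mul_assoc, mul_smul_comm, hw.2.1, smul_smul, smul_smul, mul_assoc]
  · refine hw.2.2.2 x hx ?_
    rw [smul_mul_assoc, map_smul] at hwx
    exact (smul_eq_zero.1 hwx).resolve_left hs

theorem IsRankOne.finrank_traceRad : Module.finrank F (traceRad t W) = 2 := by
  haveI := h.moduleFinite
  have := finrank_inf_ker (f := t ∘ₗ LinearMap.mulLeft F w) hw.1
    (IsRankOne.trace_mul_self_ne_zero h hW hw)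
  rw [hW.2.1] at this
  rw [IsRankOne.traceRad_eq h hW hw]
  exact Nat.succ.inj this

theorem IsRankOne.exists_eq {x : O} (hx : x ∈ W) : ∃ (a : F) (r : O), r ∈ traceRad t W ∧
    x = a • w + r := by
  have hne := IsRankOne.trace_mul_self_ne_zero h hW hw
  refine ⟨t (w * x) / t (w * w), x - (t (w * x) / t (w * w)) • w, ?_, by abel⟩
  rw [IsRankOne.traceRad_eq h hW hw]
  refine ⟨W.sub_mem hx (W.smul_mem _ hw.1), mem_orth.2 ?_⟩
  rw [mul_sub, mul_smul_comm, map_sub, map_smul, smul_eq_mul, div_mul_cancel₀ _ hne,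
    sub_self]

/-- The radical is a totally isotropic plane and an ideal, hence closed under products, and
`mul_eq_zero_of_mul_mem` applies. -/
theorem IsRankOne.isTypeZ : IsTypeZ (traceRad t W) := by
  haveI := h.moduleFinite
  have hU : IsImagPlane (traceRad t W) :=
    ⟨fun x hx => hW.1 hx.1, IsRankOne.finrank_traceRad h hW hw⟩
  rw [h.isTypeZ_iff]
  refine ⟨hU, ?_⟩
  have hiso : ∀ x ∈ traceRad t W, x * x = 0 := fun x hx => by
    rw [h.mul_self_eq_zero (h.mem_imag.1 (hW.1 hx.1))]
    exact hx.2 x hx.1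
  have hsub : IsSubalgebra4 (Submodule.span F {1} ⊔ W) := by
    rw [h.isSubalgebra4_iff, h.inf_imag_sup hW.1]
    exact ⟨(le_sup_left : Submodule.span F {(1 : O)} ≤ _) (Submodule.mem_span_singleton_self 1), hW⟩
  have hid := h.isIdealOf_traceRad hsub.1
  rw [← h.traceRad_inf_imag hsub.1.1, h.inf_imag_sup hW.1] at hid
  intro x hx y hy
  by_cases hdep : ∃ a : F, y = a • x
  · obtain ⟨a, rfl⟩ := hdep
    rw [mul_smul_comm, hiso x hx, smul_zero]
  · push Not at hdep
    have hx0 : x = 0 ∨ x ≠ 0 := eq_or_ne x 0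
    rcases hx0 with rfl | hx0
    · rw [zero_mul]
    · obtain ⟨a, b, hab⟩ := exists_mem_span_pair hU.2 hx hy hx0 hdep
        (hid.2 x (hid.1 hx) y hy).1
      exact h.mul_eq_zero_of_mul_mem (hiso x hx) (hiso y hy) hab

end RankOne

theorem IsRankOne.decomposition {H : Submodule F O} (hH : IsSubalgebra4 H) {w : O} {c : F}
    (hw : IsRankOne t w c (H ⊓ imag F O)) :
    IsJacobsonRadical H (traceRad t H) ∧ IsTypeZ (traceRad t H) ∧
      IsCayleyDickson2 (Submodule.span F {1, w}) ∧
        Submodule.span F {1, w} ⊓ traceRad t H = ⊥ ∧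
          Submodule.span F {1, w} ⊔ traceRad t H = H := by
  have hW := (h.isSubalgebra4_iff.1 hH).2
  have htw := h.mem_imag.1 hw.1.2
  have hrad := h.traceRad_inf_imag hH.1.1
  refine ⟨(h.isJacobsonRadical_iff hH.1).2 rfl, ?_, h.isCayleyDickson2_span htw hw.2.1 hw.2.2.1,
    ?_, ?_⟩
  · rw [← hrad]
    exact IsRankOne.isTypeZ h hW hw
  · rw [Submodule.eq_bot_iff]
    rintro x ⟨hx, hxr⟩
    obtain ⟨a, b, rfl⟩ := mem_span_one.1 hx
    have h1 := hxr.2 1 hH.1.1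
    have h3 := hxr.2 w hw.1.1
    have ha : a = 0 := by simpa [htw, h.trace_one, h.two] using h1
    have hb : b = 0 := by
      simpa [ha, smul_mul_assoc, hw.2.1, h.trace_one, h.two, hw.2.2.1] using h3
    rw [ha, hb]; simp
  · apply le_antisymm
    · refine sup_le ?_ (fun x hx => hx.1)
      rw [Submodule.span_le]
      rintro x (rfl | rfl)
      · exact hH.1.1
      · exact hw.1.1
    · intro x hx
      obtain ⟨a, r, hr, he⟩ := IsRankOne.exists_eq h hW hw (h.sub_mem_inf hH.1.1 hx)
      rw [hrad] at hr
      exact Submodule.mem_sup.2 ⟨_, mem_span_one.2 ⟨t x / 2, a, rfl⟩, r, hr, by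
        linear_combination (norm := module) -he⟩

/-- Types of subalgebras in terms of their imaginary parts. -/
theorem mem_subalgs_iff (Y : SubalgType) {H : Submodule F O} :
    H ∈ subalgs F O Y ↔ 1 ∈ H ∧ H ⊓ imag F O ∈ imagSubalgs t Y := by
  haveI := h.moduleFinite
  have hand : ∀ {P Q : Prop}, (IsSubalgebra4 H → (P ↔ Q)) →
      ((IsSubalgebra4 H ∧ P) ↔ (1 ∈ H ∧ IsImagSubalgebra t (H ⊓ imag F O) ∧ Q)) := by
    intro P Q hPQ
    rw [← and_assoc, ← h.isSubalgebra4_iff]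
    exact and_congr_right hPQ
  cases Y
  · refine hand fun hH => ?_
    rw [h.isSimpleSubalgebra_iff hH, h.traceRad_inf_imag hH.1.1]
  · refine hand fun hH => ?_
    constructor
    · rintro ⟨D, J, hJ, -, hD, hdiv, -, hsup⟩
      obtain ⟨w, c, hw, rfl⟩ := h.exists_isRankOne hH hJ hD hsup
      refine ⟨w, c, hw, fun hs => ?_⟩
      obtain ⟨x, hx, hx0, y, hy, hy0, he⟩ :=
        h.exists_zero_divisors_span (h.mem_imag.1 hw.1.2) hw.2.1 hw.2.2.1 hs
      exact not_hasZeroDivisors hdiv ⟨x, hx, hx0, y, hy, hy0, Or.inl he⟩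
    · rintro ⟨w, c, hw, hs⟩
      obtain ⟨h1, h3, h4, h5, h6⟩ := IsRankOne.decomposition h hH hw
      exact ⟨_, _, h1, h3, h4, h.isDivisionSubalgebra_span (h.mem_imag.1 hw.1.2) hw.2.1 hs, h5, h6⟩
  · refine hand fun hH => ?_
    constructor
    · rintro ⟨D, J, hJ, -, hD, hz, -, hsup⟩
      obtain ⟨w, c, hw, rfl⟩ := h.exists_isRankOne hH hJ hD hsup
      have hs : IsSquare c := by
        by_contra hs
        exact not_hasZeroDivisors
          (h.isDivisionSubalgebra_span (h.mem_imag.1 hw.1.2) hw.2.1 hs) hz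
      obtain ⟨s, rfl⟩ := hs
      have hs0 : s ≠ 0 := by rintro rfl; exact hw.2.2.1 (by simp)
      -- Dividing `w` by a root of its square normalizes the square to 1.
      have := IsRankOne.smul h (h.isSubalgebra4_iff.1 hH).2 hw (inv_ne_zero hs0)
      rw [show s⁻¹ * s⁻¹ * (s * s) = 1 by field_simp] at this
      exact ⟨_, this⟩
    · rintro ⟨w, hw⟩
      obtain ⟨h1, h3, h4, h5, h6⟩ := IsRankOne.decomposition h hH hw
      obtain ⟨x, hx, hx0, y, hy, hy0, he⟩ :=
        h.exists_zero_divisors_span (h.mem_imag.1 hw.1.2) hw.2.1 hw.2.2.1 ⟨1, by simp⟩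
      exact ⟨_, _, h1, h3, h4, ⟨x, hx, hx0, y, hy, hy0, Or.inl he⟩, h5, h6⟩
  · refine hand fun hH => ?_
    have hW := (h.isSubalgebra4_iff.1 hH).2
    have hle : traceRad t (H ⊓ imag F O) ≤ H ⊓ imag F O := fun x hx => hx.1
    constructor
    · rintro ⟨J, hJ, hr⟩
      rw [h.isJacobsonRadical_iff hH.1, ← h.traceRad_inf_imag hH.1.1] at hJ
      exact Submodule.eq_of_le_of_finrank_eq hle (by rw [← hJ, hr, hW.2.1])
    · intro he
      refine ⟨_, (h.isJacobsonRadical_iff hH.1).2 rfl, ?_⟩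
      rw [← h.traceRad_inf_imag hH.1.1, he, hW.2.1]

end IsCayleyTrace

end Subalgebras

/-! ### Exhaustiveness of the subalgebra types, and the plane types inside each. -/

section PlanesInSubalgebras

variable [SMulCommClass F O O] [IsScalarTower F O O] {t : O →ₗ[F] F}

omit [SMulCommClass F O O] [IsScalarTower F O O] in
theorem one_lt_natCard_cast [Finite F] : (1 : ℚ) < Nat.card F := by
  exact_mod_cast Finite.one_lt_card (α := F)

namespace IsCayleyTrace

variable (h : IsCayleyTrace F t)
include h

theorem trace_mul_eq_zero {W : Submodule F O} (hW : W ≤ imag F O) (hiso : ∀ x ∈ W, x * x = 0)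
    {x y : O} (hx : x ∈ W) (hy : y ∈ W) : t (x * y) = 0 := by
  have e1 := hiso _ (W.add_mem hx hy)
  rw [add_mul, mul_add, mul_add, hiso x hx, hiso y hy, zero_add, add_zero,
    h.add_comm_mul (h.mem_imag.1 (hW hx)) (h.mem_imag.1 (hW hy))] at e1
  exact h.smul_one_inj e1

/-- Three mutually orthogonal anisotropic vectors cut the dimension down by one each, leaving zero.
-/
theorem eq_zero_of_orthogonal {W : Submodule F O} (hr : Module.finrank F W = 3) {x y z v : O}
    (hx : x ∈ W) (hy : y ∈ W) (hz : z ∈ W) (hxx : t (x * x) ≠ 0) (hyy : t (y * y) ≠ 0)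
    (hzz : t (z * z) ≠ 0) (hxy : t (x * y) = 0) (hxz : t (x * z) = 0) (hyz : t (y * z) = 0)
    (hv : v ∈ W) (hxv : t (x * v) = 0) (hyv : t (y * v) = 0) (hzv : t (z * v) = 0) : v = 0 := by
  haveI := h.moduleFinite
  have h1 := finrank_inf_ker (f := t ∘ₗ LinearMap.mulLeft F x) hx hxx
  have h2 := finrank_inf_ker (f := t ∘ₗ LinearMap.mulLeft F y)
    (P := W ⊓ LinearMap.ker (t ∘ₗ LinearMap.mulLeft F x)) ⟨hy, hxy⟩ hyy
  have h3 := finrank_inf_ker (f := t ∘ₗ LinearMap.mulLeft F z)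
    (P := W ⊓ LinearMap.ker (t ∘ₗ LinearMap.mulLeft F x) ⊓
      LinearMap.ker (t ∘ₗ LinearMap.mulLeft F y)) ⟨⟨hz, hxz⟩, hyz⟩ hzz
  rw [hr] at h1
  have h4 := Submodule.finrank_eq_zero.1 (show Module.finrank F
    (W ⊓ LinearMap.ker (t ∘ₗ LinearMap.mulLeft F x) ⊓ LinearMap.ker (t ∘ₗ LinearMap.mulLeft F y) ⊓
      LinearMap.ker (t ∘ₗ LinearMap.mulLeft F z) : Submodule F O) = 0 by omega)
  rw [← Submodule.mem_bot F, ← h4]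
  exact ⟨⟨⟨hv, hxv⟩, hyv⟩, hzv⟩

/-- Every four-dimensional subalgebra has one of the four types. -/
theorem exists_mem_imagSubalgs {W : Submodule F O} (hW : IsImagSubalgebra t W) :
    ∃ Y, W ∈ imagSubalgs t Y := by
  haveI := h.moduleFinite
  have h2 := h.two
  by_cases h1 : ∀ x ∈ W, x * x = 0
  · refine ⟨.F1J3, hW, le_antisymm (fun x hx => hx.1) fun x hx => ⟨hx, fun y hy => ?_⟩⟩
    exact h.trace_mul_eq_zero hW.1 h1 hx hy
  push Not at h1
  obtain ⟨x, hx, hxx⟩ := h1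
  have htx := h.mem_imag.1 (hW.1 hx)
  have hxx' : t (x * x) ≠ 0 := fun e => hxx ((h.mul_self_eq_zero htx).2 e)
  -- If the orthogonal complement of `x` in `W` is totally isotropic, it lies in the radical and the
  -- form has rank one.
  by_cases h3 : ∀ y ∈ W, t (x * y) = 0 → y * y = 0
  · have hx1 : IsRankOne t x (t (x * x) / 2) W := by
      refine ⟨hx, h.mul_self htx, div_ne_zero hxx' h2, fun y hy hxy => ⟨hy, fun z hz => ?_⟩⟩
      set z' := z - (t (x * z) / t (x * x)) • x with hz'
      have hz'W : z' ∈ W := W.sub_mem hz (W.smul_mem _ hx)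
      have hxz' : t (x * z') = 0 := by
        rw [hz', mul_sub, mul_smul_comm, map_sub, map_smul, smul_eq_mul, div_mul_cancel₀ _ hxx',
          sub_self]
      have e := h.trace_mul_eq_zero (W := W ⊓ orth t x) (inf_le_left.trans hW.1)
        (fun u hu => h3 u hu.1 hu.2) ⟨hy, hxy⟩ ⟨hz'W, hxz'⟩
      rw [hz', mul_sub, mul_smul_comm, map_sub, map_smul, h.comm y x, hxy, smul_zero,
        sub_zero] at e
      exact e
    by_cases hs : IsSquare (t (x * x) / 2)
    · obtain ⟨s, hs⟩ := hs
      have hs0 : s ≠ 0 := by rintro rfl; exact hx1.2.2.1 (by rw [hs, mul_zero])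
      have := IsRankOne.smul h hW hx1 (inv_ne_zero hs0)
      rw [hs, show s⁻¹ * s⁻¹ * (s * s) = 1 by field_simp] at this
      exact ⟨.S2J2, hW, _, this⟩
    · exact ⟨.F2J2, hW, x, _, hx1, hs⟩
  · push Not at h3
    obtain ⟨y, hy, hxy, hyy⟩ := h3
    have hty := h.mem_imag.1 (hW.1 hy)
    have hyy' : t (y * y) ≠ 0 := fun e => hyy ((h.mul_self_eq_zero hty).2 e)
    -- The product `x * y` lies in `W`, is orthogonal to `x` and `y`, and is anisotropic. An
    -- orthogonal pair of anisotropic vectors thus already forces rank three.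
    have hz := hW.2.2 x hx y hy
    rw [hxy, zero_div, zero_smul, sub_zero] at hz
    have hyx := h.mul_eq_neg htx hty hxy
    refine ⟨.M4, hW, (Submodule.eq_bot_iff _).2 fun v hv => ?_⟩
    refine h.eq_zero_of_orthogonal hW.2.1 hx hy hz hxx' hyy' ?_ hxy ?_ ?_ hv.1
      (by rw [h.comm]; exact hv.2 x hx) (by rw [h.comm]; exact hv.2 y hy)
      (by rw [h.comm]; exact hv.2 _ hz)
    · obtain ⟨β, hβ0, hβ⟩ : ∃ β : F, β ≠ 0 ∧ y * y = β • 1 :=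
        ⟨_, div_ne_zero hyy' h2, h.mul_self hty⟩
      have e1 : y * (x * y) = -(β • x) := by
        rw [show x * y = -(y * x) by rw [hyx, neg_neg], mul_neg, h.left_alt, hβ, smul_mul_assoc,
          one_mul]
      rw [h.assoc, e1, mul_neg, mul_smul_comm, map_neg, map_smul, smul_eq_mul]
      exact neg_ne_zero.2 (mul_ne_zero hβ0 hxx')
    · rw [h.left_alt, h.mul_self htx, smul_mul_assoc, one_mul, map_smul, hty, smul_zero]
    · rw [← h.assoc, hyx, neg_mul, h.right_alt, h.mul_self hty, mul_smul_comm, mul_one, map_neg,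
        map_smul, htx, smul_zero, neg_zero]

section

variable {W : Submodule F O} (hW : IsImagSubalgebra t W) {w : O} {c : F} (hw : IsRankOne t w c W)
include hW hw

theorem IsRankOne.mul_eq_neg {r : O} (hr : r ∈ traceRad t W) : r * w = -(w * r) := by
  refine h.mul_eq_neg (h.mem_imag.1 (hW.1 hw.1)) (h.mem_imag.1 (hW.1 hr.1)) ?_
  rw [h.comm]
  exact hr.2 w hw.1

theorem IsRankOne.mul_eq_zero {r s : O} (hr : r ∈ traceRad t W) (hs : s ∈ traceRad t W) :
    r * s = 0 :=
  (h.isTypeZ_iff.1 (IsRankOne.isTypeZ h hW hw)).2 r hr s hs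

theorem IsRankOne.mul_self_add {r : O} (a : F) (hr : r ∈ traceRad t W) :
    (a • w + r) * (a • w + r) = (a * a * c) • 1 := by
  simp only [add_mul, mul_add, smul_mul_assoc, mul_smul_comm, hw.2.1,
    IsRankOne.mul_eq_neg h hW hw hr, IsRankOne.mul_eq_zero h hW hw hr hr]
  module

/-- The planes in the imaginary part of a subalgebra with two-dimensional radical. -/
theorem IsRankOne.plane_cases {U : Submodule F O} (hU : IsImagPlane U) (hUW : U ≤ W) :
    U = traceRad t W ∨ ∃ u ∈ U, ∃ v ∈ U, u ∈ traceRad t W ∧ IsTangent t u v ∧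
      ∃ (a : F) (r : O), a ≠ 0 ∧ r ∈ traceRad t W ∧ v = a • w + r := by
  haveI := h.moduleFinite
  by_cases hle : U ≤ traceRad t W
  · left
    exact Submodule.eq_of_le_of_finrank_eq hle
      (by rw [hU.2, IsRankOne.finrank_traceRad h hW hw])
  · right
    obtain ⟨v, hv, hvR⟩ := SetLike.not_le_iff_exists.1 hle
    obtain ⟨a, r, hr, rfl⟩ := IsRankOne.exists_eq h hW hw (hUW hv)
    have ha : a ≠ 0 := by
      rintro rfl
      rw [zero_smul, zero_add] at hvR
      exact hvR hr
    have h1 := finrank_le_inf_ker U (t ∘ₗ LinearMap.mulLeft F w)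
    rw [hU.2] at h1
    obtain ⟨u, ⟨hu, hwu⟩, hu0⟩ := exists_mem_ne_zero_of_finrank_pos
      (P := U ⊓ LinearMap.ker (t ∘ₗ LinearMap.mulLeft F w)) (by omega)
    have huR := hw.2.2.2 u (hUW hu) hwu
    refine ⟨u, hu, _, hv, huR, ⟨hu0, IsRankOne.mul_eq_zero h hW hw huR huR, ?_, ?_⟩,
      a, r, ha, hr, rfl⟩
    · rw [IsRankOne.mul_self_add h hW hw a hr, map_smul, h.trace_one]
      exact mul_ne_zero (mul_ne_zero (mul_ne_zero ha ha) hw.2.2.1) h.two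
    · exact huR.2 _ (hUW hv)

theorem IsRankOne.mul_tangent {u r : O} {a : F} (hu : u ∈ traceRad t W) (hr : r ∈ traceRad t W) :
    u * (a • w + r) = -(a • (w * u)) := by
  rw [mul_add, mul_smul_comm, IsRankOne.mul_eq_neg h hW hw hu, IsRankOne.mul_eq_zero h hW hw hu hr,
    smul_neg, add_zero]

theorem IsRankOne.mul_mul {u : O} : w * (w * u) = c • u := by
  rw [h.left_alt, hw.2.1, smul_mul_assoc, one_mul]

/-- Left multiplication by `w` has square `c`. A stable line of the radical is an eigenline, and the
square of its eigenvalue is `c`; hence type U cannot occur when `c` is a non-square. -/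
theorem IsRankOne.isSquare_of_stable {u r : O} {a e : F} (hu : u ∈ traceRad t W) (hu0 : u ≠ 0)
    (hr : r ∈ traceRad t W) (ha : a ≠ 0) (he : u * (a • w + r) = e • u) :
    w * u = (-(a⁻¹ * e)) • u ∧ (a⁻¹ * e) * (a⁻¹ * e) = c := by
  rw [IsRankOne.mul_tangent h hW hw hu hr] at he
  have h1 : w * u = (-(a⁻¹ * e)) • u := by
    apply smul_right_injective O ha
    simp only [smul_smul, mul_neg, mul_inv_cancel_left₀ ha]
    linear_combination (norm := module) -he
  refine ⟨h1, ?_⟩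
  have h3 := IsRankOne.mul_mul h hW hw (u := u)
  rw [h1, mul_smul_comm, h1, smul_smul] at h3
  have h4 : ((a⁻¹ * e) * (a⁻¹ * e) - c) • u = 0 := by
    linear_combination (norm := module) h3
  exact sub_eq_zero.1 ((smul_eq_zero.1 h4).resolve_right hu0)

end

variable [Finite F]

/-- The radical has dimension 0, 2, 2, 3 in the four types. F2J2 and S2J2 differ because every
square of an element of `W` is of the form `a² c`. -/
theorem imagSubalgs_unique {X Y : SubalgType} {W : Submodule F O} (hX : W ∈ imagSubalgs t X)
    (hY : W ∈ imagSubalgs t Y) : X = Y := by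
  haveI := h.moduleFinite
  have hM : W ∈ imagSubalgs t .M4 → Module.finrank F (traceRad t W) = 0 := fun h1 => by
    rw [h1.2, finrank_bot]
  have hF : W ∈ imagSubalgs t .F2J2 → Module.finrank F (traceRad t W) = 2 := by
    rintro ⟨hW, w, c, hw, -⟩; exact IsRankOne.finrank_traceRad h hW hw
  have hS : W ∈ imagSubalgs t .S2J2 → Module.finrank F (traceRad t W) = 2 := by
    rintro ⟨hW, w, hw⟩; exact IsRankOne.finrank_traceRad h hW hw
  have hF1 : W ∈ imagSubalgs t .F1J3 → Module.finrank F (traceRad t W) = 3 := fun h1 => by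
    rw [h1.2, h1.1.2.1]
  have hFS : W ∈ imagSubalgs t .F2J2 → W ∈ imagSubalgs t .S2J2 → False := by
    rintro ⟨hW, w, c, hw, hc⟩ ⟨-, v, hv⟩
    obtain ⟨a, r, hr, rfl⟩ := IsRankOne.exists_eq h hW hw hv.1
    have h1 := hv.2.1
    rw [IsRankOne.mul_self_add h hW hw a hr] at h1
    have h3 : a * a * c = 1 := by
      have : (a * a * c - 1) • (1 : O) = 0 := by rw [sub_smul, h1, sub_self]
      exact sub_eq_zero.1 (h.smul_one_inj this)
    have ha : a ≠ 0 := by rintro rfl; simp at h3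
    exact hc ⟨a⁻¹, by field_simp; linear_combination h3⟩
  cases X <;> cases Y <;>
    first
    | rfl
    | exact (hFS hX hY).elim
    | exact (hFS hY hX).elim
    | (exfalso
       first | have := hM hX | have := hF hX | have := hS hX | have := hF1 hX
       first | have := hM hY | have := hF hY | have := hS hY | have := hF1 hY
       omega)

/-! ### All planes -/

theorem ncard_planes_through {W : Submodule F O} (hWi : W ≤ imag F O)
    (hr : Module.finrank F W = 3) {x : O} (hx : x ∈ W) (hx0 : x ≠ 0) :
    ({U | IsImagPlane U ∧ U ≤ W ∧ x ∈ U}.ncard : ℚ) = Nat.card F + 1 := by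
  haveI := h.moduleFinite
  have hq := one_lt_natCard_cast (F := F)
  have hle : Submodule.span F {x} ≤ W := (Submodule.span_singleton_le_iff_mem _ _).2 hx
  have h1 := ncard_covers_cast (F := F) (finrank_span_singleton (K := F) hx0)
    (𝓗 := {U | IsImagPlane U ∧ U ≤ W ∧ x ∈ U}) (S := (W : Set O) \ (Submodule.span F {x} : Set O))
    (fun U hU => ⟨(Submodule.span_singleton_le_iff_mem _ _).2 hU.2.2, hU.1.2⟩)
    (fun y hy => ⟨hy.2, Submodule.span F {x} ⊔ Submodule.span F {y}, ⟨⟨?_, ?_⟩, ?_, ?_⟩, ?_⟩)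
    (fun U hU y hy hyx => ⟨hU.2.1 hy, hyx⟩)
  · rw [ncard_sdiff_submodule hle, finrank_span_singleton hx0, hr] at h1
    have h2 : (Nat.card F : ℚ) ^ 2 - Nat.card F ≠ 0 := by nlinarith
    apply mul_right_cancel₀ h2
    linear_combination h1
  · exact (sup_le hle ((Submodule.span_singleton_le_iff_mem _ _).2 hy.1)).trans hWi
  · rw [finrank_sup_span hy.2, finrank_span_singleton hx0]
  · exact sup_le hle ((Submodule.span_singleton_le_iff_mem _ _).2 hy.1)
  · exact (le_sup_left : Submodule.span F {x} ≤ _) (Submodule.mem_span_singleton_self x)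
  · exact (le_sup_right : Submodule.span F {y} ≤ _) (Submodule.mem_span_singleton_self y)

theorem ncard_planes {W : Submodule F O} (hWi : W ≤ imag F O) (hr : Module.finrank F W = 3) :
    ({U | IsImagPlane U ∧ U ≤ W}.ncard : ℚ) = (Nat.card F : ℚ) ^ 2 + Nat.card F + 1 := by
  haveI := h.moduleFinite
  haveI : Finite O := finite_of_moduleFinite (F := F)
  haveI : Finite (Submodule F O) := finite_submodule
  have hq := one_lt_natCard_cast (F := F)
  have h1 := ncard_mul_eq_ncard_mul_cast (A := {U | IsImagPlane U ∧ U ≤ W})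
    (B := (W : Set O) \ {0}) (fun U x => x ∈ U) (m := (Nat.card F : ℚ) ^ 2 - 1)
    (n := Nat.card F + 1) (fun U hU => ?_) (fun x hx => ?_)
  · rw [ncard_sdiff_zero, hr] at h1
    have h2 : (Nat.card F : ℚ) ^ 2 - 1 ≠ 0 := by nlinarith
    apply mul_right_cancel₀ h2
    linear_combination h1
  · rw [← hU.1.2, ← ncard_sdiff_zero]
    congr 2
    ext x
    exact ⟨fun hx => ⟨hx.2, hx.1.2⟩, fun hx => ⟨⟨hU.2 hx.1, hx.2⟩, hx.1⟩⟩
  · rw [← h.ncard_planes_through hWi hr hx.1 hx.2]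
    congr 2
    ext U
    exact and_assoc

/-- The identity that determines the last type in each column. -/
theorem ncard_planes_types {W : Submodule F O} (hWi : W ≤ imag F O)
    (hr : Module.finrank F W = 3) :
    ({U ∈ planes F O .Q | U ≤ W}.ncard : ℚ) + ({U ∈ planes F O .U | U ≤ W}.ncard +
        ({U ∈ planes F O .Dn | U ≤ W}.ncard + ({U ∈ planes F O .Ds | U ≤ W}.ncard +
          ({U ∈ planes F O .M | U ≤ W}.ncard + ({U ∈ planes F O .J | U ≤ W}.ncard +
            {U ∈ planes F O .Z | U ≤ W}.ncard))))) =
      (Nat.card F : ℚ) ^ 2 + Nat.card F + 1 := by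
  rw [← h.ncard_planes hWi hr, h.ncard_planes_sum]
  push_cast
  rfl

-- Write `uv = a u + b v`. Then `t((uv)v)` equals `b t(v²)`, and it vanishes because `(uv)v = u v²`
-- is a multiple of `u`; so `b = 0`.
omit [Finite F] in
theorem IsTangent.exists_mul_eq {U : Submodule F O} (hU : IsImagPlane U) {u v : O} (hu : u ∈ U)
    (hv : v ∈ U) (huv : IsTangent t u v) (hm : u * v ∈ U) : ∃ c : F, u * v = c • u := by
  haveI := h.moduleFinite
  obtain ⟨a, b, hab⟩ := exists_mem_span_pair hU.2 hu hv huv.1 huv.ne_smul hm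
  have h3 : t ((u * v) * v) = 0 := by
    rw [h.right_alt, h.mul_self (h.trace_eq_zero hU hv), mul_smul_comm, mul_one, map_smul,
      h.trace_eq_zero hU hu, smul_zero]
  rw [hab, add_mul, smul_mul_assoc, smul_mul_assoc, map_add, map_smul, map_smul, huv.2.2.2,
    smul_zero, zero_add] at h3
  have hb := (smul_eq_zero.1 h3).resolve_right huv.2.2.1
  exact ⟨a, by rw [hab, hb, zero_smul, add_zero]⟩

/-- The types of planes that occur in the imaginary part of a subalgebra. -/
theorem type_cases {Y : SubalgType} {W : Submodule F O} (hY : W ∈ imagSubalgs t Y) {X : PlaneType}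
    {U : Submodule F O} (hX : U ∈ planes F O X) (hUW : U ≤ W) :
    match Y with
    | .M4 => X = .Q ∨ X = .U ∨ X = .M
    | .F2J2 => X = .Dn ∨ X = .Z
    | .S2J2 => X = .U ∨ X = .Ds ∨ X = .Z
    | .F1J3 => X = .J ∨ X = .Z := by
  haveI := h.moduleFinite
  have hU := h.isImagPlane_of_mem_planes hX
  cases Y
  · obtain ⟨hW, hrad⟩ := hY
    -- In a nondegenerate `W` a tangent plane at `u` is all of `W ∩ u^⊥`. It contains `uv`, since
    -- `u(uv) = 0`, so the nilpotent line is stable.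
    have hD : ¬ IsTypeD U := by
      intro hD
      obtain ⟨-, u, hu, v, hv, huv, hs⟩ := h.isTypeD_iff.1 hD
      obtain ⟨x, hx, hux⟩ : ∃ x ∈ W, t (u * x) ≠ 0 := by
        by_contra! hc
        have : u ∈ traceRad t W := ⟨hUW hu, hc⟩
        rw [hrad, Submodule.mem_bot] at this
        exact huv.1 this
      have h1 := finrank_inf_ker (f := t ∘ₗ LinearMap.mulLeft F u) hx hux
      rw [hW.2.1] at h1
      have huU : U = W ⊓ LinearMap.ker (t ∘ₗ LinearMap.mulLeft F u) := by
        apply Submodule.eq_of_le_of_finrank_eq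
        · intro y hy
          refine ⟨hUW hy, ?_⟩
          obtain ⟨a, b, rfl⟩ := exists_mem_span_pair hU.2 hu hv huv.1 huv.ne_smul hy
          change t (u * (a • u + b • v)) = 0
          rw [mul_add, mul_smul_comm, mul_smul_comm, huv.2.1, map_add, map_smul, map_smul,
            huv.2.2.2]
          simp
        · rw [hU.2]; omega
      have huvU : u * v ∈ U := by
        have h3 := hW.2.2 u (hUW hu) v (hUW hv)
        rw [huv.2.2.2, zero_div, zero_smul, sub_zero] at h3
        rw [huU]
        refine ⟨h3, ?_⟩
        change t (u * (u * v)) = 0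
        rw [h.left_alt, huv.2.1, zero_mul, map_zero]
      obtain ⟨a, ha⟩ := IsTangent.exists_mul_eq h hU hu hv huv huvU
      exact hs a ha
    obtain ⟨x, hx, hxx⟩ := h.exists_mul_self_ne_zero hW.1 hW.2.1 hrad hUW hU.2.ge
    cases X
    · simp
    · simp
    · exact (hD hX.1).elim
    · exact (hD hX.1).elim
    · simp
    · exact (hxx ((h.isTypeJ_iff.1 hX).2.1 x hx)).elim
    · exact (hxx ((h.isTypeZ_iff.1 hX).2 x hx x hx)).elim
  · obtain ⟨hW, w, c, hw, hc⟩ := hY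
    rcases IsRankOne.plane_cases h hW hw hU hUW with
      rfl | ⟨u, hu, v, hv, huR, huv, a, r, ha, hr, rfl⟩
    · right
      exact h.planes_unique hX (Y := .Z) (IsRankOne.isTypeZ h hW hw)
    · left
      refine h.planes_unique hX (Y := .Dn) (h.isTypeDn_iff.2 ⟨hU, u, hu, _, hv, huv, ?_, _,
        IsRankOne.mul_self_add h hW hw a hr, ?_⟩)
      · intro e he
        exact hc ⟨_, (IsRankOne.isSquare_of_stable h hW hw huR huv.1 hr ha he).2.symm⟩
      · rintro ⟨s, hs⟩
        exact hc ⟨s / a, by field_simp; linear_combination hs⟩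
  · obtain ⟨hW, w, hw⟩ := hY
    rcases IsRankOne.plane_cases h hW hw hU hUW with
      rfl | ⟨u, hu, v, hv, huR, huv, a, r, ha, hr, rfl⟩
    · right; right
      exact h.planes_unique hX (Y := .Z) (IsRankOne.isTypeZ h hW hw)
    · by_cases hs : ∃ e : F, u * (a • w + r) = e • u
      · left
        exact h.planes_unique hX (Y := .U) (h.isTypeU_iff.2 ⟨hU, u, hu, _, hv, huv, hs⟩)
      · right; left
        push Not at hs
        exact h.planes_unique hX (Y := .Ds) (h.isTypeDs_iff.2 ⟨hU, u, hu, _, hv, huv, hs, _,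
          IsRankOne.mul_self_add h hW hw a hr, a, by ring⟩)
  · obtain ⟨hW, hrad⟩ := hY
    have hiso : ∀ x ∈ U, x * x = 0 := fun x hx => by
      have hx' : x ∈ traceRad t W := hrad.ge (hUW hx)
      rw [h.mul_self_eq_zero (h.trace_eq_zero hU hx)]
      exact hx'.2 x hx'.1
    by_cases hz : ∀ x ∈ U, ∀ y ∈ U, x * y = 0
    · right
      exact h.planes_unique hX (Y := .Z) (h.isTypeZ_iff.2 ⟨hU, hz⟩)
    · left
      push Not at hz
      exact h.planes_unique hX (Y := .J) (h.isTypeJ_iff.2 ⟨hU, hiso, hz⟩)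

theorem ncard_imagSubalgs_sum (P : Submodule F O → Prop) :
    {W | IsImagSubalgebra t W ∧ P W}.ncard =
      {W ∈ imagSubalgs t .M4 | P W}.ncard + ({W ∈ imagSubalgs t .F2J2 | P W}.ncard +
        ({W ∈ imagSubalgs t .S2J2 | P W}.ncard + {W ∈ imagSubalgs t .F1J3 | P W}.ncard)) := by
  haveI := h.moduleFinite
  haveI : Finite O := finite_of_moduleFinite (F := F)
  haveI : Finite (Submodule F O) := finite_submodule
  have hdis : ∀ X Y, X ≠ Y → Disjoint {W ∈ imagSubalgs t X | P W} {W ∈ imagSubalgs t Y | P W} :=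
    fun X Y hXY => Set.disjoint_left.2 fun U h1 h2 => hXY (h.imagSubalgs_unique h1.1 h2.1)
  have e : {W | IsImagSubalgebra t W ∧ P W} = {W ∈ imagSubalgs t .M4 | P W} ∪
      ({W ∈ imagSubalgs t .F2J2 | P W} ∪ ({W ∈ imagSubalgs t .S2J2 | P W} ∪
        {W ∈ imagSubalgs t .F1J3 | P W})) := by
    ext W
    constructor
    · rintro ⟨hW, hP⟩
      obtain ⟨X, hX⟩ := h.exists_mem_imagSubalgs hW
      cases X <;> simp [hX, hP]
    · rintro (h1 | h1 | h1 | h1) <;> exact ⟨h1.1.1, h1.2⟩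
  rw [e]
  iterate 3
    rw [Set.ncard_union_eq (by
      simp [Set.disjoint_union_right, hdis])]

theorem ncard_eq_zero_of_not_mem {X : PlaneType} {W : Submodule F O}
    (hX : ∀ U ∈ planes F O X, ¬ U ≤ W) : {U ∈ planes F O X | U ≤ W}.ncard = 0 := by
  have : {U ∈ planes F O X | U ≤ W} = ∅ := by
    rw [Set.eq_empty_iff_forall_notMem]
    exact fun U hU => hX U hU.1 hU.2
  rw [this, Set.ncard_empty]

end IsCayleyTrace

end PlanesInSubalgebras

/-! ### The numbers of planes of each type in a subalgebra. -/

section PlaneCounts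

variable [SMulCommClass F O O] [IsScalarTower F O O] {t : O →ₗ[F] F}

theorem ncard_span_sdiff_zero [Finite F] {V : Type*} [AddCommGroup V] [Module F V]
    [Module.Finite F V] {u : V} (hu : u ≠ 0) :
    (((Submodule.span F {u} : Submodule F V) : Set V) \ {0}).ncard = Nat.card F - (1 : ℚ) := by
  rw [ncard_sdiff_zero, finrank_span_singleton hu, pow_one]

namespace IsCayleyTrace

variable (h : IsCayleyTrace F t)
include h

/-- `W` contains the imaginary part of `d * x` along with `x`; these give the sum and the difference
of the two Peirce components. -/
theorem range_peirceMap_inf {W : Submodule F O} (hW : IsImagSubalgebra t W) {d : O} (hd : d ∈ W)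
    (hdd : d * d = 1) :
    LinearMap.range (peirceMap d (W ⊓ peirce t d) (W ⊓ peirce t (-d))) = W := by
  have h2 := h.two
  ext x
  rw [mem_range_peirceMap]
  constructor
  · rintro ⟨c, a, b, ha, hb, rfl⟩
    exact W.add_mem (W.add_mem (W.smul_mem c hd) ha.1) hb.1
  · intro hx
    obtain ⟨a, b, ha, hb, he, he'⟩ := h.exists_peirce (h.mem_imag.1 (hW.1 hd)) hdd
      (h.mem_imag.1 (hW.1 hx))
    have h1 : a - b ∈ W := by
      have := hW.2.2 d hd x hx
      rwa [he', map_add, map_sub, ha.1, hb.1, map_smul, h.trace_one, sub_zero, add_zero,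
        smul_eq_mul, mul_div_assoc, div_self h2, mul_one, add_sub_cancel_left] at this
    have h3 : a + b ∈ W := by
      have := W.sub_mem hx (W.smul_mem (t (d * x) / 2) hd)
      nth_rw 1 [he] at this
      rwa [add_assoc, add_sub_cancel_left] at this
    refine ⟨_, a, b, ⟨?_, ha⟩, ⟨?_, hb⟩, he⟩
    · refine (Submodule.smul_mem_iff W h2).1 ?_
      convert! W.add_mem h3 h1 using 1
      module
    · refine (Submodule.smul_mem_iff W h2).1 ?_
      convert! W.sub_mem h3 h1 using 1
      module

theorem finrank_inf_peirce {W : Submodule F O} (hW : IsImagSubalgebra t W) {d : O} (hd : d ∈ W)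
    (hdd : d * d = 1) : Module.finrank F (W ⊓ peirce t d : Submodule F O) +
      Module.finrank F (W ⊓ peirce t (-d) : Submodule F O) = 2 := by
  have := h.finrank_range_peirceMap (h.mem_imag.1 (hW.1 hd)) hdd
    (inf_le_right : W ⊓ peirce t d ≤ _) (inf_le_right : W ⊓ peirce t (-d) ≤ _)
  rw [h.range_peirceMap_inf hW hd hdd, hW.2.1] at this
  omega

section

variable [Finite F]

/-- A nondegenerate `W` contains square roots of one. -/
theorem exists_mul_self_eq_one {W : Submodule F O} (hW : IsImagSubalgebra t W)
    (hrad : traceRad t W = ⊥) : ∃ d ∈ W, d * d = 1 := by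
  haveI := h.moduleFinite
  haveI := Fintype.ofFinite F
  have h2 := h.two
  obtain ⟨x, hx, hxx⟩ := h.exists_mul_self_ne_zero hW.1 hW.2.1 hrad le_rfl
    (by rw [hW.2.1]; norm_num)
  have h1 := finrank_le_inf_ker W (t ∘ₗ LinearMap.mulLeft F x)
  obtain ⟨y, ⟨hy, hxy⟩, hyy⟩ := h.exists_mul_self_ne_zero hW.1 hW.2.1 hrad
    (S := W ⊓ LinearMap.ker (t ∘ₗ LinearMap.mulLeft F x)) inf_le_left
    (by have := hW.2.1; omega)
  have htx := h.mem_imag.1 (hW.1 hx)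
  have hty := h.mem_imag.1 (hW.1 hy)
  have hyx := h.mul_eq_neg htx hty hxy
  obtain ⟨α, hα⟩ : ∃ α : F, x * x = α • 1 := ⟨_, h.mul_self htx⟩
  obtain ⟨β, hβ⟩ : ∃ β : F, y * y = β • 1 := ⟨_, h.mul_self hty⟩
  have hα0 : α ≠ 0 := by rintro rfl; rw [zero_smul] at hα; exact hxx hα
  have hβ0 : β ≠ 0 := by rintro rfl; rw [zero_smul] at hβ; exact hyy hβ
  -- Over a finite field of odd order `α a² + β b² = 1` is solvable. By orthogonality the left side
  -- is the square of `a x + b y`.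
  obtain ⟨a, b, hab⟩ := FiniteField.exists_root_sum_quadratic
    (f := Polynomial.C α * Polynomial.X ^ 2 - Polynomial.C 1)
    (g := Polynomial.C β * Polynomial.X ^ 2)
    (by compute_degree!) (by compute_degree!)
    (FiniteField.odd_card_of_char_ne_two fun hc => h2 (by
      have := CharP.cast_eq_zero F (ringChar F)
      rwa [hc, Nat.cast_two] at this))
  simp at hab
  refine ⟨a • x + b • y, W.add_mem (W.smul_mem a hx) (W.smul_mem b hy), ?_⟩
  simp only [add_mul, mul_add, smul_mul_assoc, mul_smul_comm, hα, hβ, hyx]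
  have : (1 : O) = (α * a ^ 2 + β * b ^ 2) • 1 := by
    rw [show α * a ^ 2 + β * b ^ 2 = 1 by linear_combination hab, one_smul]
  conv_rhs => rw [this]
  module

theorem mem_span_of_isotropic {U : Submodule F O} (hU : IsImagPlane U) {u v x : O} (hu : u ∈ U)
    (hv : v ∈ U) (huu : u * u = 0) (hvv : v * v = 0) (huv : t (u * v) ≠ 0) (hx : x ∈ U)
    (hx0 : x ≠ 0) (hxx : x * x = 0) :
    x ∈ Submodule.span F {u} ∨ x ∈ Submodule.span F {v} := by
  have h1 : Submodule.span F {x} ∈ nilpotentLines U :=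
    (h.mem_nilpotentLines hU).2 ⟨x, hx, hx0, hxx, rfl⟩
  rw [h.nilpotentLines_eq_pair hU hu hv huu hvv huv] at h1
  rcases h1 with h1 | h1
  · exact Or.inl (h1 ▸ Submodule.mem_span_singleton_self x)
  · exact Or.inr (h1 ▸ Submodule.mem_span_singleton_self x)

omit [Finite F] in
theorem mul_self_of_mem_span {u x : O} (huu : u * u = 0) (hx : x ∈ Submodule.span F {u}) :
    x * x = 0 := by
  obtain ⟨c, rfl⟩ := Submodule.mem_span_singleton.1 hx
  rw [smul_mul_assoc, mul_smul_comm, huu, smul_zero, smul_zero]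

end

section Nondegenerate

variable [Finite F] {W : Submodule F O} (hW : IsImagSubalgebra t W) (hrad : traceRad t W = ⊥)
include hW hrad

/-- The two eigenspaces inside `W` have total dimension 2, so `ncard_isotropic` gives `q²` isotropic
vectors: a conic with `q + 1` points. -/
theorem ncard_isotropic_of_nondegenerate :
    ({x | x ∈ W ∧ x ≠ 0 ∧ x * x = 0}.ncard : ℚ) = (Nat.card F : ℚ) ^ 2 - 1 := by
  haveI := h.moduleFinite
  haveI : Finite O := finite_of_moduleFinite (F := F)
  obtain ⟨d, hd, hdd⟩ := h.exists_mul_self_eq_one hW hrad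
  have h1 := h.ncard_isotropic (h.mem_imag.1 (hW.1 hd)) hdd
    (inf_le_right : W ⊓ peirce t d ≤ _) (inf_le_right : W ⊓ peirce t (-d) ≤ _)
  rw [h.range_peirceMap_inf hW hd hdd, h.finrank_inf_peirce hW hd hdd] at h1
  have h2 : {x | x ∈ W ∧ x ≠ 0 ∧ x * x = 0} = {x | x ∈ W ∧ x * x = 0} \ {0} := by
    ext x
    exact ⟨fun hx => ⟨⟨hx.1, hx.2.2⟩, hx.2.1⟩, fun hx => ⟨hx.1.1, hx.2, hx.1.2⟩⟩
  have h3 := Set.ncard_sdiff_singleton_add_one (s := {x | x ∈ W ∧ x * x = 0}) (a := (0 : O))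
    ⟨W.zero_mem, by simp⟩
  rw [← h2, h1] at h3
  have h4 : (({x | x ∈ W ∧ x ≠ 0 ∧ x * x = 0}.ncard + 1 : ℕ) : ℚ) = ((Nat.card F ^ 2 : ℕ) : ℚ) := by
    rw [h3]
  push_cast at h4
  linear_combination h4

theorem finrank_inf_orth {x : O} (hx : x ∈ W) (hx0 : x ≠ 0) :
    Module.finrank F (W ⊓ orth t x : Submodule F O) = 2 := by
  haveI := h.moduleFinite
  obtain ⟨y, hy, hxy⟩ : ∃ y ∈ W, t (x * y) ≠ 0 := by
    by_contra! hc
    have : x ∈ traceRad t W := ⟨hx, hc⟩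
    rw [hrad, Submodule.mem_bot] at this
    exact hx0 this
  have h1 := finrank_inf_ker (f := t ∘ₗ LinearMap.mulLeft F x) hy hxy
  rw [hW.2.1] at h1
  exact Nat.succ.inj h1

/-- `W ∩ x^⊥` is the tangent to the conic at the point `x`; the remaining planes through `x` are
secants. -/
theorem isTypeU_iff_of_nondegenerate {U : Submodule F O} (hU : IsImagPlane U) (hUW : U ≤ W) {x : O}
    (hx : x ∈ U) (hx0 : x ≠ 0) (hxx : x * x = 0) : IsTypeU U ↔ U = W ⊓ orth t x := by
  haveI := h.moduleFinite
  have hr := h.finrank_inf_orth hW hrad (hUW hx) hx0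
  constructor
  · intro hT
    obtain ⟨-, u, hu, v, hv, huv, -⟩ := h.isTypeU_iff.1 hT
    obtain ⟨c, rfl⟩ := IsTangent.mul_self_eq_zero h hU hu hv huv hx hxx
    refine Submodule.eq_of_le_of_finrank_eq (le_inf hUW fun y hy => ?_) (by rw [hU.2, hr])
    obtain ⟨a, b, rfl⟩ := exists_mem_span_pair hU.2 hu hv huv.1 huv.ne_smul hy
    rw [mem_orth]
    simp [mul_add, smul_mul_assoc, mul_smul_comm, huv.2.1, huv.2.2.2]
  · intro he
    obtain ⟨X, hX⟩ := h.exists_mem_planes hU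
    rcases h.type_cases (Y := .M4) ⟨hW, hrad⟩ hX hUW with rfl | rfl | rfl
    · exact (hx0 ((h.isTypeQ_iff.1 hX).2 x hx hxx)).elim
    · exact hX
    · exfalso
      obtain ⟨-, u, hu, v, hv, huu, hvv, huv⟩ := h.isTypeM_iff.1 hX
      have hux : ∀ y ∈ U, t (x * y) = 0 := fun y hy => by
        rw [he] at hy; exact hy.2
      rcases h.mem_span_of_isotropic hU hu hv huu hvv huv hx hx0 hxx with hm | hm
      · obtain ⟨c, rfl⟩ := Submodule.mem_span_singleton.1 hm
        have hc : c ≠ 0 := by rintro rfl; simp at hx0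
        have := hux v hv
        rw [smul_mul_assoc, map_smul, smul_eq_mul] at this
        exact huv ((mul_eq_zero.1 this).resolve_left hc)
      · obtain ⟨c, rfl⟩ := Submodule.mem_span_singleton.1 hm
        have hc : c ≠ 0 := by rintro rfl; simp at hx0
        have := hux u hu
        rw [smul_mul_assoc, map_smul, smul_eq_mul, h.comm] at this
        exact huv ((mul_eq_zero.1 this).resolve_left hc)

theorem isTypeM_or_eq_of_nondegenerate {U : Submodule F O} (hU : IsImagPlane U) (hUW : U ≤ W)
    {x : O} (hx : x ∈ U) (hx0 : x ≠ 0) (hxx : x * x = 0) : IsTypeM U ↔ U ≠ W ⊓ orth t x := by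
  rw [← not_iff_not, not_not, ← h.isTypeU_iff_of_nondegenerate hW hrad hU hUW hx hx0 hxx]
  obtain ⟨X, hX⟩ := h.exists_mem_planes hU
  constructor
  · intro hM
    rcases h.type_cases (Y := .M4) ⟨hW, hrad⟩ hX hUW with rfl | rfl | rfl
    · exact (hx0 ((h.isTypeQ_iff.1 hX).2 x hx hxx)).elim
    · exact hX
    · exact (hM hX).elim
  · intro hT hM
    have := h.planes_unique (X := .U) (Y := .M) hT hM
    simp at this

theorem ncard_typeU_of_nondegenerate :
    ({U ∈ planes F O .U | U ≤ W}.ncard : ℚ) = Nat.card F + 1 := by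
  haveI := h.moduleFinite
  haveI : Finite O := finite_of_moduleFinite (F := F)
  haveI : Finite (Submodule F O) := finite_submodule
  have hq := one_lt_natCard_cast (F := F)
  have h1 := ncard_mul_eq_ncard_mul_cast (A := {U ∈ planes F O .U | U ≤ W})
    (B := {x | x ∈ W ∧ x ≠ 0 ∧ x * x = 0}) (fun U x => x ∈ U) (m := (Nat.card F : ℚ) - 1)
    (n := 1) (fun U hU => ?_) (fun x hx => ?_)
  · rw [h.ncard_isotropic_of_nondegenerate hW hrad] at h1
    have h2 : (Nat.card F : ℚ) - 1 ≠ 0 := by linarith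
    apply mul_right_cancel₀ h2
    linear_combination h1
  · obtain ⟨hP, u, hu, v, hv, huv, -⟩ := h.isTypeU_iff.1 hU.1
    rw [← ncard_span_sdiff_zero huv.1]
    congr 2
    ext x
    constructor
    · rintro ⟨⟨-, hx0, hxx⟩, hx⟩
      obtain ⟨c, hc⟩ := IsTangent.mul_self_eq_zero h hP hu hv huv hx hxx
      exact ⟨Submodule.mem_span_singleton.2 ⟨c, hc.symm⟩, hx0⟩
    · rintro ⟨hx, hx0⟩
      have hxU : x ∈ U := (Submodule.span_singleton_le_iff_mem _ _).2 hu hx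
      exact ⟨⟨hU.2 hxU, hx0, h.mul_self_of_mem_span huv.2.1 hx⟩, hxU⟩
  · have hP : IsImagPlane (W ⊓ orth t x) :=
      ⟨inf_le_left.trans hW.1, h.finrank_inf_orth hW hrad hx.1 hx.2.1⟩
    have hxP : x ∈ W ⊓ orth t x := ⟨hx.1, by rw [SetLike.mem_coe, mem_orth, hx.2.2, map_zero]⟩
    rw [Nat.cast_eq_one]
    refine ncard_eq_one_of_existsUnique ⟨W ⊓ orth t x, ⟨⟨?_, inf_le_left⟩, hxP⟩, fun U hU => ?_⟩
    · exact (h.isTypeU_iff_of_nondegenerate hW hrad hP inf_le_left hxP hx.2.1 hx.2.2).2 rfl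
    · exact (h.isTypeU_iff_of_nondegenerate hW hrad (h.isImagPlane_of_mem_planes hU.1.1) hU.1.2
        hU.2 hx.2.1 hx.2.2).1 hU.1.1

/-- Of the `q + 1` planes through an isotropic vector all but the tangent are secants, and a secant
contains `2(q - 1)` nonzero isotropic vectors. -/
theorem ncard_typeM_of_nondegenerate :
    ({U ∈ planes F O .M | U ≤ W}.ncard : ℚ) = ((Nat.card F : ℚ) ^ 2 + Nat.card F) / 2 := by
  haveI := h.moduleFinite
  haveI : Finite O := finite_of_moduleFinite (F := F)
  haveI : Finite (Submodule F O) := finite_submodule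
  have hq := one_lt_natCard_cast (F := F)
  have h1 := ncard_mul_eq_ncard_mul_cast (A := {U ∈ planes F O .M | U ≤ W})
    (B := {x | x ∈ W ∧ x ≠ 0 ∧ x * x = 0}) (fun U x => x ∈ U) (m := 2 * ((Nat.card F : ℚ) - 1))
    (n := Nat.card F) (fun U hU => ?_) (fun x hx => ?_)
  · rw [h.ncard_isotropic_of_nondegenerate hW hrad] at h1
    have h2 : 2 * ((Nat.card F : ℚ) - 1) ≠ 0 := by linarith
    apply mul_right_cancel₀ h2
    linear_combination h1
  · obtain ⟨hP, u, hu, v, hv, huu, hvv, huv⟩ := h.isTypeM_iff.1 hU.1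
    have hu0 : u ≠ 0 := by rintro rfl; simp at huv
    have hv0 : v ≠ 0 := by rintro rfl; simp at huv
    have e : {x ∈ {x | x ∈ W ∧ x ≠ 0 ∧ x * x = 0} | x ∈ U} =
        ((Submodule.span F {u} : Submodule F O) : Set O) \ {0} ∪
          ((Submodule.span F {v} : Submodule F O) : Set O) \ {0} := by
      ext x
      constructor
      · rintro ⟨⟨-, hx0, hxx⟩, hx⟩
        exact (h.mem_span_of_isotropic hP hu hv huu hvv huv hx hx0 hxx).imp
          (fun hm => ⟨hm, hx0⟩) (fun hm => ⟨hm, hx0⟩)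
      · rintro (⟨hx, hx0⟩ | ⟨hx, hx0⟩)
        · have hxU : x ∈ U := (Submodule.span_singleton_le_iff_mem _ _).2 hu hx
          exact ⟨⟨hU.2 hxU, hx0, h.mul_self_of_mem_span huu hx⟩, hxU⟩
        · have hxU : x ∈ U := (Submodule.span_singleton_le_iff_mem _ _).2 hv hx
          exact ⟨⟨hU.2 hxU, hx0, h.mul_self_of_mem_span hvv hx⟩, hxU⟩
    rw [e, Set.ncard_union_eq, Nat.cast_add, ncard_span_sdiff_zero hu0, ncard_span_sdiff_zero hv0]
    · ring
    · rw [Set.disjoint_left]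
      rintro x ⟨hx, hx0⟩ ⟨hx', -⟩
      obtain ⟨a, rfl⟩ := Submodule.mem_span_singleton.1 hx
      obtain ⟨b, hb⟩ := Submodule.mem_span_singleton.1 hx'
      have ha : a ≠ 0 := by rintro rfl; simp at hx0
      have h3 : u * (a • u) = 0 := by rw [mul_smul_comm, huu, smul_zero]
      rw [← hb, mul_smul_comm] at h3
      have hb0 := (smul_eq_zero.1 h3).resolve_right (fun e => huv (by rw [e, map_zero]))
      rw [hb0, zero_smul] at hb
      exact hx0 hb.symm
  · have hP : IsImagPlane (W ⊓ orth t x) :=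
      ⟨inf_le_left.trans hW.1, h.finrank_inf_orth hW hrad hx.1 hx.2.1⟩
    have hxP : x ∈ W ⊓ orth t x := ⟨hx.1, by rw [SetLike.mem_coe, mem_orth, hx.2.2, map_zero]⟩
    have e : {U ∈ {U ∈ planes F O .M | U ≤ W} | x ∈ U} =
        {U | IsImagPlane U ∧ U ≤ W ∧ x ∈ U} \ {W ⊓ orth t x} := by
      ext U
      constructor
      · rintro ⟨⟨hU, hUW⟩, hxU⟩
        have hU' := h.isImagPlane_of_mem_planes hU
        exact ⟨⟨hU', hUW, hxU⟩,
          (h.isTypeM_or_eq_of_nondegenerate hW hrad hU' hUW hxU hx.2.1 hx.2.2).1 hU⟩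
      · rintro ⟨⟨hU', hUW, hxU⟩, hne⟩
        exact ⟨⟨(h.isTypeM_or_eq_of_nondegenerate hW hrad hU' hUW hxU hx.2.1 hx.2.2).2 hne,
          hUW⟩, hxU⟩
    have h3 := Set.ncard_sdiff_singleton_add_one (s := {U | IsImagPlane U ∧ U ≤ W ∧ x ∈ U})
      (a := W ⊓ orth t x) ⟨hP, inf_le_left, hxP⟩
    have h4 := h.ncard_planes_through hW.1 hW.2.1 hx.1 hx.2.1
    rw [← h3, ← e] at h4
    push_cast at h4
    linear_combination h4

end Nondegenerate

section RankOneCounts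

variable [Finite F] {W : Submodule F O} (hW : IsImagSubalgebra t W) {w : O} {c : F}
  (hw : IsRankOne t w c W)
include hW hw

theorem IsRankOne.ncard_typeZ : {U ∈ planes F O .Z | U ≤ W}.ncard = 1 := by
  refine ncard_eq_one_of_existsUnique ⟨traceRad t W,
    ⟨IsRankOne.isTypeZ h hW hw, fun x hx => hx.1⟩, ?_⟩
  rintro U ⟨hU, hUW⟩
  rcases IsRankOne.plane_cases h hW hw (h.isImagPlane_of_mem_planes hU) hUW with
    rfl | ⟨u, hu, v, hv, -, huv, -⟩
  · rfl
  · exfalso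
    apply huv.2.2.1
    rw [(h.isTypeZ_iff.1 hU).2 v hv v hv, map_zero]

end RankOneCounts

section Split

variable [Finite F] {W : Submodule F O} (hW : IsImagSubalgebra t W) {d : O}
  (hd : IsRankOne t d 1 W)
include hW hd

omit [Finite F] in
theorem inf_peirce_le_traceRad : W ⊓ peirce t d ≤ traceRad t W := fun x hx =>
  hd.2.2.2 x hx.1 (by rw [hx.2.2, hx.2.1])

omit [Finite F] in
theorem inf_peirce_neg_le_traceRad : W ⊓ peirce t (-d) ≤ traceRad t W := fun x hx =>
  hd.2.2.2 x hx.1 (by rw [(mem_peirce_neg.1 hx.2).2, map_neg, hx.2.1, neg_zero])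

-- Both eigenspaces lie in the radical, where products vanish. Since the product on a Peirce
-- component is nondegenerate, each has dimension at most one, and the dimensions add up to 2.
omit [Finite F] in
theorem finrank_split : Module.finrank F (W ⊓ peirce t d : Submodule F O) = 1 ∧
    Module.finrank F (W ⊓ peirce t (-d) : Submodule F O) = 1 := by
  haveI := h.moduleFinite
  have hdd : d * d = 1 := by rw [hd.2.1, one_smul]
  have htd := h.mem_imag.1 (hW.1 hd.1)
  have h1 := h.finrank_inf_peirce hW hd.1 hdd
  have key : ∀ e : O, t e = 0 → e * e = 1 → W ⊓ peirce t e ≤ traceRad t W →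
      Module.finrank F (W ⊓ peirce t e : Submodule F O) ≤ 1 := by
    intro e he hee hle
    by_contra! hc
    obtain ⟨x, hx, hx0⟩ := exists_mem_ne_zero_of_finrank_pos (P := W ⊓ peirce t e) (by omega)
    obtain ⟨y, hy, hne⟩ := exists_not_smul (P := W ⊓ peirce t e) hc x
    obtain ⟨a, ha⟩ := h.mem_span_of_peirce_mul_eq_zero he hee hx.2 hx0 hy.2
      (IsRankOne.mul_eq_zero h hW hd (hle hx) (hle hy))
    exact hne a ha
  have h2 := key d htd hdd (h.inf_peirce_le_traceRad hW hd)
  have h3 := key (-d) (by simp [htd]) (by simp [hdd]) (h.inf_peirce_neg_le_traceRad hW hd)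
  omega

/-- The stable lines of a split subalgebra. -/
theorem ncard_stable :
    ({x | x ≠ 0 ∧ (x ∈ W ⊓ peirce t d ∨ x ∈ W ⊓ peirce t (-d))}.ncard : ℚ) =
      2 * (Nat.card F - 1) := by
  haveI := h.moduleFinite
  haveI : Finite O := finite_of_moduleFinite (F := F)
  obtain ⟨h1, h3⟩ := h.finrank_split hW hd
  have e : {x | x ≠ 0 ∧ (x ∈ W ⊓ peirce t d ∨ x ∈ W ⊓ peirce t (-d))} =
      ((W ⊓ peirce t d : Submodule F O) : Set O) \ {0} ∪
        ((W ⊓ peirce t (-d) : Submodule F O) : Set O) \ {0} := by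
    ext x
    constructor
    · rintro ⟨hx0, hx | hx⟩
      · exact Or.inl ⟨hx, hx0⟩
      · exact Or.inr ⟨hx, hx0⟩
    · rintro (⟨hx, hx0⟩ | ⟨hx, hx0⟩)
      · exact ⟨hx0, Or.inl hx⟩
      · exact ⟨hx0, Or.inr hx⟩
  rw [e, Set.ncard_union_eq, Nat.cast_add, ncard_sdiff_zero, ncard_sdiff_zero, h1, h3]
  · ring
  · rw [Set.disjoint_left]
    rintro x ⟨hx, hx0⟩ ⟨hx', -⟩
    exact hx0 (h.disjoint_peirce (h.mem_imag.1 (hW.1 hd.1)) hx.2 hx'.2)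

/-- The planes of type U are those other than the radical that contain one of the two eigenlines of
`d`. Each eigenline lies in `q` of them. -/
theorem ncard_typeU_of_split :
    ({U ∈ planes F O .U | U ≤ W}.ncard : ℚ) = 2 * Nat.card F := by
  haveI := h.moduleFinite
  haveI : Finite O := finite_of_moduleFinite (F := F)
  haveI : Finite (Submodule F O) := finite_submodule
  have hq := one_lt_natCard_cast (F := F)
  have hZ := IsRankOne.isTypeZ h hW hd
  have h1 := ncard_mul_eq_ncard_mul_cast (A := {U ∈ planes F O .U | U ≤ W})
    (B := {x | x ≠ 0 ∧ (x ∈ W ⊓ peirce t d ∨ x ∈ W ⊓ peirce t (-d))})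
    (fun U x => x ∈ U) (m := (Nat.card F : ℚ) - 1)
    (n := Nat.card F) (fun U hU => ?_) (fun x hx => ?_)
  · rw [h.ncard_stable hW hd] at h1
    have h2 : (Nat.card F : ℚ) - 1 ≠ 0 := by linarith
    apply mul_right_cancel₀ h2
    linear_combination h1
  · have hP := h.isImagPlane_of_mem_planes hU.1
    rcases IsRankOne.plane_cases h hW hd hP hU.2 with
      rfl | ⟨u, hu, v, hv, huR, huv, a, r, ha, hr, rfl⟩
    · have := h.planes_unique (X := .U) (Y := .Z) hU.1 hZ
      simp at this
    · rw [← ncard_span_sdiff_zero huv.1]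
      congr 2
      ext x
      constructor
      · rintro ⟨⟨hx0, hx⟩, hxU⟩
        have hxR : x ∈ traceRad t W := by
          rcases hx with hx | hx
          · exact h.inf_peirce_le_traceRad hW hd hx
          · exact h.inf_peirce_neg_le_traceRad hW hd hx
        obtain ⟨b, hb⟩ := IsTangent.mul_self_eq_zero h hP hu hv huv hxU
          (IsRankOne.mul_eq_zero h hW hd hxR hxR)
        exact ⟨Submodule.mem_span_singleton.2 ⟨b, hb.symm⟩, hx0⟩
      · rintro ⟨hx, hx0⟩
        have hxU : x ∈ U := (Submodule.span_singleton_le_iff_mem _ _).2 hu hx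
        refine ⟨⟨hx0, ?_⟩, hxU⟩
        have hs : ∃ e : F, u * (a • d + r) = e • u := by
          by_contra! hs
          exact not_isTypeU_and_isTypeD (U := U) hU.1
            (h.isTypeD_iff.2 ⟨hP, u, hu, _, hv, huv, hs⟩)
        obtain ⟨e, he⟩ := hs
        obtain ⟨h3, h4⟩ := IsRankOne.isSquare_of_stable h hW hd huR huv.1 hr ha he
        obtain ⟨b, rfl⟩ := Submodule.mem_span_singleton.1 hx
        have htx := h.trace_eq_zero hP hxU
        -- The eigenvalue of `d` on the nilpotent line is `±1`, which places the line in one of the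
        -- two eigenspaces.
        rcases mul_self_eq_one_iff.1 h4 with h5 | h5
        · refine Or.inr ⟨hU.2 hxU, mem_peirce_neg.2 ⟨htx, ?_⟩⟩
          rw [mul_smul_comm, h3, h5, neg_one_smul, smul_neg]
        · refine Or.inl ⟨hU.2 hxU, htx, ?_⟩
          rw [mul_smul_comm, h3, h5, neg_neg, one_smul]
  · obtain ⟨hx0, hx⟩ := hx
    have hxR : x ∈ traceRad t W := by
      rcases hx with hx | hx
      · exact h.inf_peirce_le_traceRad hW hd hx
      · exact h.inf_peirce_neg_le_traceRad hW hd hx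
    have hdx : ∃ s : F, d * x = s • x := by
      rcases hx with hx | hx
      · exact ⟨1, by rw [hx.2.2, one_smul]⟩
      · exact ⟨-1, by rw [(mem_peirce_neg.1 hx.2).2, neg_one_smul]⟩
    obtain ⟨s, hs⟩ := hdx
    have e : {U ∈ {U ∈ planes F O .U | U ≤ W} | x ∈ U} =
        {U | IsImagPlane U ∧ U ≤ W ∧ x ∈ U} \ {traceRad t W} := by
      ext U
      constructor
      · rintro ⟨⟨hU, hUW⟩, hxU⟩
        refine ⟨⟨h.isImagPlane_of_mem_planes hU, hUW, hxU⟩, ?_⟩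
        rintro rfl
        have := h.planes_unique (X := .U) (Y := .Z) hU hZ
        simp at this
      · rintro ⟨⟨hU, hUW, hxU⟩, hne⟩
        refine ⟨⟨?_, hUW⟩, hxU⟩
        rcases IsRankOne.plane_cases h hW hd hU hUW with
          he | ⟨u, hu, v, hv, huR, huv, a, r, ha, hr, rfl⟩
        · exact (hne he).elim
        · obtain ⟨b, rfl⟩ := IsTangent.mul_self_eq_zero h hU hu hv huv hxU
            (IsRankOne.mul_eq_zero h hW hd hxR hxR)
          have hb : b ≠ 0 := by rintro rfl; simp at hx0
          refine h.isTypeU_iff.2 ⟨hU, u, hu, _, hv, huv, -(a * s), ?_⟩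
          rw [IsRankOne.mul_tangent h hW hd huR hr]
          have : d * u = s • u := by
            rw [mul_smul_comm, smul_comm] at hs
            exact smul_right_injective O hb hs
          rw [this, smul_smul, neg_smul]
    have h3 := Set.ncard_sdiff_singleton_add_one (s := {U | IsImagPlane U ∧ U ≤ W ∧ x ∈ U})
      (a := traceRad t W) ⟨hZ.1, fun y hy => hy.1, hxR⟩
    have h4 := h.ncard_planes_through hW.1 hW.2.1 hxR.1 hx0
    rw [← h3, ← e] at h4
    push_cast at h4
    linear_combination h4

end Split

section Nil

variable {W : Submodule F O} (hW : IsImagSubalgebra t W) (hrad : traceRad t W = W)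
include hW hrad

theorem mul_self_eq_zero_of_nil {x : O} (hx : x ∈ W) : x * x = 0 := by
  rw [h.mul_self_eq_zero (h.mem_imag.1 (hW.1 hx))]
  exact (hrad.ge hx).2 x hx

theorem mul_mem_of_nil {x y : O} (hx : x ∈ W) (hy : y ∈ W) : x * y ∈ W := by
  have := hW.2.2 x hx y hy
  rwa [(hrad.ge hx).2 y hy, zero_div, zero_smul, sub_zero] at this

/-- The square of the radical is a line annihilated by the radical. -/
theorem exists_annihilator : ∃ z ∈ W, z ≠ 0 ∧ ∀ x ∈ W, x * z = 0 := by
  haveI := h.moduleFinite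
  have hiso := fun x (hx : x ∈ W) => h.mul_self_eq_zero_of_nil hW hrad hx
  have htr : ∀ x ∈ W, ∀ y ∈ W, t (x * y) = 0 := fun x hx y hy => (hrad.ge hx).2 y hy
  have himag : ∀ x ∈ W, t x = 0 := fun x hx => h.mem_imag.1 (hW.1 hx)
  -- A plane with zero multiplication is its own annihilator, so the three-dimensional `W` cannot
  -- have all products zero.
  obtain ⟨x, hx, y, hy, hxy⟩ : ∃ x ∈ W, ∃ y ∈ W, x * y ≠ 0 := by
    by_contra! hc
    obtain ⟨v, hv, hv0⟩ := exists_mem_ne_zero_of_finrank_pos (P := W) (by rw [hW.2.1]; norm_num)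
    obtain ⟨u, hu, hne⟩ := exists_not_smul (P := W) (by rw [hW.2.1]; norm_num) v
    have : W ≤ Submodule.span F {u, v} := fun x hx => by
      obtain ⟨a, b, hab⟩ := h.exists_of_mul_eq_zero (himag u hu) (hiso u hu) (himag v hv)
        (hc u hu v hv) hne hv0 (himag x hx) (hc u hu x hx) (hc v hv x hx)
      exact Submodule.mem_span_pair.2 ⟨a, b, hab.symm⟩
    have h1 := Submodule.finrank_mono this
    have hu0 : u ≠ 0 := by
      rintro rfl; exact hne 0 (by simp)
    rw [Set.pair_comm, finrank_span_pair hv0 hne, hW.2.1] at h1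
    omega
  have hz := h.mul_mem_of_nil hW hrad hx hy
  refine ⟨x * y, hz, hxy, fun v hv => ?_⟩
  have hx0 : x ≠ 0 := by rintro rfl; simp at hxy
  have hne : ∀ c : F, y ≠ c • x := by
    rintro c rfl; rw [mul_smul_comm, hiso x hx, smul_zero] at hxy; exact hxy rfl
  have hzn : x * y ∉ Submodule.span F {x, y} := by
    intro hm
    obtain ⟨a, b, hab⟩ := Submodule.mem_span_pair.1 hm
    exact hxy (h.mul_eq_zero_of_mul_mem (hiso x hx) (hiso y hy) hab.symm)
  -- `x`, `y` and `x * y` form a basis of `W`, and all three annihilate `x * y`.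
  have hspan : Submodule.span F {x, y} ⊔ Submodule.span F {x * y} = W := by
    refine eq_sup_span ?_ hz hzn (by rw [finrank_span_pair hx0 hne, hW.2.1])
    rw [Submodule.span_le]
    rintro z (rfl | rfl) <;> assumption
  rw [← hspan] at hv
  obtain ⟨p, hp, z, hz', rfl⟩ := Submodule.mem_sup.1 hv
  obtain ⟨a, b, rfl⟩ := Submodule.mem_span_pair.1 hp
  obtain ⟨c, rfl⟩ := Submodule.mem_span_singleton.1 hz'
  have e1 : x * (x * y) = 0 := by rw [h.left_alt, hiso x hx, zero_mul]
  have e2 : y * (x * y) = 0 := by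
    have h1 := h.mul_eq_neg (himag _ hz) (himag y hy) (htr _ hz y hy)
    rw [h1, h.right_alt, hiso y hy, mul_zero, neg_zero]
  rw [add_mul, add_mul, smul_mul_assoc, smul_mul_assoc, smul_mul_assoc, e1, e2, hiso _ hz]
  simp

/-- A plane of type Z is its own annihilator and therefore contains the annihilated vector `z`.
Conversely, every plane through `z` has zero multiplication. The planes in question form the pencil
through `z`. -/
theorem ncard_typeZ_of_nil [Finite F] :
    ({U ∈ planes F O .Z | U ≤ W}.ncard : ℚ) = Nat.card F + 1 := by
  haveI := h.moduleFinite
  have himag : ∀ x ∈ W, t x = 0 := fun x hx => h.mem_imag.1 (hW.1 hx)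
  have hiso := fun x (hx : x ∈ W) => h.mul_self_eq_zero_of_nil hW hrad hx
  obtain ⟨z, hz, hz0, hann⟩ := h.exists_annihilator hW hrad
  have hann' : ∀ x ∈ W, z * x = 0 := fun x hx => by
    rw [h.mul_eq_neg (himag x hx) (himag z hz) (by rw [hann x hx, map_zero]), hann x hx, neg_zero]
  rw [← h.ncard_planes_through hW.1 hW.2.1 hz hz0]
  congr 2
  ext U
  constructor
  · rintro ⟨hU, hUW⟩
    obtain ⟨hP, hzero⟩ := h.isTypeZ_iff.1 hU
    refine ⟨hP, hUW, ?_⟩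
    obtain ⟨v, hv, hv0⟩ := exists_mem_ne_zero_of_finrank_pos (P := U) (by rw [hP.2]; norm_num)
    obtain ⟨u, hu, hne⟩ := exists_not_smul (P := U) hP.2.ge v
    obtain ⟨a, b, rfl⟩ := h.exists_of_mul_eq_zero (himag u (hUW hu)) (hiso u (hUW hu))
      (himag v (hUW hv)) (hzero u hu v hv) hne hv0 (himag z hz) (hann u (hUW hu)) (hann v (hUW hv))
    exact U.add_mem (U.smul_mem a hu) (U.smul_mem b hv)
  · rintro ⟨hP, hUW, hzU⟩
    refine ⟨h.isTypeZ_iff.2 ⟨hP, ?_⟩, hUW⟩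
    obtain ⟨u, hu, hne⟩ := exists_not_smul (P := U) hP.2.ge z
    intro x hx y hy
    obtain ⟨a, b, rfl⟩ := exists_mem_span_pair hP.2 hzU hu hz0 hne hx
    obtain ⟨a', b', rfl⟩ := exists_mem_span_pair hP.2 hzU hu hz0 hne hy
    simp only [add_mul, mul_add, smul_mul_assoc, mul_smul_comm, hiso z hz, hiso u (hUW hu),
      hann u (hUW hu), hann' u (hUW hu)]
    simp

end Nil

/-- The numbers `T_{X,Y}`. -/
theorem ncard_planes_le [Finite F] (X : PlaneType) (Y : SubalgType) {W : Submodule F O}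
    (hY : W ∈ imagSubalgs t Y) :
    ({U ∈ planes F O X | U ≤ W}.ncard : ℚ) = tTable (Nat.card F : ℚ) X Y := by
  have hW : IsImagSubalgebra t W := by cases Y <;> exact hY.1
  -- In each column a single type is not counted directly; it is what remains of the total `q² + q +
  -- 1`.
  have hsum := h.ncard_planes_types hW.1 hW.2.1
  have hcases := fun X U => h.type_cases (X := X) (U := U) hY
  have h0 : ∀ X, (∀ U ∈ planes F O X, ¬ U ≤ W) → ({U ∈ planes F O X | U ≤ W}.ncard : ℚ) = 0 :=
    fun X hX => by rw [h.ncard_eq_zero_of_not_mem hX, Nat.cast_zero]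
  cases Y
  · have hU := h.ncard_typeU_of_nondegenerate hW hY.2
    have hM := h.ncard_typeM_of_nondegenerate hW hY.2
    have hDn := h0 .Dn fun U h1 h2 => by simpa using hcases _ U h1 h2
    have hDs := h0 .Ds fun U h1 h2 => by simpa using hcases _ U h1 h2
    have hJ := h0 .J fun U h1 h2 => by simpa using hcases _ U h1 h2
    have hZ := h0 .Z fun U h1 h2 => by simpa using hcases _ U h1 h2
    cases X <;> simp only [tTable] <;> linarith
  · obtain ⟨w, c, hw, -⟩ := hY.2
    have hZ : ({U ∈ planes F O .Z | U ≤ W}.ncard : ℚ) = 1 := by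
      rw [IsRankOne.ncard_typeZ h hW hw, Nat.cast_one]
    have hQ := h0 .Q fun U h1 h2 => by simpa using hcases _ U h1 h2
    have hU := h0 .U fun U h1 h2 => by simpa using hcases _ U h1 h2
    have hDs := h0 .Ds fun U h1 h2 => by simpa using hcases _ U h1 h2
    have hM := h0 .M fun U h1 h2 => by simpa using hcases _ U h1 h2
    have hJ := h0 .J fun U h1 h2 => by simpa using hcases _ U h1 h2
    cases X <;> simp only [tTable] <;> linarith
  · obtain ⟨w, hw⟩ := hY.2
    have hZ : ({U ∈ planes F O .Z | U ≤ W}.ncard : ℚ) = 1 := by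
      rw [IsRankOne.ncard_typeZ h hW hw, Nat.cast_one]
    have hU := h.ncard_typeU_of_split hW hw
    have hQ := h0 .Q fun U h1 h2 => by simpa using hcases _ U h1 h2
    have hDn := h0 .Dn fun U h1 h2 => by simpa using hcases _ U h1 h2
    have hM := h0 .M fun U h1 h2 => by simpa using hcases _ U h1 h2
    have hJ := h0 .J fun U h1 h2 => by simpa using hcases _ U h1 h2
    cases X <;> simp only [tTable] <;> linarith
  · have hZ := h.ncard_typeZ_of_nil hW hY.2
    have hQ := h0 .Q fun U h1 h2 => by simpa using hcases _ U h1 h2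
    have hU := h0 .U fun U h1 h2 => by simpa using hcases _ U h1 h2
    have hDn := h0 .Dn fun U h1 h2 => by simpa using hcases _ U h1 h2
    have hDs := h0 .Ds fun U h1 h2 => by simpa using hcases _ U h1 h2
    have hM := h0 .M fun U h1 h2 => by simpa using hcases _ U h1 h2
    cases X <;> simp only [tTable] <;> linarith

end IsCayleyTrace

end PlaneCounts

/-! ### Subalgebras containing a given plane. -/

section SubalgebraCounts

variable [SMulCommClass F O O] [IsScalarTower F O O] {t : O →ₗ[F] F}

namespace IsCayleyTrace

variable (h : IsCayleyTrace F t)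
include h

theorem sub_trace_eq {x r : O} {k : F} (hr : t r = 0) (hx : x = k • 1 + r) :
    x - (t x / 2) • 1 = r := by
  have h2 := h.two
  rw [hx, map_add, map_smul, hr, h.trace_one, add_zero, smul_eq_mul, mul_div_assoc, div_self h2,
    mul_one, add_sub_cancel_left]

theorem IsImagSubalgebra_type {Y : SubalgType} {W : Submodule F O} (hY : W ∈ imagSubalgs t Y) :
    IsImagSubalgebra t W := by cases Y <;> exact hY.1

/-! ### Planes that generate a four-dimensional subalgebra -/

/-- Two imaginary elements generate a subalgebra of dimension at most four. -/
theorem isImagSubalgebra_sup {U : Submodule F O} (hU : IsImagPlane U) {u v : O} (hu : u ∈ U)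
    (hv : v ∈ U) (hu0 : u ≠ 0) (hne : ∀ c : F, v ≠ c • u)
    (hz : u * v - (t (u * v) / 2) • 1 ∉ U) :
    IsImagSubalgebra t (U ⊔ Submodule.span F {u * v - (t (u * v) / 2) • 1}) := by
  haveI := h.moduleFinite
  have htu := h.trace_eq_zero hU hu
  have htv := h.trace_eq_zero hU hv
  obtain ⟨s, hs⟩ : ∃ s, s = t (u * v) / 2 := ⟨_, rfl⟩
  rw [← hs] at hz ⊢
  obtain ⟨z, hzdef⟩ : ∃ z, z = u * v - s • 1 := ⟨_, rfl⟩
  rw [← hzdef] at hz ⊢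
  have hsub : ∀ x, x ∈ U ⊔ Submodule.span F {z} ↔ ∃ a b c : F, x = a • u + b • v + c • z := by
    intro x
    constructor
    · intro hx
      obtain ⟨y, hy, y', hy', rfl⟩ := Submodule.mem_sup.1 hx
      obtain ⟨a, b, rfl⟩ := exists_mem_span_pair hU.2 hu hv hu0 hne hy
      obtain ⟨c, rfl⟩ := Submodule.mem_span_singleton.1 hy'
      exact ⟨a, b, c, rfl⟩
    · rintro ⟨a, b, c, rfl⟩
      exact Submodule.add_mem_sup (U.add_mem (U.smul_mem a hu) (U.smul_mem b hv))
        (Submodule.smul_mem _ c (Submodule.mem_span_singleton_self z))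
  have htz : t z = 0 := h.mem_imag.1 (by rw [hzdef, hs]; exact h.sub_mem_imag _)
  obtain ⟨α, hα⟩ : ∃ α : F, u * u = α • 1 := ⟨_, h.mul_self htu⟩
  obtain ⟨β, hβ⟩ : ∃ β : F, v * v = β • 1 := ⟨_, h.mul_self htv⟩
  obtain ⟨ζ, hζ⟩ : ∃ ζ : F, z * z = ζ • 1 := ⟨_, h.mul_self htz⟩
  have huv : u * v = z + s • 1 := by rw [hzdef]; abel
  have hvu : v * u = -z + s • 1 := by
    have h1 := h.add_comm_mul htu htv
    have h3 : t (u * v) = 2 * s := by rw [hs]; field_simp [h.two]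
    rw [h3] at h1
    rw [hzdef]
    linear_combination (norm := module) h1
  -- The alternative laws determine the whole multiplication table on `1, u, v, z`.
  have huz : u * z = α • v - s • u := by
    rw [hzdef, mul_sub, h.left_alt, hα, smul_mul_assoc, one_mul, mul_smul_comm, mul_one]
  have hzv : z * v = β • u - s • v := by
    rw [hzdef, sub_mul, h.right_alt, hβ, smul_mul_assoc, one_mul, mul_smul_comm, mul_one]
  have hzu : z * u = -(α • v - s • u) := by
    rw [← huz]; exact h.mul_eq_neg htu htz (by rw [huz]; simp [htu, htv])
  have hvz : v * z = -(β • u - s • v) := by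
    rw [← hzv]; exact h.mul_eq_neg htz htv (by rw [hzv]; simp [htu, htv])
  refine ⟨?_, ?_, ?_⟩
  · intro x hx
    obtain ⟨a, b, c, rfl⟩ := (hsub x).1 hx
    rw [h.mem_imag]; simp [htu, htv, htz]
  · rw [finrank_sup_span hz, hU.2]
  · intro x hx y hy
    obtain ⟨a, b, c, rfl⟩ := (hsub x).1 hx
    obtain ⟨a', b', c', rfl⟩ := (hsub y).1 hy
    rw [h.sub_trace_eq
      (r := ((b * c' - c * b') * (-β) - (a * c' - c * a') * s) • u +
        ((a * c' - c * a') * α + (b * c' - c * b') * s) • v + (a * b' - b * a') • z)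
      (k := a * a' * α + b * b' * β + c * c' * ζ + (a * b' + b * a') * s)
      (by simp [htu, htv, htz])]
    · exact (hsub _).2 ⟨_, _, _, rfl⟩
    · simp only [add_mul, mul_add, smul_mul_assoc, mul_smul_comm, hα, hβ, hζ, huv, hvu, huz, hzu,
        hvz, hzv]
      module

theorem eq_of_generates {U : Submodule F O} (hU : IsImagPlane U) {u v : O} (hu : u ∈ U)
    (hv : v ∈ U) (hz : u * v - (t (u * v) / 2) • 1 ∉ U) {W : Submodule F O}
    (hW : IsImagSubalgebra t W) (hUW : U ≤ W) :
    W = U ⊔ Submodule.span F {u * v - (t (u * v) / 2) • 1} := by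
  haveI := h.moduleFinite
  exact (eq_sup_span hUW (hW.2.2 u (hUW hu) v (hUW hv)) hz (by rw [hW.2.1, hU.2])).symm

/-- The imaginary part of `uv` is orthogonal to `u` and `v`. If it lay in `U`, it would vanish, so
that `uv = s` and `s u = u(uv) = α v`. Independence gives `α = s = 0`, and `u` would be in the
radical. -/
theorem generates_of_nondegenerate {U : Submodule F O} (hU : IsImagPlane U)
    (hrad : traceRad t U = ⊥) {u v : O} (hu : u ∈ U) (hv : v ∈ U) (hu0 : u ≠ 0)
    (hne : ∀ c : F, v ≠ c • u) : u * v - (t (u * v) / 2) • 1 ∉ U := by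
  haveI := h.moduleFinite
  intro hz
  have htu := h.trace_eq_zero hU hu
  have htv := h.trace_eq_zero hU hv
  obtain ⟨s, hs⟩ : ∃ s, s = t (u * v) / 2 := ⟨_, rfl⟩
  rw [← hs] at hz
  obtain ⟨α, hα⟩ : ∃ α : F, u * u = α • 1 := ⟨_, h.mul_self htu⟩
  obtain ⟨β, hβ⟩ : ∃ β : F, v * v = β • 1 := ⟨_, h.mul_self htv⟩
  have h1 : u * (u * v) = α • v := by rw [h.left_alt, hα, smul_mul_assoc, one_mul]
  have h3 : (u * v) * v = β • u := by rw [h.right_alt, hβ, mul_smul_comm, mul_one]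
  have hz0 : u * v - s • 1 = 0 := by
    rw [← Submodule.mem_bot F, ← hrad]
    refine ⟨hz, fun y hy => ?_⟩
    obtain ⟨a, b, rfl⟩ := exists_mem_span_pair hU.2 hu hv hu0 hne hy
    have e1 : t ((u * v - s • 1) * u) = 0 := by
      rw [h.comm, mul_sub, h1, map_sub, map_smul, htv, mul_smul_comm, mul_one, map_smul, htu]
      simp
    have e2 : t ((u * v - s • 1) * v) = 0 := by
      rw [sub_mul, h3, map_sub, map_smul, htu, smul_mul_assoc, one_mul, map_smul, htv]
      simp
    rw [mul_add, mul_smul_comm, mul_smul_comm, map_add, map_smul, map_smul, e1, e2]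
    simp
  rw [sub_eq_zero.1 hz0, mul_smul_comm, mul_one] at h1
  have hα0 : α = 0 := by
    by_contra hα0
    apply hne (α⁻¹ * s)
    rw [mul_smul, h1, smul_smul, inv_mul_cancel₀ hα0, one_smul]
  rw [hα0, zero_smul] at h1
  have hs0 := (smul_eq_zero.1 h1).resolve_right hu0
  apply hu0
  rw [← Submodule.mem_bot F, ← hrad]
  refine ⟨hu, fun y hy => ?_⟩
  obtain ⟨a, b, rfl⟩ := exists_mem_span_pair hU.2 hu hv hu0 hne hy
  rw [mul_add, mul_smul_comm, mul_smul_comm, hα, sub_eq_zero.1 hz0, hα0, hs0]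
  simp

/-- Planes of types Q, M, Dn, Ds and J lie in exactly one four-dimensional subalgebra. -/
theorem existsUnique_imagSubalgebra [Finite F] {X : PlaneType} {U : Submodule F O}
    (hX : U ∈ planes F O X) (hXU : X ≠ .U) (hXZ : X ≠ .Z) :
    ∃ W, (IsImagSubalgebra t W ∧ U ≤ W) ∧ ∀ W', IsImagSubalgebra t W' → U ≤ W' → W' = W := by
  haveI := h.moduleFinite
  have hU := h.isImagPlane_of_mem_planes hX
  -- Once `uv` lies outside `F1 + U`, its imaginary part must be adjoined, and adjoining it already
  -- gives a subalgebra.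
  obtain ⟨u, hu, v, hv, hu0, hne, hz⟩ : ∃ u ∈ U, ∃ v ∈ U, u ≠ 0 ∧ (∀ c : F, v ≠ c • u) ∧
      u * v - (t (u * v) / 2) • 1 ∉ U := by
    have hnd : traceRad t U = ⊥ → ∃ u ∈ U, ∃ v ∈ U, u ≠ 0 ∧ (∀ c : F, v ≠ c • u) ∧
        u * v - (t (u * v) / 2) • 1 ∉ U := by
      intro hrad
      obtain ⟨u, hu, hu0⟩ := exists_mem_ne_zero_of_finrank_pos (P := U) (by rw [hU.2]; norm_num)
      obtain ⟨v, hv, hne⟩ := exists_not_smul (P := U) hU.2.ge u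
      exact ⟨u, hu, v, hv, hu0, hne, h.generates_of_nondegenerate hU hrad hu hv hu0 hne⟩
    have hD : IsTypeD U → ∃ u ∈ U, ∃ v ∈ U, u ≠ 0 ∧ (∀ c : F, v ≠ c • u) ∧
        u * v - (t (u * v) / 2) • 1 ∉ U := by
      intro hD
      obtain ⟨-, u, hu, v, hv, huv, hs⟩ := h.isTypeD_iff.1 hD
      refine ⟨u, hu, v, hv, huv.1, huv.ne_smul, fun hm => ?_⟩
      rw [huv.2.2.2, zero_div, zero_smul, sub_zero] at hm
      obtain ⟨c, hc⟩ := IsTangent.exists_mul_eq h hU hu hv huv hm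
      exact hs c hc
    cases X
    · refine hnd ((Submodule.eq_bot_iff _).2 fun x hx => ?_)
      exact (h.isTypeQ_iff.1 hX).2 x hx.1
        ((h.mul_self_eq_zero (h.trace_eq_zero hU hx.1)).2 (hx.2 x hx.1))
    · exact (hXU rfl).elim
    · exact hD hX.1
    · exact hD hX.1
    · refine hnd ((Submodule.eq_bot_iff _).2 fun x hx => ?_)
      obtain ⟨-, u, hu, v, hv, huu, hvv, huv⟩ := h.isTypeM_iff.1 hX
      have hu0 : u ≠ 0 := by rintro rfl; simp at huv
      have hne : ∀ c : F, v ≠ c • u := by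
        rintro c rfl; rw [mul_smul_comm, huu] at huv; simp at huv
      obtain ⟨a, b, rfl⟩ := exists_mem_span_pair hU.2 hu hv hu0 hne hx.1
      have e1 := hx.2 u hu
      have e2 := hx.2 v hv
      simp only [add_mul, smul_mul_assoc, huu, hvv, map_smul, h.comm v u, smul_zero, zero_add,
        add_zero] at e1 e2
      rw [(smul_eq_zero.1 e1).resolve_right huv, (smul_eq_zero.1 e2).resolve_right huv]
      simp
    · obtain ⟨-, hiso, u, hu, v, hv, huv⟩ := h.isTypeJ_iff.1 hX
      refine ⟨u, hu, v, hv, ?_, ?_, fun hm => ?_⟩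
      · rintro rfl; simp at huv
      · rintro c rfl; rw [mul_smul_comm, hiso u hu, smul_zero] at huv; exact huv rfl
      · rw [h.trace_mul_eq_zero hU.1 hiso hu hv, zero_div, zero_smul, sub_zero] at hm
        have hu0 : u ≠ 0 := by rintro rfl; simp at huv
        have hne : ∀ c : F, v ≠ c • u := by
          rintro c rfl; rw [mul_smul_comm, hiso u hu, smul_zero] at huv; exact huv rfl
        obtain ⟨a, b, hab⟩ := exists_mem_span_pair hU.2 hu hv hu0 hne hm
        exact huv (h.mul_eq_zero_of_mul_mem (hiso u hu) (hiso v hv) hab)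
    · exact (hXZ rfl).elim
  exact ⟨_, ⟨h.isImagSubalgebra_sup hU hu hv hu0 hne hz, le_sup_left⟩,
    fun W' hW' hUW' => h.eq_of_generates hU hu hv hz hW' hUW'⟩

/-! ### Planes of type U -/

/-- From `uv = c u` and right alternativity, `v² = c²`; then `d = -c⁻¹ v` works because `u` and `v`
anticommute. -/
theorem exists_normal_form_typeU [Finite F] {U : Submodule F O} (hU : IsTypeU U) :
    ∃ d ∈ U, ∃ u ∈ U, d * d = 1 ∧ u ∈ peirce t d ∧ u ≠ 0 := by
  obtain ⟨hP, u, hu, v, hv, huv, c, hc⟩ := h.isTypeU_iff.1 hU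
  have htu := h.trace_eq_zero hP hu
  have htv := h.trace_eq_zero hP hv
  obtain ⟨γ, hγ⟩ : ∃ γ : F, v * v = γ • 1 := ⟨_, h.mul_self htv⟩
  have hγ0 : γ ≠ 0 := IsTangent.coeff_ne_zero h huv hγ
  have h1 := h.right_alt v u
  rw [hc, smul_mul_assoc, hc, hγ, mul_smul_comm, mul_one, smul_smul] at h1
  have h3 : c * c = γ := by
    have : (c * c - γ) • u = 0 := by rw [sub_smul, h1, sub_self]
    exact sub_eq_zero.1 ((smul_eq_zero.1 this).resolve_right huv.1)
  have hc0 : c ≠ 0 := by rintro rfl; exact hγ0 (by rw [← h3, mul_zero])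
  refine ⟨-(c⁻¹ • v), U.neg_mem (U.smul_mem _ hv), u, hu, ?_, ⟨htu, ?_⟩, huv.1⟩
  · rw [neg_mul_neg, smul_mul_assoc, mul_smul_comm, hγ, ← h3, smul_smul, smul_smul,
      show c⁻¹ * c⁻¹ * (c * c) = 1 by field_simp, one_smul]
  · rw [neg_mul, smul_mul_assoc, h.mul_eq_neg htu htv huv.2.2.2, hc, smul_neg, neg_neg, smul_smul,
      inv_mul_cancel₀ hc0, one_smul]

section TypeU

variable {d u : O} (hd : t d = 0) (hdd : d * d = 1) (hu : u ∈ peirce t d) (hu0 : u ≠ 0)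
include hd hdd hu hu0

theorem isImagSubalgebra_range {b : O} (hb : b ∈ peirce t (-d)) (hb0 : b ≠ 0) :
    IsImagSubalgebra t
      (LinearMap.range (peirceMap d (Submodule.span F {u}) (Submodule.span F {b}))) := by
  have hA : Submodule.span F {u} ≤ peirce t d := (Submodule.span_singleton_le_iff_mem _ _).2 hu
  have hB : Submodule.span F {b} ≤ peirce t (-d) := (Submodule.span_singleton_le_iff_mem _ _).2 hb
  have hmem : ∀ x, x ∈ LinearMap.range (peirceMap d (Submodule.span F {u}) (Submodule.span F {b})) ↔
      ∃ p r s : F, x = p • d + r • u + s • b := by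
    intro x
    rw [mem_range_peirceMap]
    constructor
    · rintro ⟨p, a, b', ha, hb', rfl⟩
      obtain ⟨r, rfl⟩ := Submodule.mem_span_singleton.1 ha
      obtain ⟨s, rfl⟩ := Submodule.mem_span_singleton.1 hb'
      exact ⟨p, r, s, rfl⟩
    · rintro ⟨p, r, s, rfl⟩
      exact ⟨p, _, _, Submodule.smul_mem _ r (Submodule.mem_span_singleton_self u),
        Submodule.smul_mem _ s (Submodule.mem_span_singleton_self b), rfl⟩
  refine ⟨?_, ?_, ?_⟩
  · intro x hx
    obtain ⟨p, r, s, rfl⟩ := (hmem x).1 hx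
    rw [h.mem_imag]; simp [hd, hu.1, hb.1]
  · rw [h.finrank_range_peirceMap hd hdd hA hB, finrank_span_singleton hu0,
      finrank_span_singleton hb0]
  · intro x hx y hy
    obtain ⟨p, r, s, rfl⟩ := (hmem x).1 hx
    obtain ⟨p', r', s', rfl⟩ := (hmem y).1 hy
    have hbu := h.peirce_neg_mul_peirce hd hdd hb hu
    rw [h.comm b u] at hbu
    have hub := h.peirce_mul_peirce_neg hd hdd hu hb
    obtain ⟨τ, hτ⟩ : ∃ τ, τ = t (u * b) / 2 := ⟨_, rfl⟩
    rw [← hτ] at hbu hub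
    rw [h.sub_trace_eq
      (r := ((r * s' - s * r') * τ) • d + (p * r' - r * p') • u + (s * p' - p * s') • b)
      (k := p * p' + (r * s' + s * r') * τ) (by simp [hd, hu.1, hb.1])]
    · exact (hmem _).2 ⟨_, _, _, rfl⟩
    · simp only [add_mul, mul_add, smul_mul_assoc, mul_smul_comm, hdd, hu.2,
        h.peirce_mul hd hu, (mem_peirce_neg.1 hb).2, h.peirce_mul_neg hd hb,
        h.peirce_self_mul hd hu, h.peirce_neg_self_mul hd hb, hub, hbu]
      module

/-- The two dimensions add up to 2 and the first is positive because of `u`. If the second were 0,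
some `y` independent of `u` in the first eigenspace would yield a nonzero `u * y` in the second. -/
theorem finrank_inf_peirce_neg_eq_one {W : Submodule F O} (hW : IsImagSubalgebra t W) (hdW : d ∈ W)
    (huW : u ∈ W) : Module.finrank F (W ⊓ peirce t (-d) : Submodule F O) = 1 := by
  haveI := h.moduleFinite
  have h1 := h.finrank_inf_peirce hW hdW hdd
  have h3 : Module.finrank F (W ⊓ peirce t d : Submodule F O) ≠ 0 := fun h0 => by
    have := Submodule.finrank_eq_zero.1 h0
    have hm : u ∈ W ⊓ peirce t d := ⟨huW, hu⟩
    rw [this, Submodule.mem_bot] at hm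
    exact hu0 hm
  have h4 : Module.finrank F (W ⊓ peirce t (-d) : Submodule F O) ≠ 0 := fun h0 => by
    obtain ⟨y, hy, hne⟩ := exists_not_smul (P := W ⊓ peirce t d) (by omega) u
    have hm : u * y ∈ W ⊓ peirce t (-d) := by
      refine ⟨?_, h.peirce_mul_mem hd hu hy.2⟩
      have := hW.2.2 u huW y hy.1
      rwa [h.peirce_trace_mul hd hu hy.2, zero_div, zero_smul, sub_zero] at this
    rw [Submodule.finrank_eq_zero.1 h0, Submodule.mem_bot] at hm
    obtain ⟨c, hc⟩ := h.mem_span_of_peirce_mul_eq_zero hd hdd hu hu0 hy.2 hm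
    exact hne c hc
  omega

theorem eq_range_of_mem {W : Submodule F O} (hW : IsImagSubalgebra t W) (hdW : d ∈ W)
    (huW : u ∈ W) {b : O} (hb : b ∈ peirce t (-d)) (hb0 : b ≠ 0) (hbW : b ∈ W) :
    W = LinearMap.range (peirceMap d (Submodule.span F {u}) (Submodule.span F {b})) := by
  haveI := h.moduleFinite
  symm
  apply Submodule.eq_of_le_of_finrank_eq
  · intro x hx
    obtain ⟨p, a, b', ha, hb', rfl⟩ := mem_range_peirceMap.1 hx
    exact W.add_mem (W.add_mem (W.smul_mem p hdW)
      ((Submodule.span_singleton_le_iff_mem _ _).2 huW ha))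
      ((Submodule.span_singleton_le_iff_mem _ _).2 hbW hb')
  · rw [hW.2.1, (h.isImagSubalgebra_range hd hdd hu hu0 hb hb0).2.1]

variable [Finite F]

/-- In a degenerate `W` the isotropic `u` lies in the radical, so its pairing with `b` vanishes.
Conversely, if `t (u * b) = 0`, then `u` is orthogonal to `d`, `u` and `b`, which span `W`. -/
theorem trace_ne_zero_iff {Y : SubalgType} {W : Submodule F O} (hY : W ∈ imagSubalgs t Y)
    (hdW : d ∈ W) (huW : u ∈ W) {b : O} (hb : b ∈ peirce t (-d)) (hb0 : b ≠ 0) (hbW : b ∈ W) :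
    t (u * b) ≠ 0 ↔ Y = .M4 := by
  have hW := h.IsImagSubalgebra_type hY
  have huu := h.peirce_self_mul hd hu
  constructor
  · intro hub
    cases Y
    · rfl
    · obtain ⟨w, c, hw, -⟩ := hY.2
      exfalso
      obtain ⟨a, r, hr, rfl⟩ := IsRankOne.exists_eq h hW hw huW
      rw [IsRankOne.mul_self_add h hW hw a hr] at huu
      have ha := (mul_eq_zero.1 (h.smul_one_inj huu)).resolve_right hw.2.2.1
      rw [_root_.mul_self_eq_zero.1 ha, zero_smul, zero_add] at hub
      exact hub (hr.2 b hbW)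
    · obtain ⟨w, hw⟩ := hY.2
      exfalso
      obtain ⟨a, r, hr, rfl⟩ := IsRankOne.exists_eq h hW hw huW
      rw [IsRankOne.mul_self_add h hW hw a hr] at huu
      have ha := (mul_eq_zero.1 (h.smul_one_inj huu)).resolve_right hw.2.2.1
      rw [_root_.mul_self_eq_zero.1 ha, zero_smul, zero_add] at hub
      exact hub (hr.2 b hbW)
    · exact (hub ((hY.2.ge huW).2 b hbW)).elim
  · rintro rfl hub
    apply hu0
    rw [← Submodule.mem_bot F, ← hY.2]
    refine ⟨huW, fun y hy => ?_⟩
    rw [h.eq_range_of_mem hd hdd hu hu0 hW hdW huW hb hb0 hbW] at hy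
    obtain ⟨p, a, b', ha, hb', rfl⟩ := mem_range_peirceMap.1 hy
    obtain ⟨r, rfl⟩ := Submodule.mem_span_singleton.1 ha
    obtain ⟨s, rfl⟩ := Submodule.mem_span_singleton.1 hb'
    rw [mul_add, mul_add, mul_smul_comm, mul_smul_comm, mul_smul_comm, huu, h.peirce_mul hd hu]
    simp [hub, hu.1]

/-- Subalgebras containing a plane of type U correspond to lines of a Peirce component. -/
theorem ncard_mul_of_typeU {U : Submodule F O} (hU : IsTypeU U) (hdU : d ∈ U) (huU : u ∈ U)
    {Y : SubalgType} {S : Set O} (hS : ∀ b ∈ S, b ∈ peirce t (-d) ∧ b ≠ 0)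
    (hSY : ∀ b ∈ peirce t (-d), b ≠ 0 → ∀ (Y' : SubalgType) (W : Submodule F O),
      W ∈ imagSubalgs t Y' → U ≤ W → b ∈ W → (b ∈ S ↔ Y' = Y)) :
    ({W ∈ imagSubalgs t Y | U ≤ W}.ncard : ℚ) * (Nat.card F - 1) = S.ncard := by
  haveI := h.moduleFinite
  haveI : Finite O := finite_of_moduleFinite (F := F)
  haveI : Finite (Submodule F O) := finite_submodule
  have hne : ∀ c : F, u ≠ c • d := by
    rintro c rfl
    have h1 := hu.2
    rw [mul_smul_comm, hdd] at h1
    have h3 := congrArg t h1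
    rw [map_smul, map_smul, hd, h.trace_one, smul_zero, smul_eq_mul] at h3
    rw [(mul_eq_zero.1 h3).resolve_right h.two, zero_smul] at hu0
    exact hu0 rfl
  have hd0 : d ≠ 0 := by
    rintro rfl
    rw [mul_zero] at hdd
    haveI := h.nontrivial
    exact zero_ne_one hdd
  have hUle : ∀ W : Submodule F O, d ∈ W → u ∈ W → U ≤ W := fun W hdW huW => by
    rw [← span_pair_eq hU.1.2 hdU huU hd0 hne, Submodule.span_le]
    rintro x (rfl | rfl) <;> assumption
  rw [← mul_one (S.ncard : ℚ)]
  refine ncard_mul_eq_ncard_mul_cast (fun W b => b ∈ W) (fun W hW => ?_) (fun b hb => ?_)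
  · have hI := h.IsImagSubalgebra_type hW.1
    have h1 := h.finrank_inf_peirce_neg_eq_one hd hdd hu hu0 hI (hW.2 hdU) (hW.2 huU)
    have h3 := ncard_sdiff_zero (F := F) (W ⊓ peirce t (-d))
    rw [h1, pow_one] at h3
    rw [← h3]
    congr 2
    ext b
    constructor
    · rintro ⟨hb, hbW⟩
      exact ⟨⟨hbW, (hS b hb).1⟩, (hS b hb).2⟩
    · rintro ⟨⟨hbW, hb⟩, hb0⟩
      exact ⟨(hSY b hb hb0 Y W hW.1 hW.2 hbW).2 rfl, hbW⟩
  · obtain ⟨hbp, hb0⟩ := hS b hb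
    rw [Nat.cast_eq_one]
    have hI := h.isImagSubalgebra_range hd hdd hu hu0 hbp hb0
    obtain ⟨Y', hY'⟩ := h.exists_mem_imagSubalgs hI
    have hm : ∀ p r s : F, p • d + r • u + s • b ∈
        LinearMap.range (peirceMap d (Submodule.span F {u}) (Submodule.span F {b})) := fun p r s =>
      mem_range_peirceMap.2 ⟨p, _, _, Submodule.smul_mem _ r (Submodule.mem_span_singleton_self u),
        Submodule.smul_mem _ s (Submodule.mem_span_singleton_self b), rfl⟩
    have hdW := hm 1 0 0
    have huW := hm 0 1 0
    rw [one_smul, zero_smul, zero_smul, add_zero, add_zero] at hdW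
    rw [zero_smul, one_smul, zero_smul, zero_add, add_zero] at huW
    have hUW := hUle _ hdW huW
    have hbW := hm 0 0 1
    rw [zero_smul, zero_smul, one_smul, zero_add, zero_add] at hbW
    obtain rfl := (hSY b hbp hb0 Y' _ hY' hUW hbW).1 hb
    refine ncard_eq_one_of_existsUnique ⟨_, ⟨⟨hY', hUW⟩, hbW⟩, fun W hW => ?_⟩
    exact h.eq_range_of_mem hd hdd hu hu0 (h.IsImagSubalgebra_type hW.1.1) (hW.1.2 hdU)
      (hW.1.2 huU) hbp hb0 hW.2

end TypeU

/-- The admissible `b` are those not orthogonal to `u`: `q³ - q²` vectors, `q - 1` for each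
subalgebra. -/
theorem ncard_typeU_M4 [Finite F] {U : Submodule F O} (hU : IsTypeU U) :
    ({W ∈ imagSubalgs t .M4 | U ≤ W}.ncard : ℚ) = (Nat.card F : ℚ) ^ 2 := by
  haveI := h.moduleFinite
  have hq := one_lt_natCard_cast (F := F)
  obtain ⟨d, hdU, u, huU, hdd, hu, hu0⟩ := h.exists_normal_form_typeU hU
  have hd := h.trace_eq_zero hU.1 hdU
  have h1 := h.ncard_mul_of_typeU hd hdd hu hu0 hU hdU huU (Y := .M4)
    (S := (peirce t (-d) : Set O) \ ((peirce t (-d) ⊓ orth t u : Submodule F O) : Set O))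
    (fun b hb => ⟨hb.1, by rintro rfl; exact hb.2 (Submodule.zero_mem _)⟩)
    (fun b hb hb0 Y' W hW hUW hbW => by
      rw [← h.trace_ne_zero_iff hd hdd hu hu0 hW (hUW hdU) (hUW huU) hb hb0 hbW]
      exact ⟨fun hb1 hb2 => hb1.2 ⟨hb, hb2⟩, fun hb1 => ⟨hb, fun hb2 => hb1 hb2.2⟩⟩)
  rw [ncard_sdiff_submodule inf_le_left, h.finrank_peirce_neg hd hdd,
    h.finrank_peirce_neg_orth hd hdd hu hu0] at h1
  have h2 : (Nat.card F : ℚ) - 1 ≠ 0 := by linarith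
  apply mul_right_cancel₀ h2
  linear_combination h1

/-- The `q² - 1` nonzero `b` orthogonal to `u` give degenerate subalgebras, and S2J2 is the only
degenerate type containing planes of type U. -/
theorem ncard_typeU_S2J2 [Finite F] {U : Submodule F O} (hU : IsTypeU U) :
    ({W ∈ imagSubalgs t .S2J2 | U ≤ W}.ncard : ℚ) = Nat.card F + 1 := by
  haveI := h.moduleFinite
  have hq := one_lt_natCard_cast (F := F)
  obtain ⟨d, hdU, u, huU, hdd, hu, hu0⟩ := h.exists_normal_form_typeU hU
  have hd := h.trace_eq_zero hU.1 hdU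
  have h1 := h.ncard_mul_of_typeU hd hdd hu hu0 hU hdU huU (Y := .S2J2)
    (S := ((peirce t (-d) ⊓ orth t u : Submodule F O) : Set O) \ {0})
    (fun b hb => ⟨hb.1.1, hb.2⟩)
    (fun b hb hb0 Y' W hW hUW hbW => by
      have h3 := h.trace_ne_zero_iff hd hdd hu hu0 hW (hUW hdU) (hUW huU) hb hb0 hbW
      have h4 := h.type_cases hW (X := .U) hU hUW
      have h5 : b ∈ ((peirce t (-d) ⊓ orth t u : Submodule F O) : Set O) \ {0} ↔ t (u * b) = 0 :=
        ⟨fun hb1 => hb1.1.2, fun hb1 => ⟨⟨hb, hb1⟩, hb0⟩⟩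
      rw [h5, ← not_iff_not, ← ne_eq, h3]
      cases Y' <;> simp at h4 ⊢)
  rw [ncard_sdiff_zero, h.finrank_peirce_neg_orth hd hdd hu hu0] at h1
  have h2 : (Nat.card F : ℚ) - 1 ≠ 0 := by linarith
  apply mul_right_cancel₀ h2
  linear_combination h1

end IsCayleyTrace

end SubalgebraCounts

/-! ### Four-dimensional subalgebras containing a plane with zero multiplication -/

section ZeroPlanes

variable [SMulCommClass F O O] [IsScalarTower F O O] {t : O →ₗ[F] F}

/-- The imaginary elements orthogonal to `U`. -/
def imagOrth (t : O →ₗ[F] F) (U : Submodule F O) : Submodule F O where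
  carrier := {x | t x = 0 ∧ ∀ y ∈ U, t (y * x) = 0}
  zero_mem' := by simp
  add_mem' := fun {x y} hx hy =>
    ⟨by rw [map_add, hx.1, hy.1, add_zero],
      fun z hz => by rw [mul_add, map_add, hx.2 z hz, hy.2 z hz, add_zero]⟩
  smul_mem' := fun c x hx =>
    ⟨by rw [map_smul, hx.1, smul_zero],
      fun z hz => by rw [mul_smul_comm, map_smul, hx.2 z hz, smul_zero]⟩

namespace IsCayleyTrace

variable (h : IsCayleyTrace F t)
include h

section

variable {U : Submodule F O} (hU : IsTypeZ U)
include hU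

theorem le_imagOrth : U ≤ imagOrth t U := fun x hx =>
  ⟨h.trace_eq_zero hU.1 hx, fun y hy => by rw [hU.2.2 y hy x hx, map_zero]⟩

theorem mul_mem_of_mem_imagOrth {w : O} (hw : w ∈ imagOrth t U) {x : O} (hx : x ∈ U) :
    x * w ∈ U := by
  haveI := h.moduleFinite
  rcases eq_or_ne x 0 with rfl | hx0
  · rw [zero_mul]; exact U.zero_mem
  obtain ⟨v, hv, hne⟩ := exists_not_smul hU.1.2.ge x
  have hne' : ∀ c : F, x ≠ c • v := fun c hc => by
    have hc0 : c ≠ 0 := by rintro rfl; exact hx0 (by rw [hc, zero_smul])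
    exact hne c⁻¹ (by rw [hc, smul_smul, inv_mul_cancel₀ hc0, one_smul])
  obtain ⟨a, b, hab⟩ := h.mul_mem_of_orthogonal (h.trace_eq_zero hU.1 hx) (hU.2.2 x hx x hx)
    (h.trace_eq_zero hU.1 hv) (hU.2.2 x hx v hv) hne' (by simpa using hne 0) hw.1 (hw.2 x hx)
    (hw.2 v hv)
  rw [hab]
  exact U.add_mem (U.smul_mem a hx) (U.smul_mem b hv)

section Extension

variable {w : O} (hw : w ∈ imagOrth t U) {c : F} (hc : w * w = c • 1)
include hw hc

theorem mul_add_smul {x y : O} (hx : x ∈ U) (hy : y ∈ U) (a b : F) :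
    (x + a • w) * (y + b • w) = (a * b * c) • 1 + (b • (x * w) - a • (y * w)) := by
  have h1 := h.mul_eq_neg (h.trace_eq_zero hU.1 hy) hw.1 (hw.2 y hy)
  simp only [add_mul, mul_add, smul_mul_assoc, mul_smul_comm, hU.2.2 x hx y hy, hc, h1]
  module

theorem trace_mul_add_smul {x y : O} (hx : x ∈ U) (hy : y ∈ U) (a b : F) :
    t ((x + a • w) * (y + b • w)) = a * b * c * 2 := by
  rw [h.mul_add_smul hU hw hc hx hy, map_add, map_sub, map_smul, map_smul, map_smul, hw.2 x hx,
    hw.2 y hy, h.trace_one]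
  simp

omit h hU hw hc in
theorem mem_sup_span {x : O} : x ∈ U ⊔ Submodule.span F {w} ↔ ∃ y ∈ U, ∃ a : F, x = y + a • w := by
  rw [Submodule.mem_sup]
  constructor
  · rintro ⟨y, hy, z, hz, rfl⟩
    obtain ⟨a, rfl⟩ := Submodule.mem_span_singleton.1 hz
    exact ⟨y, hy, a, rfl⟩
  · rintro ⟨y, hy, a, rfl⟩
    exact ⟨y, hy, _, Submodule.smul_mem _ a (Submodule.mem_span_singleton_self w), rfl⟩

/-- `U` absorbs multiplication by its orthogonal space, so adjoining any imaginary `w` orthogonal to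
`U` and outside it gives a subalgebra. Its type is read off from `w²`. -/
theorem isImagSubalgebra_sup_span (hwU : w ∉ U) :
    IsImagSubalgebra t (U ⊔ Submodule.span F {w}) := by
  haveI := h.moduleFinite
  refine ⟨sup_le hU.1.1 ((Submodule.span_singleton_le_iff_mem _ _).2 (h.mem_imag.2 hw.1)),
    by rw [finrank_sup_span hwU, hU.1.2], fun x hxw y hyw => ?_⟩
  obtain ⟨x, hx, a, rfl⟩ := mem_sup_span.1 hxw
  obtain ⟨y, hy, b, rfl⟩ := mem_sup_span.1 hyw
  have hm : b • (x * w) - a • (y * w) ∈ U :=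
    U.sub_mem (U.smul_mem _ (h.mul_mem_of_mem_imagOrth hU hw hx))
      (U.smul_mem _ (h.mul_mem_of_mem_imagOrth hU hw hy))
  rw [h.sub_trace_eq (h.trace_eq_zero hU.1 hm) (h.mul_add_smul hU hw hc hx hy a b)]
  exact Submodule.mem_sup_left hm

omit hc in
theorem sup_span_mem_F1J3 (hc : w * w = 0) (hwU : w ∉ U) :
    U ⊔ Submodule.span F {w} ∈ imagSubalgs t .F1J3 := by
  rw [← zero_smul F (1 : O)] at hc
  refine ⟨h.isImagSubalgebra_sup_span hU hw hc hwU,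
    le_antisymm (fun x hx => hx.1) fun x hxw => ⟨hxw, fun y hyw => ?_⟩⟩
  obtain ⟨x, hx, a, rfl⟩ := mem_sup_span.1 hxw
  obtain ⟨y, hy, b, rfl⟩ := mem_sup_span.1 hyw
  rw [h.trace_mul_add_smul hU hw hc hx hy, mul_zero, zero_mul]

theorem isRankOne_sup_span (hc0 : c ≠ 0) : IsRankOne t w c (U ⊔ Submodule.span F {w}) := by
  refine ⟨Submodule.mem_sup_right (Submodule.mem_span_singleton_self w), hc, hc0,
    fun x hxw hwx => ⟨hxw, fun y hyw => ?_⟩⟩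
  obtain ⟨x, hx, a, rfl⟩ := mem_sup_span.1 hxw
  obtain ⟨y, hy, b, rfl⟩ := mem_sup_span.1 hyw
  have h1 := h.trace_mul_add_smul hU hw hc U.zero_mem hx 1 a
  rw [one_smul, zero_add, hwx, one_mul] at h1
  have ha : a = 0 := by simpa [hc0, h.two] using h1.symm
  rw [h.trace_mul_add_smul hU hw hc hx hy, ha]
  simp

theorem not_mem_of_mul_self (hc0 : c ≠ 0) : w ∉ U := fun hwU =>
  hc0 (h.smul_one_inj (by rw [← hc]; exact hU.2.2 w hwU w hwU))

end Extension

/-- In rank one the radical is the only plane of type Z, in rank zero it is all of `W`, and rank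
three has no such plane. Hence every subalgebra above `U` lies in the orthogonal space of `U`. -/
theorem le_traceRad_of_isTypeZ [Finite F] {W : Submodule F O} (hW : IsImagSubalgebra t W)
    (hUW : U ≤ W) : U ≤ traceRad t W := by
  obtain ⟨Y, hY⟩ := h.exists_mem_imagSubalgs hW
  have hZ : U ∈ planes F O .Z := hU
  have key : ∀ w c, IsRankOne t w c W → U ≤ traceRad t W := fun w c hw => by
    rcases IsRankOne.plane_cases h hW hw hU.1 hUW with h1 | ⟨u, hu, v, hv, -, huv, -⟩
    · exact h1.le
    · exact (huv.2.2.1 (by rw [hU.2.2 v hv v hv, map_zero])).elim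
  have hcases := h.type_cases hY hZ hUW
  cases Y
  · simp at hcases
  · obtain ⟨w, c, hw, -⟩ := hY.2
    exact key w c hw
  · obtain ⟨w, hw⟩ := hY.2
    exact key w 1 hw
  · exact hY.2.symm ▸ hUW

theorem le_imagOrth_of_le [Finite F] {W : Submodule F O} (hW : IsImagSubalgebra t W)
    (hUW : U ≤ W) : W ≤ imagOrth t U := fun x hx =>
  ⟨h.mem_imag.1 (hW.1 hx), fun _ hy => (h.le_traceRad_of_isTypeZ hU hW hUW hy).2 x hx⟩

theorem exists_peirce_of_isTypeZ : ∃ d u v, t d = 0 ∧ d * d = 1 ∧ u ∈ peirce t d ∧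
    v ∈ peirce t (-d) ∧ u ≠ 0 ∧ v ≠ 0 ∧ u * v = 0 ∧ Submodule.span F {u, v} = U := by
  haveI := h.moduleFinite
  obtain ⟨v, hv, hv0⟩ := exists_mem_ne_zero_of_finrank_pos (P := U) (by rw [hU.1.2]; norm_num)
  obtain ⟨u, hu, hne⟩ := exists_not_smul hU.1.2.ge v
  obtain ⟨d, hd, hdd, hud, hvd⟩ := h.exists_peirce_of_isotropic (h.trace_eq_zero hU.1 hu)
    (hU.2.2 u hu u hu) (h.trace_eq_zero hU.1 hv) (hU.2.2 u hu v hv) hne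
  refine ⟨d, u, v, hd, hdd, hud, hvd, by simpa using hne 0, hv0, hU.2.2 u hu v hv, ?_⟩
  rw [Set.pair_comm]
  exact span_pair_eq hU.1.2 hv hu hv0 hne

end

section Orth

variable {d u v : O} (hd : t d = 0) (hdd : d * d = 1) (hu : u ∈ peirce t d)
  (hv : v ∈ peirce t (-d)) (hu0 : u ≠ 0) (hv0 : v ≠ 0) (huv : u * v = 0)
include hd hdd hu hv

theorem range_peirceMap_orth :
    LinearMap.range (peirceMap d (peirce t d ⊓ orth t v) (peirce t (-d) ⊓ orth t u)) =
      imagOrth t (Submodule.span F {u, v}) := by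
  have key : ∀ (c : F) (a b : O), a ∈ peirce t d → b ∈ peirce t (-d) →
      t (u * (c • d + a + b)) = t (u * b) ∧ t (v * (c • d + a + b)) = t (v * a) :=
    fun c a b ha hb => by
      simp only [mul_add, map_add, mul_smul_comm, map_smul, h.peirce_mul hd hu,
        h.peirce_mul_neg hd hv, h.peirce_trace_mul hd hu ha, h.peirce_neg_trace_mul hd hv hb,
        map_neg, hu.1, hv.1]
      simp
  ext x
  rw [mem_range_peirceMap]
  constructor
  · rintro ⟨c, a, b, ⟨ha, hva⟩, ⟨hb, hub⟩, rfl⟩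
    refine ⟨by simp [hd, ha.1, hb.1], fun y hy => ?_⟩
    obtain ⟨α, β, rfl⟩ := Submodule.mem_span_pair.1 hy
    rw [add_mul, smul_mul_assoc, smul_mul_assoc, map_add, map_smul, map_smul,
      (key c a b ha hb).1, (key c a b ha hb).2, mem_orth.1 hva, mem_orth.1 hub]
    simp
  · rintro ⟨hx, hxU⟩
    obtain ⟨a, b, ha, hb, he, -⟩ := h.exists_peirce hd hdd hx
    have h1 := hxU u (Submodule.mem_span_of_mem (by simp))
    have h2 := hxU v (Submodule.mem_span_of_mem (by simp))
    rw [he, (key _ a b ha hb).1] at h1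
    rw [he, (key _ a b ha hb).2] at h2
    exact ⟨_, a, b, ⟨ha, h2⟩, ⟨hb, h1⟩, he⟩

omit hu in
include hv0 in
theorem finrank_peirce_orth : Module.finrank F (peirce t d ⊓ orth t v : Submodule F O) = 2 := by
  have := h.finrank_peirce_neg_orth (d := -d) (by simp [hd]) (by simp [hdd]) hv hv0
  rwa [neg_neg] at this

-- A vector `z` with `t (u * z)` nonzero complements `u^⊥` in the opposite eigenspace. After
-- subtracting the right multiple of `u`, a radical vector is orthogonal to all of that eigenspace,
-- hence zero.
include hu0 hv0 huv in
theorem radical_peirce_orth : {a | a ∈ peirce t d ⊓ orth t v ∧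
    ∀ b ∈ peirce t (-d) ⊓ orth t u, t (a * b) = 0} = (Submodule.span F {u} : Submodule F O) := by
  ext a
  constructor
  · rintro ⟨⟨ha, -⟩, hab⟩
    obtain ⟨z, hz, huz⟩ : ∃ z ∈ peirce t (-d), t (u * z) ≠ 0 := by
      by_contra! hc
      exact hu0 (h.peirce_nondeg hd hdd hu hc)
    refine Submodule.mem_span_singleton.2 ⟨t (a * z) / t (u * z), ?_⟩
    symm
    rw [← sub_eq_zero]
    refine h.peirce_nondeg hd hdd (Submodule.sub_mem _ ha (Submodule.smul_mem _ _ hu))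
      fun b hb => ?_
    have h1 := hab (b - (t (u * b) / t (u * z)) • z)
      ⟨Submodule.sub_mem _ hb (Submodule.smul_mem _ _ hz), by
        change t (u * _) = 0
        rw [mul_sub, mul_smul_comm, map_sub, map_smul, smul_eq_mul,
          div_mul_cancel₀ _ huz, sub_self]⟩
    rw [mul_sub, mul_smul_comm, map_sub, map_smul, smul_eq_mul] at h1
    rw [sub_mul, smul_mul_assoc, map_sub, map_smul, smul_eq_mul]
    linear_combination h1
  · intro ha
    obtain ⟨c, rfl⟩ := Submodule.mem_span_singleton.1 ha
    refine ⟨Submodule.smul_mem _ _ ⟨hu, ?_⟩, fun b hb => ?_⟩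
    · change t (v * u) = 0
      rw [h.comm, huv, map_zero]
    · rw [smul_mul_assoc, map_smul, mem_orth.1 hb.2, smul_zero]

end Orth

section Counts

variable [Finite F] {U : Submodule F O} (hU : IsTypeZ U)
include hU

theorem finrank_imagOrth : Module.finrank F (imagOrth t U) = 5 := by
  obtain ⟨d, u, v, hd, hdd, hu, hv, hu0, hv0, huv, rfl⟩ := h.exists_peirce_of_isTypeZ hU
  rw [← h.range_peirceMap_orth hd hdd hu hv,
    h.finrank_range_peirceMap hd hdd inf_le_left inf_le_left,
    h.finrank_peirce_orth hd hdd hv hv0, h.finrank_peirce_neg_orth hd hdd hu hu0]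

theorem ncard_isotropic_imagOrth :
    {x | x ∈ imagOrth t U ∧ x * x = 0}.ncard = Nat.card F ^ 4 := by
  obtain ⟨d, u, v, hd, hdd, hu, hv, hu0, hv0, huv, rfl⟩ := h.exists_peirce_of_isTypeZ hU
  have := h.ncard_isotropic hd hdd (inf_le_left : peirce t d ⊓ orth t v ≤ _)
    (inf_le_left : peirce t (-d) ⊓ orth t u ≤ _)
  rwa [h.range_peirceMap_orth hd hdd hu hv, h.finrank_peirce_orth hd hdd hv hv0,
    h.finrank_peirce_neg_orth hd hdd hu hu0] at this

omit hU in
theorem ncard_sq_eq_one : {s : F | s ^ 2 = 1}.ncard = 2 := by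
  have h1 : {s : F | s ^ 2 = 1} = {1, -1} := by
    ext s
    change s ^ 2 = 1 ↔ s = 1 ∨ s = -1
    rw [← sq_eq_sq_iff_eq_or_eq_neg, one_pow]
  rw [h1, Set.ncard_pair]
  intro h2
  exact h.two (by linear_combination h2)

theorem ncard_mul_self_eq_one_imagOrth :
    ({x | x ∈ imagOrth t U ∧ x * x = (1 : F) • 1}.ncard : ℚ) =
      (Nat.card F : ℚ) ^ 4 + (Nat.card F : ℚ) ^ 3 := by
  haveI := h.moduleFinite
  obtain ⟨d, u, v, hd, hdd, hu, hv, hu0, hv0, huv, rfl⟩ := h.exists_peirce_of_isTypeZ hU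
  -- Both components have `q²` elements, the radical has `q`, and 1 has two square roots: `q · 2q² +
  -- (q² - q) q² = q⁴ + q³`.
  have h1 := h.ncard_mul_self_eq hd hdd (inf_le_left : peirce t d ⊓ orth t v ≤ _)
    (inf_le_left : peirce t (-d) ⊓ orth t u ≤ _) 1 h.ncard_sq_eq_one
    (by rw [h.radical_peirce_orth hd hdd hu hv hu0 hv0 huv, ncard_submodule,
      finrank_span_singleton hu0, pow_one])
  rw [h.range_peirceMap_orth hd hdd hu hv, ncard_submodule, ncard_submodule,
    h.finrank_peirce_orth hd hdd hv hv0, h.finrank_peirce_neg_orth hd hdd hu hu0] at h1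
  rw [h1]
  push_cast [Nat.cast_sub (Nat.le_self_pow two_ne_zero (Nat.card F))]
  ring

theorem ncard_isImagSubalgebra_of_isTypeZ :
    ({W | IsImagSubalgebra t W ∧ U ≤ W}.ncard : ℚ) = (Nat.card F : ℚ) ^ 2 + Nat.card F + 1 := by
  haveI := h.moduleFinite
  have hq := one_lt_natCard_cast (F := F)
  have h1 := ncard_covers_cast (F := F) hU.1.2 (𝓗 := {W | IsImagSubalgebra t W ∧ U ≤ W})
    (S := (imagOrth t U : Set O) \ (U : Set O)) (fun W hW => ⟨hW.2, hW.1.2.1⟩)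
    (fun x hx => ⟨hx.2, _, ⟨h.isImagSubalgebra_sup_span hU hx.1 (h.mul_self hx.1.1) hx.2,
      le_sup_left⟩, Submodule.mem_sup_right (Submodule.mem_span_singleton_self x)⟩)
    (fun W hW x hx hxU => ⟨h.le_imagOrth_of_le hU hW.1 hW.2 hx, hxU⟩)
  rw [ncard_sdiff_submodule (h.le_imagOrth hU), h.finrank_imagOrth hU, hU.1.2] at h1
  have h2 : (Nat.card F : ℚ) ^ 2 * (Nat.card F - 1) ≠ 0 := by
    have : (0 : ℚ) < Nat.card F - 1 := by linarith
    positivity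
  apply mul_right_cancel₀ h2
  linear_combination h1

/-- The `q⁴ - q²` isotropic vectors outside `U` in its orthogonal space are shared out, `q³ - q²` to
each nil subalgebra. -/
theorem ncard_typeZ_F1J3 :
    ({W ∈ imagSubalgs t .F1J3 | U ≤ W}.ncard : ℚ) = Nat.card F + 1 := by
  haveI := h.moduleFinite
  haveI : Finite O := finite_of_moduleFinite (F := F)
  have hq := one_lt_natCard_cast (F := F)
  have h1 := ncard_covers_cast (F := F) hU.1.2 (𝓗 := {W ∈ imagSubalgs t .F1J3 | U ≤ W})
    (S := {x | x ∈ imagOrth t U ∧ x * x = 0} \ (U : Set O)) (fun W hW => ⟨hW.2, hW.1.1.2.1⟩)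
    (fun x hx => ⟨hx.2, _, ⟨h.sup_span_mem_F1J3 hU hx.1.1 hx.1.2 hx.2,
      le_sup_left⟩, Submodule.mem_sup_right (Submodule.mem_span_singleton_self x)⟩)
    (fun W hW x hx hxU => ⟨⟨h.le_imagOrth_of_le hU hW.1.1 hW.2 hx,
      h.mul_self_eq_zero_of_nil hW.1.1 hW.1.2 hx⟩, hxU⟩)
  have h2 := Set.ncard_sdiff_add_ncard_of_subset (s := (U : Set O))
    (t := {x | x ∈ imagOrth t U ∧ x * x = 0})
    (fun x hx => ⟨h.le_imagOrth hU hx, hU.2.2 x hx x hx⟩)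
  rw [h.ncard_isotropic_imagOrth hU, ncard_submodule, hU.1.2] at h2
  have h3 := congrArg (Nat.cast (R := ℚ)) h2
  push_cast at h3
  have h4 : (Nat.card F : ℚ) ^ 2 * (Nat.card F - 1) ≠ 0 := by
    have : (0 : ℚ) < Nat.card F - 1 := by linarith
    positivity
  apply mul_right_cancel₀ h4
  linear_combination h1 + h3

omit hU in
theorem IsRankOne.ncard_mul_self_eq_one {W : Submodule F O} (hW : IsImagSubalgebra t W) {w : O}
    (hw : IsRankOne t w 1 W) :
    {x | x ∈ W ∧ x * x = (1 : F) • 1}.ncard = 2 * Nat.card F ^ 2 := by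
  haveI := h.moduleFinite
  have hdd : w * w = 1 := by rw [hw.2.1, one_smul]
  have h1 := h.ncard_mul_self_eq (h.mem_imag.1 (hW.1 hw.1)) hdd
    (inf_le_right : W ⊓ peirce t w ≤ _) (inf_le_right : W ⊓ peirce t (-w) ≤ _) 1
    h.ncard_sq_eq_one rfl
  have h2 : {a | a ∈ W ⊓ peirce t w ∧ ∀ b ∈ W ⊓ peirce t (-w), t (a * b) = 0} =
      (W ⊓ peirce t w : Submodule F O) := by
    ext a
    exact ⟨fun ha => ha.1, fun ha => ⟨ha, fun b hb =>
      (h.inf_peirce_le_traceRad hW hw ha).2 b hb.1⟩⟩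
  obtain ⟨h3, h4⟩ := h.finrank_split hW hw
  rw [h.range_peirceMap_inf hW hw.1 hdd, h2, ncard_submodule, ncard_submodule, h3, h4] at h1
  rw [h1, Nat.sub_self]
  ring

/-- Each of the `q⁴ + q³` square roots of 1 orthogonal to `U` spans with `U` exactly one split
subalgebra, and each of these contains `2q²` such roots. -/
theorem ncard_typeZ_S2J2 : ({W ∈ imagSubalgs t .S2J2 | U ≤ W}.ncard : ℚ) =
    ((Nat.card F : ℚ) ^ 2 + Nat.card F) / 2 := by
  haveI := h.moduleFinite
  haveI : Finite O := finite_of_moduleFinite (F := F)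
  haveI : Finite (Submodule F O) := finite_submodule
  have hq := one_lt_natCard_cast (F := F)
  have h1 := ncard_mul_eq_ncard_mul_cast (A := {W ∈ imagSubalgs t .S2J2 | U ≤ W})
    (B := {x | x ∈ imagOrth t U ∧ x * x = (1 : F) • 1}) (fun W x => x ∈ W)
    (m := ((2 * Nat.card F ^ 2 : ℕ) : ℚ)) (n := ((1 : ℕ) : ℚ)) (fun W hW => ?_) (fun x hx => ?_)
  · rw [h.ncard_mul_self_eq_one_imagOrth hU] at h1
    push_cast at h1
    have h2 : (Nat.card F : ℚ) ^ 2 * 2 ≠ 0 := by positivity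
    apply mul_right_cancel₀ h2
    linear_combination h1
  · obtain ⟨⟨hI, w, hw⟩, hUW⟩ := hW
    rw [← IsRankOne.ncard_mul_self_eq_one h hI hw]
    congr 2
    ext x
    exact ⟨fun hx => ⟨hx.2, hx.1.2⟩, fun hx => ⟨⟨h.le_imagOrth_of_le hU hI hUW hx.1, hx.2⟩, hx.1⟩⟩
  · obtain ⟨hxU, hxx⟩ := hx
    have hx := h.not_mem_of_mul_self hU hxU hxx one_ne_zero
    congr 1
    refine ncard_eq_one_of_existsUnique ⟨U ⊔ Submodule.span F {x},
      ⟨⟨⟨h.isImagSubalgebra_sup_span hU hxU hxx hx, x,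
        h.isRankOne_sup_span hU hxU hxx one_ne_zero⟩, le_sup_left⟩,
        Submodule.mem_sup_right (Submodule.mem_span_singleton_self x)⟩, fun W hW => ?_⟩
    exact (eq_sup_span hW.1.2 hW.2 hx (by rw [hU.1.2, hW.1.1.1.2.1])).symm

end Counts

/-- The numbers `H_{X,Y}`. -/
theorem ncard_imagSubalgs_ge [Finite F] (X : PlaneType) (Y : SubalgType) {U : Submodule F O}
    (hX : U ∈ planes F O X) :
    ({W ∈ imagSubalgs t Y | U ≤ W}.ncard : ℚ) = hTable (Nat.card F : ℚ) X Y := by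
  have hsum := congrArg (Nat.cast (R := ℚ)) (h.ncard_imagSubalgs_sum (U ≤ ·))
  push_cast at hsum
  have hcases := fun Y W (hY : W ∈ imagSubalgs t Y) => h.type_cases hY hX
  have h0 : ∀ Y, (∀ W ∈ imagSubalgs t Y, ¬ U ≤ W) →
      ({W ∈ imagSubalgs t Y | U ≤ W}.ncard : ℚ) = 0 := fun Y hY => by
    have : {W ∈ imagSubalgs t Y | U ≤ W} = ∅ := by
      rw [Set.eq_empty_iff_forall_notMem]
      exact fun W hW => hY W hW.1 hW.2
    rw [this, Set.ncard_empty, Nat.cast_zero]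
  -- For types other than U and Z the total is 1 and a single subalgebra type is possible. For Z,
  -- the entry for F2J2 is the total `q² + q + 1` minus the two counted entries.
  have h1 : X ≠ .U → X ≠ .Z → ({W | IsImagSubalgebra t W ∧ U ≤ W}.ncard : ℚ) = 1 :=
    fun hXU hXZ => by
      obtain ⟨W, hW, hW'⟩ := h.existsUnique_imagSubalgebra hX hXU hXZ
      rw [ncard_eq_one_of_existsUnique ⟨W, hW, fun W' h2 => hW' W' h2.1 h2.2⟩, Nat.cast_one]
  cases X
  · have hF := h0 .F2J2 fun W h2 h3 => by simpa using hcases _ W h2 h3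
    have hS := h0 .S2J2 fun W h2 h3 => by simpa using hcases _ W h2 h3
    have hJ := h0 .F1J3 fun W h2 h3 => by simpa using hcases _ W h2 h3
    have := h1 (by simp) (by simp)
    cases Y <;> simp only [hTable] <;> linarith
  · have hF := h0 .F2J2 fun W h2 h3 => by simpa using hcases _ W h2 h3
    have hJ := h0 .F1J3 fun W h2 h3 => by simpa using hcases _ W h2 h3
    have hM := h.ncard_typeU_M4 hX
    have hS := h.ncard_typeU_S2J2 hX
    cases Y <;> simp only [hTable] <;> linarith
  · have hM := h0 .M4 fun W h2 h3 => by simpa using hcases _ W h2 h3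
    have hS := h0 .S2J2 fun W h2 h3 => by simpa using hcases _ W h2 h3
    have hJ := h0 .F1J3 fun W h2 h3 => by simpa using hcases _ W h2 h3
    have := h1 (by simp) (by simp)
    cases Y <;> simp only [hTable] <;> linarith
  · have hM := h0 .M4 fun W h2 h3 => by simpa using hcases _ W h2 h3
    have hF := h0 .F2J2 fun W h2 h3 => by simpa using hcases _ W h2 h3
    have hJ := h0 .F1J3 fun W h2 h3 => by simpa using hcases _ W h2 h3
    have := h1 (by simp) (by simp)
    cases Y <;> simp only [hTable] <;> linarith
  · have hF := h0 .F2J2 fun W h2 h3 => by simpa using hcases _ W h2 h3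
    have hS := h0 .S2J2 fun W h2 h3 => by simpa using hcases _ W h2 h3
    have hJ := h0 .F1J3 fun W h2 h3 => by simpa using hcases _ W h2 h3
    have := h1 (by simp) (by simp)
    cases Y <;> simp only [hTable] <;> linarith
  · have hM := h0 .M4 fun W h2 h3 => by simpa using hcases _ W h2 h3
    have hF := h0 .F2J2 fun W h2 h3 => by simpa using hcases _ W h2 h3
    have hS := h0 .S2J2 fun W h2 h3 => by simpa using hcases _ W h2 h3
    have := h1 (by simp) (by simp)
    cases Y <;> simp only [hTable] <;> linarith
  · have hM := h0 .M4 fun W h2 h3 => by simpa using hcases _ W h2 h3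
    have hS := h.ncard_typeZ_S2J2 hX
    have hJ := h.ncard_typeZ_F1J3 hX
    have := h.ncard_isImagSubalgebra_of_isTypeZ hX
    cases Y <;> simp only [hTable] <;> linarith

end IsCayleyTrace

end ZeroPlanes

/-! ### The numbers of planes and of four-dimensional subalgebras -/

section Totals

variable [SMulCommClass F O O] [IsScalarTower F O O] {t : O →ₗ[F] F}

/-- The imaginary elements annihilated by left multiplication by `u`. -/
def imagAnnihilator (t : O →ₗ[F] F) (u : O) : Submodule F O :=
  LinearMap.ker t ⊓ LinearMap.ker (LinearMap.mulLeft F u)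

theorem mem_imagAnnihilator {u x : O} : x ∈ imagAnnihilator t u ↔ t x = 0 ∧ u * x = 0 := Iff.rfl

namespace IsCayleyTrace

variable (h : IsCayleyTrace F t)
include h

/-- `0 = (ux)x = u x²` is a scalar multiple of `u`, the scalar being `x²`. -/
theorem mul_self_eq_zero_of_mul_eq_zero {u x : O} (hu0 : u ≠ 0) (hx : t x = 0) (hux : u * x = 0) :
    x * x = 0 := by
  have h1 := h.right_alt x u
  rw [hux, zero_mul, h.mul_self hx, mul_smul_comm, mul_one] at h1
  rw [h.mul_self hx, (smul_eq_zero.1 h1.symm).resolve_right hu0, zero_smul]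

/-- With `d` chosen so that `d * u = u`, the annihilator is `Fu` plus the two-dimensional orthogonal
space of `u` in the opposite eigenspace. -/
theorem finrank_imagAnnihilator {u : O} (hu : t u = 0) (huu : u * u = 0) (hu0 : u ≠ 0) :
    Module.finrank F (imagAnnihilator t u) = 3 := by
  haveI := h.moduleFinite
  obtain ⟨d, hd, hdd, hud⟩ := h.exists_peirce_mem hu huu hu0
  have h1 : u ∉ peirce t (-d) ⊓ orth t u := fun hm => hu0 (h.disjoint_peirce hd hud hm.1)
  have h2 : (peirce t (-d) ⊓ orth t u) ⊔ Submodule.span F {u} = imagAnnihilator t u := by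
    apply le_antisymm
    · refine sup_le (fun b hb => mem_imagAnnihilator.2 ⟨hb.1.1, ?_⟩)
        ((Submodule.span_singleton_le_iff_mem _ _).2 ⟨hu, huu⟩)
      rw [h.peirce_mul_peirce_neg hd hdd hud hb.1, mem_orth.1 hb.2, zero_div, zero_smul]
    · rintro x ⟨hx, hux⟩
      obtain ⟨c, b, hb, hub, rfl⟩ := h.exists_of_peirce_mul_eq_zero hd hdd hud hu0 hx hux
      rw [add_comm]
      exact Submodule.add_mem_sup ⟨hb, hub⟩
        (Submodule.smul_mem _ c (Submodule.mem_span_singleton_self u))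
  rw [← h2, finrank_sup_span h1, h.finrank_peirce_neg_orth hd hdd hud hu0]

theorem isTypeZ_span_pair {u x : O} (hu : t u = 0) (huu : u * u = 0) (hu0 : u ≠ 0)
    (hx : x ∈ imagAnnihilator t u) (hxu : x ∉ Submodule.span F {u}) :
    IsTypeZ (Submodule.span F {u, x}) := by
  haveI := h.moduleFinite
  rw [h.isTypeZ_iff]
  have hne : ∀ c : F, x ≠ c • u := fun c hc =>
    hxu (Submodule.mem_span_singleton.2 ⟨c, hc.symm⟩)
  refine ⟨⟨?_, finrank_span_pair hu0 hne⟩, fun y hy z hz => ?_⟩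
  · rw [Submodule.span_le]
    rintro y (rfl | rfl)
    · exact h.mem_imag.2 hu
    · exact h.mem_imag.2 hx.1
  · obtain ⟨a, b, rfl⟩ := Submodule.mem_span_pair.1 hy
    obtain ⟨c, e, rfl⟩ := Submodule.mem_span_pair.1 hz
    have hux : u * x = 0 := hx.2
    have hxu : x * u = 0 := by rw [h.mul_eq_neg hu hx.1 (by rw [hux, map_zero]), hux, neg_zero]
    simp only [add_mul, mul_add, smul_mul_assoc, mul_smul_comm, hux, hxu, huu,
      h.mul_self_eq_zero_of_mul_eq_zero hu0 hx.1 hux, smul_zero, add_zero]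

section

variable [Finite F]

/-- The planes of type Z through `u` are the planes through `u` in its three-dimensional
annihilator. -/
theorem ncard_typeZ_through {u : O} (hu : t u = 0) (huu : u * u = 0) (hu0 : u ≠ 0) :
    ({U ∈ planes F O .Z | u ∈ U}.ncard : ℚ) = Nat.card F + 1 := by
  haveI := h.moduleFinite
  have hq := one_lt_natCard_cast (F := F)
  have hle : Submodule.span F {u} ≤ imagAnnihilator t u :=
    (Submodule.span_singleton_le_iff_mem _ _).2 ⟨hu, huu⟩
  have h1 := ncard_covers_cast (F := F) (finrank_span_singleton (K := F) hu0)
    (𝓗 := {U ∈ planes F O .Z | u ∈ U})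
    (S := (imagAnnihilator t u : Set O) \ (Submodule.span F {u} : Submodule F O))
    (fun U hU => ⟨(Submodule.span_singleton_le_iff_mem _ _).2 hU.2, hU.1.1.2⟩)
    (fun x hx => ⟨hx.2, _, ⟨h.isTypeZ_span_pair hu huu hu0 hx.1 hx.2,
      Submodule.mem_span_of_mem (by simp)⟩, Submodule.mem_span_of_mem (by simp)⟩)
    (fun U hU x hx hxu => ⟨⟨h.trace_eq_zero hU.1.1 hx, hU.1.2.2 u hU.2 x hx⟩, hxu⟩)
  rw [ncard_sdiff_submodule hle, h.finrank_imagAnnihilator hu huu hu0,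
    finrank_span_singleton hu0] at h1
  have h2 : (Nat.card F : ℚ) * (Nat.card F - 1) ≠ 0 := by
    have : (0 : ℚ) < Nat.card F - 1 := by linarith
    positivity
  apply mul_right_cancel₀ h2
  linear_combination h1

theorem ncard_isotropic_imag {d : O} (hd : t d = 0) (hdd : d * d = 1) :
    (({x | x ∈ imag F O ∧ x * x = 0} \ {0}).ncard : ℚ) = (Nat.card F : ℚ) ^ 6 - 1 := by
  haveI := h.moduleFinite
  haveI : Finite O := finite_of_moduleFinite (F := F)
  have h1 := h.ncard_isotropic hd hdd le_rfl le_rfl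
  rw [h.range_peirceMap hd hdd, h.finrank_peirce hd hdd, h.finrank_peirce_neg hd hdd] at h1
  have h2 := Set.ncard_sdiff_singleton_add_one (s := {x | x ∈ imag F O ∧ x * x = 0}) (a := (0 : O))
    ⟨Submodule.zero_mem _, by simp⟩
  rw [h1] at h2
  have h3 := congrArg (Nat.cast (R := ℚ)) h2
  push_cast at h3
  linear_combination h3

/-- Incidences with nonzero isotropic vectors give `Θ_Z (q² - 1) = (q⁶ - 1)(q + 1)`. This is the
only total that needs a direct count. -/
theorem ncard_planes_Z {d : O} (hd : t d = 0) (hdd : d * d = 1) :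
    ((planes F O .Z).ncard : ℚ) = thetaTable (Nat.card F : ℚ) .Z := by
  haveI := h.moduleFinite
  haveI : Finite O := finite_of_moduleFinite (F := F)
  haveI : Finite (Submodule F O) := finite_submodule
  have hq := one_lt_natCard_cast (F := F)
  have h1 := ncard_mul_eq_ncard_mul_cast (A := planes F O .Z)
    (B := {x | x ∈ imag F O ∧ x * x = 0} \ {0}) (fun U x => x ∈ U)
    (m := (Nat.card F : ℚ) ^ 2 - 1) (n := (Nat.card F : ℚ) + 1) (fun U hU => ?_) (fun x hx => ?_)
  · rw [h.ncard_isotropic_imag hd hdd] at h1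
    have h2 : (Nat.card F : ℚ) ^ 2 - 1 ≠ 0 := by
      have : (1 : ℚ) < Nat.card F ^ 2 := one_lt_pow₀ hq two_ne_zero
      linarith
    apply mul_right_cancel₀ h2
    rw [h1]
    simp only [thetaTable, qNum, Finset.sum_range_succ, Finset.sum_range_zero]
    ring
  · have h2 := ncard_sdiff_zero (F := F) U
    rw [hU.1.2] at h2
    rw [← h2]
    congr 2
    ext x
    exact ⟨fun hx => ⟨hx.2, hx.1.2⟩, fun hx => ⟨⟨⟨hU.1.1 hx.1, hU.2.2 x hx.1 x hx.1⟩, hx.2⟩, hx.1⟩⟩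
  · exact h.ncard_typeZ_through (h.mem_imag.1 hx.1.1) hx.1.2 hx.2

/-- Counting the incidences between planes and four-dimensional subalgebras. -/
theorem ncard_planes_mul (X : PlaneType) (Y : SubalgType) :
    ((planes F O X).ncard : ℚ) * hTable (Nat.card F : ℚ) X Y =
      ((imagSubalgs t Y).ncard : ℚ) * tTable (Nat.card F : ℚ) X Y := by
  haveI := h.moduleFinite
  haveI : Finite O := finite_of_moduleFinite (F := F)
  haveI : Finite (Submodule F O) := finite_submodule
  exact ncard_mul_eq_ncard_mul_cast (fun U W => U ≤ W)
    (fun U hU => h.ncard_imagSubalgs_ge X Y hU) (fun W hW => h.ncard_planes_le X Y hW)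

/-- The numbers `N_Y` and `Θ_X`. -/
theorem ncard_imagSubalgs_and_planes {d : O} (hd : t d = 0) (hdd : d * d = 1) :
    (∀ Y, ((imagSubalgs t Y).ncard : ℚ) = nTable (Nat.card F : ℚ) Y) ∧
      ∀ X, ((planes F O X).ncard : ℚ) = thetaTable (Nat.card F : ℚ) X := by
  have hq := one_lt_natCard_cast (F := F)
  have hZ := h.ncard_planes_Z hd hdd
  have hZF := h.ncard_planes_mul .Z .F2J2
  have hZS := h.ncard_planes_mul .Z .S2J2
  have hZJ := h.ncard_planes_mul .Z .F1J3
  have hDn := h.ncard_planes_mul .Dn .F2J2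
  have hDs := h.ncard_planes_mul .Ds .S2J2
  have hJ := h.ncard_planes_mul .J .F1J3
  have hUS := h.ncard_planes_mul .U .S2J2
  have hUM := h.ncard_planes_mul .U .M4
  have hQ := h.ncard_planes_mul .Q .M4
  have hM := h.ncard_planes_mul .M .M4
  simp only [hTable, tTable, thetaTable, qNum, Finset.sum_range_succ, Finset.sum_range_zero,
    mul_one] at hZ hZF hZS hZJ hDn hDs hJ hUS hUM hQ hM
  generalize (Nat.card F : ℚ) = q at *
  have hq1 : q + 1 ≠ 0 := by linarith
  -- The incidence equations are solved along a chain: `Θ_Z` gives the three degenerate subalgebra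
  -- counts; these give Dn, Ds, J and U; the count for U gives M4, which gives Q and M.
  rw [hZ] at hZF hZS hZJ
  have nF : ((imagSubalgs t .F2J2).ncard : ℚ) = (q ^ 7 - q) / 2 := by linear_combination -hZF
  have nS : ((imagSubalgs t .S2J2).ncard : ℚ) = (q ^ 7 + 2 * q ^ 6 + 2 * q ^ 5 + 2 * q ^ 4 +
      2 * q ^ 3 + 2 * q ^ 2 + q) / 2 := by linear_combination -hZS
  have nJ : ((imagSubalgs t .F1J3).ncard : ℚ) = q ^ 5 + q ^ 4 + q ^ 3 + q ^ 2 + q + 1 := by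
    apply mul_right_cancel₀ hq1
    linear_combination -hZJ
  rw [nF] at hDn
  rw [nS] at hDs hUS
  rw [nJ] at hJ
  have nU : ((planes F O .U).ncard : ℚ) = q ^ 7 + q ^ 6 + q ^ 5 + q ^ 4 + q ^ 3 + q ^ 2 := by
    apply mul_right_cancel₀ hq1
    linear_combination hUS
  rw [nU] at hUM
  have nM : ((imagSubalgs t .M4).ncard : ℚ) = q ^ 8 + q ^ 6 + q ^ 4 := by
    apply mul_right_cancel₀ hq1
    linear_combination -hUM
  rw [nM] at hQ hM
  constructor
  · intro Y
    cases Y <;> simp only [nTable] <;> assumption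
  · intro X
    cases X <;> simp only [thetaTable, qNum, Finset.sum_range_succ, Finset.sum_range_zero]
    · linear_combination hQ
    · linear_combination nU
    · linear_combination hDn
    · linear_combination hDs
    · linear_combination hM
    · linear_combination hJ
    · linear_combination hZ

end

/-! ### Subalgebras and their imaginary parts -/

/-- Taking imaginary parts is a bijection with inverse `W ↦ F1 + W`; a condition on the imaginary
part is carried along for use with `U ≤ ·`. -/
theorem ncard_subalgs (Y : SubalgType) (P : Submodule F O → Prop) :
    {H ∈ subalgs F O Y | P (H ⊓ imag F O)}.ncard = {W ∈ imagSubalgs t Y | P W}.ncard := by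
  refine Set.ncard_congr (fun H _ => H ⊓ imag F O) (fun H hH => ?_) (fun H H' hH hH' he => ?_)
    (fun W hW => ?_)
  · exact ⟨((h.mem_subalgs_iff Y).1 hH.1).2, hH.2⟩
  · rw [← h.sup_inf_imag ((h.mem_subalgs_iff Y).1 hH.1).1,
      ← h.sup_inf_imag ((h.mem_subalgs_iff Y).1 hH'.1).1]
    exact congrArg _ he
  · have h1 := h.inf_imag_sup (h.IsImagSubalgebra_type hW.1).1
    refine ⟨Submodule.span F {1} ⊔ W, ⟨(h.mem_subalgs_iff Y).2
      ⟨Submodule.mem_sup_left (Submodule.mem_span_singleton_self 1), ?_⟩, ?_⟩, h1⟩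
    · rw [h1]; exact hW.1
    · rw [h1]; exact hW.2

theorem mem_blocks {W : Submodule F O} : W ∈ blocks F O ↔ IsImagSubalgebra t W := by
  constructor
  · rintro ⟨H, hH, rfl⟩
    exact (h.isSubalgebra4_iff.1 hH).2
  · intro hW
    have h1 := h.inf_imag_sup hW.1
    refine ⟨Submodule.span F {1} ⊔ W, h.isSubalgebra4_iff.2
      ⟨Submodule.mem_sup_left (Submodule.mem_span_singleton_self 1), ?_⟩, h1.symm⟩
    rw [h1]; exact hW

theorem ncard_subalgs_eq (Y : SubalgType) : (subalgs F O Y).ncard = (imagSubalgs t Y).ncard := by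
  simpa using h.ncard_subalgs Y fun _ => True

theorem ncard_blocks [Finite F] : (blocks F O).ncard =
    (subalgs F O .M4).ncard + (subalgs F O .F2J2).ncard + (subalgs F O .S2J2).ncard +
      (subalgs F O .F1J3).ncard := by
  have h1 := h.ncard_imagSubalgs_sum fun _ => True
  have h2 : blocks F O = {W | IsImagSubalgebra t W ∧ True} := by
    ext W
    rw [h.mem_blocks]
    simp
  rw [h2, h1, h.ncard_subalgs_eq, h.ncard_subalgs_eq, h.ncard_subalgs_eq, h.ncard_subalgs_eq]
  simp only [and_true, Set.ofPred_mem_eq]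
  ring

/-- Every row of the table of the `H_{X,Y}` has a nonzero entry, so each plane lies in some block.
-/
theorem isCoveringDesign [Finite F] : IsCoveringDesign (imag F O) (blocks F O) 7 3 2 := by
  refine ⟨h.finrank_imag, fun B hB => ?_, fun U hU hr => ?_⟩
  · have := h.mem_blocks.1 hB
    exact ⟨this.1, this.2.1⟩
  · have hq := one_lt_natCard_cast (F := F)
    obtain ⟨X, hX⟩ := h.exists_mem_planes (U := U) ⟨hU, hr⟩
    obtain ⟨Y, hY⟩ : ∃ Y, hTable (Nat.card F : ℚ) X Y ≠ 0 := by
      have : (Nat.card F : ℚ) + 1 ≠ 0 := by linarith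
      cases X
      exacts [⟨.M4, one_ne_zero⟩, ⟨.S2J2, this⟩, ⟨.F2J2, one_ne_zero⟩, ⟨.S2J2, one_ne_zero⟩,
        ⟨.M4, one_ne_zero⟩, ⟨.F1J3, one_ne_zero⟩, ⟨.F1J3, this⟩]
    rw [← h.ncard_imagSubalgs_ge X Y hX] at hY
    obtain ⟨W, hW⟩ := Set.nonempty_of_ncard_ne_zero (Nat.cast_ne_zero.1 hY)
    exact ⟨W, h.mem_blocks.2 (h.IsImagSubalgebra_type hW.1), hW.2⟩

end IsCayleyTrace

end Totals

/-! ### Arithmetic of `q` and the final assembly. -/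

/-- If `2 = 0`, then `1` has additive order 2, which would divide the odd order of `F`. -/
theorem two_ne_zero_of_odd_natCard [Finite F] (hF : Odd (Nat.card F)) : (2 : F) ≠ 0 := fun h2 => by
  have h1 : addOrderOf (1 : F) = 2 :=
    addOrderOf_eq_prime (by rw [nsmul_one]; exact_mod_cast h2) one_ne_zero
  have h3 := addOrderOf_dvd_natCard (1 : F)
  rw [h1] at h3
  exact Nat.not_even_iff_odd.2 hF (even_iff_two_dvd.2 h3)

theorem qBinom_six_two {q : ℚ} (hq : 0 < q) : qBinom q 6 2 =
    q ^ 8 + q ^ 7 + 2 * q ^ 6 + 2 * q ^ 5 + 3 * q ^ 4 + 2 * q ^ 3 + 2 * q ^ 2 + q + 1 := by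
  simp only [qBinom, qFactorial, qNum, Nat.reduceSub, Finset.prod_range_succ,
    Finset.prod_range_zero, Finset.sum_range_succ, Finset.sum_range_zero]
  rw [div_eq_iff (by positivity)]
  ring

end CayleyDesign

theorem mainTheorem9 {F O : Type*} [Field F] [Finite F] (q : ℕ) (hq : Nat.card F = q)
    (hodd : Odd q) [NonAssocRing O] [Module F O] [SMulCommClass F O O] [IsScalarTower F O O]
    [CayleyDesign.InvolutiveAlgebra F O] (hO : CayleyDesign.IsCayleyAlgebra F O) :
    -- the blocks form a `(7, 3, 2)`-`q`-covering design, and their number is the stated one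
    CayleyDesign.IsCoveringDesign (CayleyDesign.imag F O) (CayleyDesign.blocks F O) 7 3 2 ∧
    (CayleyDesign.blocks F O).ncard =
      (CayleyDesign.subalgs F O .M4).ncard + (CayleyDesign.subalgs F O .F2J2).ncard +
        (CayleyDesign.subalgs F O .S2J2).ncard + (CayleyDesign.subalgs F O .F1J3).ncard ∧
    (CayleyDesign.blocks F O).ncard =
      q ^ 8 + q ^ 7 + 2 * q ^ 6 + 2 * q ^ 5 + 3 * q ^ 4 + 2 * q ^ 3 + 2 * q ^ 2 + q + 1 ∧
    ((CayleyDesign.blocks F O).ncard : ℚ) = CayleyDesign.qBinom q 6 2 ∧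
    -- the numbers `Θ_X` of subspaces of type `X`
    (∀ X, ((CayleyDesign.planes F O X).ncard : ℚ) = CayleyDesign.thetaTable q X) ∧
    -- the numbers `N_Y` of subalgebras of type `Y`
    (∀ Y, ((CayleyDesign.subalgs F O Y).ncard : ℚ) = CayleyDesign.nTable q Y) ∧
    -- the numbers `H_{X,Y}` of subalgebras of type `Y` containing a fixed subspace of type `X`
    (∀ X Y, ∀ U ∈ CayleyDesign.planes F O X,
      (({H ∈ CayleyDesign.subalgs F O Y | U ≤ H}.ncard : ℕ) : ℚ) = CayleyDesign.hTable q X Y) ∧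
    -- the numbers `T_{X,Y}` of subspaces of type `X` in a fixed subalgebra of type `Y`
    (∀ X Y, ∀ H ∈ CayleyDesign.subalgs F O Y,
      (({U ∈ CayleyDesign.planes F O X | U ≤ H}.ncard : ℕ) : ℚ) = CayleyDesign.tTable q X Y) := by
  subst hq
  obtain ⟨t, h, d, hd, hdd⟩ := hO.exists_trace (CayleyDesign.two_ne_zero_of_odd_natCard hodd)
  have hq := CayleyDesign.one_lt_natCard_cast (F := F)
  obtain ⟨hN, hΘ⟩ := h.ncard_imagSubalgs_and_planes hd hdd
  have hN' : ∀ Y, ((CayleyDesign.subalgs F O Y).ncard : ℚ) =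
      CayleyDesign.nTable (Nat.card F : ℚ) Y := fun Y => by rw [h.ncard_subalgs_eq, hN]
  have hB : ((CayleyDesign.blocks F O).ncard : ℚ) = (Nat.card F : ℚ) ^ 8 + (Nat.card F : ℚ) ^ 7 +
      2 * (Nat.card F : ℚ) ^ 6 + 2 * (Nat.card F : ℚ) ^ 5 + 3 * (Nat.card F : ℚ) ^ 4 +
        2 * (Nat.card F : ℚ) ^ 3 + 2 * (Nat.card F : ℚ) ^ 2 + Nat.card F + 1 := by
    rw [h.ncard_blocks]
    push_cast
    rw [hN', hN', hN', hN']
    simp only [CayleyDesign.nTable]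
    ring
  refine ⟨h.isCoveringDesign, h.ncard_blocks, by exact_mod_cast hB, ?_, hΘ, hN',
    fun X Y U hU => ?_, fun X Y H hH => ?_⟩
  · rw [hB, CayleyDesign.qBinom_six_two (by linarith)]
  · rw [← h.ncard_imagSubalgs_ge X Y hU, ← h.ncard_subalgs Y (U ≤ ·)]
    -- An imaginary plane lies in `H` exactly when it lies in the imaginary part of `H`.
    simp only [le_inf_iff, (h.isImagPlane_of_mem_planes hU).1, and_true]
  · rw [← h.ncard_planes_le X Y ((h.mem_subalgs_iff Y).1 hH).2]
    congr 2
    ext U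
    exact and_congr_right fun hU => ⟨fun hUH => le_inf hUH (h.isImagPlane_of_mem_planes hU).1,
      fun hUH => hUH.trans inf_le_left⟩
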